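/- Fix finitely many graphs $G_1,\dots,G_s$ ($s\ge 1$), where $G_i$ has vertex set $\{1,\dots,|V_i|\}$ and edge set $E_i$, and $G_1$ is a single edge on two vertices. Fix real numbers $\beta_1\in\mathbb R$ and $\beta_i\ge 0$ for $2\le i\le s$. For a graph $X$ on the vertex set $\{1,\dots,n\}$ let $N_{G_i}(X)$ be the number of tuples $(v_1,\dots,v_{|V_i|})$ of distinct vertices of $X$ such that $v_av_b$ is an edge of $X$ whenever $ab\in E_i$, and define the Gibbs measure $$p_n(X)=\frac1{Z_n}\exp\Big(\sum_{i=1}^s\beta_i\frac{N_{G_i}(X)}{n^{|V_i|-2}}\Big)$$ on the set of all graphs on $\{1,\dots,n\}$, where $Z_n$ is the normalizing constant. The Glauber dynamics is the discrete-time Markov chain on these graphs which, from state $X$, chooses one of the $\binom n2$ possible edges $e$ uniformly at random and moves to $X_{e+}$ ($X$ with $e$ present) or to $X_{e-}$ ($X$ with $e$ absent) with probabilities proportional to $p_n(X_{e+})$ and $p_n(X_{e-})$. Its mixing time $\tau_{\mathrm{mix}}(n)$ is the least number of steps $t$ such that, from every initial state, the distribution of the chain after $t$ steps is within total variation distance $e^{-1}$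 of $p_n$. Put $$\Psi_\beta(p)=\sum_{i=1}^s2\beta_i|E_i|p^{|E_i|-1},\qquad \varphi_\beta(p)=\frac{e^{\Psi_\beta(p)}}{1+e^{\Psi_\beta(p)}}.$$ Suppose that $\beta$ is in the high temperature phase, that is, the equation $\varphi_\beta(p)=p$ has a unique solution $p^*\in[0,1]$, and $\varphi_\beta'(p^*)<1$. Then $$\tau_{\mathrm{mix}}(n)=\Theta(n^2\log n)\qquad(n\to\infty),$$ where the implied constants may depend on $G_1,\dots,G_s$ and $\beta$, but not on $n$. -/

import Mathlib

open Filter Asymptotics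

namespace ERGM

noncomputable section

/-- The Hamiltonian `H(X) = ∑ i, β i * N_{G i}(X) / n ^ (|V i| - 2)` of a graph `X` on `n` labelled
vertices.  Here `G i` is a graph on `V i` labelled vertices, and `N_{G i}(X)` is the number of tuples
of distinct vertices `(v_1, …, v_m)` of `X`, `m = V i`, such that `v_a v_b` is an edge of `X`
whenever `a b` is an edge of `G i`; this is the number of labelled copies of `G i` in `X`. -/
def hamiltonian {ι : Type*} [Fintype ι] (V : ι → ℕ) (G : (i : ι) → SimpleGraph (Fin (V i)))
    (β : ι → ℝ) {n : ℕ} (X : SimpleGraph (Fin n)) : ℝ :=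
  ∑ i, β i * ((X.labelledCopyCount (G i) : ℝ) / (n : ℝ) ^ ((V i : ℤ) - 2))

/-- The Gibbs measure: the probability `p_n(X) = exp (H(X)) / Z_n` of the graph `X`. -/
def gibbs {ι : Type*} [Fintype ι] (V : ι → ℕ) (G : (i : ι) → SimpleGraph (Fin (V i)))
    (β : ι → ℝ) {n : ℕ} (X : SimpleGraph (Fin n)) : ℝ :=
  Real.exp (hamiltonian V G β X) / ∑ Y : SimpleGraph (Fin n), Real.exp (hamiltonian V G β Y)

/-- `X_{e+}`: the graph that has the edge `e` and agrees with `X` at all other edges. -/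
def addEdge {n : ℕ} (X : SimpleGraph (Fin n)) (e : Sym2 (Fin n)) : SimpleGraph (Fin n) :=
  X ⊔ SimpleGraph.fromEdgeSet {e}

/-- `X_{e-}`: the graph that does not have the edge `e` and agrees with `X` at all other edges. -/
def removeEdge {n : ℕ} (X : SimpleGraph (Fin n)) (e : Sym2 (Fin n)) : SimpleGraph (Fin n) :=
  X.deleteEdges {e}

open Classical in
/-- The transition matrix of the Glauber dynamics on the graphs on `n` labelled vertices: one of the
`n.choose 2` possible edges `e` is chosen uniformly at random, and then the new state is `X_{e+}` or
`X_{e-}` with probabilities proportional to `p_n(X_{e+})` and `p_n(X_{e-})`. -/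
def glauber {ι : Type*} [Fintype ι] (V : ι → ℕ) (G : (i : ι) → SimpleGraph (Fin (V i)))
    (β : ι → ℝ) (n : ℕ) : Matrix (SimpleGraph (Fin n)) (SimpleGraph (Fin n)) ℝ :=
  fun X Y ↦ (n.choose 2 : ℝ)⁻¹ * ∑ e ∈ (⊤ : SimpleGraph (Fin n)).edgeFinset,
    ((if Y = addEdge X e then
        gibbs V G β (addEdge X e) / (gibbs V G β (addEdge X e) + gibbs V G β (removeEdge X e))
      else 0) +
     (if Y = removeEdge X e then
        gibbs V G β (removeEdge X e) / (gibbs V G β (addEdge X e) + gibbs V G β (removeEdge X e))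
      else 0))

/-- The total variation distance of two probability mass functions on a finite set. -/
def tvDist {S : Type*} [Fintype S] (μ ν : S → ℝ) : ℝ := (1 / 2) * ∑ x, |μ x - ν x|

open Classical in
/-- The mixing time of a Markov chain on a finite set with transition matrix `P` and stationary
distribution `π`: the least number of steps `t` after which the chain, from any initial state `x`,
is within total variation distance `e⁻¹` of `π`. -/
def mixingTime {S : Type*} [Fintype S] (P : Matrix S S ℝ) (π : S → ℝ) : ℕ :=
  sInf {t : ℕ | ∀ x : S, tvDist ((P ^ t) x) π ≤ Real.exp (-1)}

/-- `Ψ_β(p) = ∑ i, 2 β_i |E_i| p ^ (|E_i| - 1)`, where `E_i` is the edge set of `G i`. -/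
def Psi {ι : Type*} [Fintype ι] (V : ι → ℕ) (G : (i : ι) → SimpleGraph (Fin (V i)))
    (β : ι → ℝ) (p : ℝ) : ℝ :=
  ∑ i, 2 * β i * ((G i).edgeSet.ncard : ℝ) * p ^ ((G i).edgeSet.ncard - 1)

/-- `φ_β(p) = exp (Ψ_β(p)) / (1 + exp (Ψ_β(p)))`. -/
def phi {ι : Type*} [Fintype ι] (V : ι → ℕ) (G : (i : ι) → SimpleGraph (Fin (V i)))
    (β : ι → ℝ) (p : ℝ) : ℝ :=
  Real.exp (Psi V G β p) / (1 + Real.exp (Psi V G β p))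

/-- The high temperature phase: `φ_β` has a unique fixed point `p⋆` in `[0, 1]`, and
`φ_β'(p⋆) < 1`. -/
def HighTemperature {ι : Type*} [Fintype ι] (V : ι → ℕ) (G : (i : ι) → SimpleGraph (Fin (V i)))
    (β : ι → ℝ) : Prop :=
  ∃ p ∈ Set.Icc (0 : ℝ) 1, phi V G β p = p ∧
    (∀ q ∈ Set.Icc (0 : ℝ) 1, phi V G β q = q → q = p) ∧ deriv (phi V G β) p < 1

end

end ERGM

/-!
The Glauber dynamics is attractive: the conditional probability `rate e X` of an edge is increasing
in `X`, because negative coefficients occur only at the single edge. All estimates are made for the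
Markov operator `upd` of the dynamics acting on functions; no coupling and no path space is needed.

*Burn-in* (`Reaches`). If all rooted subgraph densities of the graph are at most those of the
binomial random graph of density `q`, then every edge is switched on with probability at most about
`φ(q)`, so the dynamics is dominated by independent updates with parameter `φ(q)`
(`upd_rate_pow_bad_le`). In order `n ^ 2` steps the independent updates bring all densities down to
those of density `φ(q)`, up to an exponentially small probability; this is a McDiarmid inequality
along the chain (`EdgeLip.upd_pow_tail`, `exists_upd_const_pow_bad_le`). Since `φ` has a unique fixed
point, a bounded number of such stages (`Reaches.step`, `Reaches.of_gap`) leads from density one to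
any neighbourhood of `p⋆` from above, and from density zero to any neighbourhood from below.

*Contraction.* For `X ≤ Y` let `edgeGap t X Y` be the difference of the expected numbers of edges
after `t` steps. Between graphs that are good from below and from above, the sum of the update rates
grows at most by `φ'(p⋆) + o(1)` per additional edge (`Attractive.totalRate_sub_le_of_isGood`). As
`φ'(p⋆) < 1`, the gap shrinks by a factor `1 - c / n ^ 2` per step after burn-in
(`Attractive.edgeGap_succ_le`), so it is small after order `n ^ 2 * log n` steps. By attractivity the
gap controls every bounded observable (`Attractive.upd_pow_sub_le_edgeGap`) and thus the distance
to the stationary Gibbs measure.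

*Lower bound.* By attractivity, too, the gap between the empty and the complete graph is at least
`(1 - 1 / N) ^ t * N`, where `N = n.choose 2` (`Attractive.le_edgeGap`). A single edge influences
the expected number of edges after `t` steps by at most `exp (O(t / n ^ 2))`, which bounds the
variance of that number (`Attractive.edgeCount_variance_le`). For `t = c * n ^ 2 * log n` with small
`c` the standard deviation is much smaller than the gap, and the two initial states are still told
apart by the number of edges.
-/

namespace ERGM

noncomputable section

open scoped Classical

/-! ### Markov operators on functions -/

/-- A Markov operator on the real functions on `S`: linear, order preserving, and fixing constants.
For finite `S` these are the operators `f ↦ P *ᵥ f` of stochastic matrices `P`. -/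
structure IsMarkov {S : Type*} (L : Module.End ℝ (S → ℝ)) : Prop where
  mono : ∀ ⦃f g : S → ℝ⦄, f ≤ g → L f ≤ L g
  one : L 1 = 1

section Markov
variable {S : Type*} {L : Module.End ℝ (S → ℝ)}

lemma IsMarkov.pow (hL : IsMarkov L) (t : ℕ) : IsMarkov (L ^ t) := by
  induction t with
  | zero => exact ⟨fun f g h ↦ by simpa using h, by simp⟩
  | succ t ih =>
    refine ⟨fun f g h ↦ ?_, ?_⟩
    · simpa [pow_succ] using ih.mono (hL.mono h)
    · simp [pow_succ, hL.one, ih.one]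

lemma IsMarkov.const (hL : IsMarkov L) (c : ℝ) : L (fun _ ↦ c) = fun _ ↦ c := by
  have : (fun _ : S ↦ c) = c • (1 : S → ℝ) := by ext; simp
  rw [this, map_smul, hL.one]

lemma IsMarkov.le_const (hL : IsMarkov L) {f : S → ℝ} {c : ℝ} (h : ∀ x, f x ≤ c) (x : S) :
    L f x ≤ c := by
  have := hL.mono (show f ≤ fun _ ↦ c from h) x
  rwa [hL.const] at this

lemma IsMarkov.const_le (hL : IsMarkov L) {f : S → ℝ} {c : ℝ} (h : ∀ x, c ≤ f x) (x : S) :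
    c ≤ L f x := by
  have := hL.mono (show (fun _ ↦ c) ≤ f from h) x
  rwa [hL.const] at this

lemma IsMarkov.nonneg (hL : IsMarkov L) {f : S → ℝ} (h : 0 ≤ f) : 0 ≤ L f :=
  fun x ↦ hL.const_le h x

lemma IsMarkov.abs_le (hL : IsMarkov L) {f : S → ℝ} {c : ℝ} (h : ∀ x, |f x| ≤ c) (x : S) :
    |L f x| ≤ c :=
  _root_.abs_le.2 ⟨hL.const_le (fun x ↦ (_root_.abs_le.1 (h x)).1) x,
    hL.le_const (fun x ↦ (_root_.abs_le.1 (h x)).2) x⟩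

/-- Duhamel comparison of two Markov chains: if one step of `L` exceeds one step of `Q` by at most
`b` on the functions `Q ^ s f`, the excesses add up along the chain `L`. -/
lemma IsMarkov.pow_le_add_sum (hL : IsMarkov L) (Q : Module.End ℝ (S → ℝ)) (f b : S → ℝ)
    (h : ∀ s : ℕ, L ((Q ^ s) f) ≤ Q ((Q ^ s) f) + b) (t : ℕ) :
    (L ^ t) f ≤ (Q ^ t) f + ∑ u ∈ Finset.range t, (L ^ u) b := by
  induction t with
  | zero => simp
  | succ t ih =>
    have h1 := hL.mono ih
    rw [map_add, map_sum] at h1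
    have e1 : L ((L ^ t) f) = (L ^ (t + 1)) f := by simp [pow_succ']
    have e2 : Q ((Q ^ t) f) = (Q ^ (t + 1)) f := by simp [pow_succ']
    have e3 : ∑ u ∈ Finset.range t, L ((L ^ u) b) = ∑ u ∈ Finset.range t, (L ^ (u + 1)) b :=
      Finset.sum_congr rfl fun u _ ↦ by simp [pow_succ']
    rw [Finset.sum_range_succ', ← e1, ← e2, ← e3]
    intro x
    have := h1 x
    have := h t x
    simp only [Pi.add_apply, pow_zero, Module.End.one_apply] at *
    linarith

end Markov

/-! ### Graphs as edge configurations -/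

section Graphs
variable {n : ℕ}

/-- The set of the possible edges of a graph on `n` labelled vertices. -/
def edges (n : ℕ) : Finset (Sym2 (Fin n)) := (⊤ : SimpleGraph (Fin n)).edgeFinset

/-- The indicator of the presence of the edge `e` in the graph `X`. -/
def ind (X : SimpleGraph (Fin n)) (e : Sym2 (Fin n)) : ℝ := if e ∈ X.edgeSet then 1 else 0

lemma mem_edges {e : Sym2 (Fin n)} : e ∈ edges n ↔ ¬ e.IsDiag := by
  simp [edges]

lemma card_edges (n : ℕ) : (edges n).card = n.choose 2 := by
  unfold edges
  convert SimpleGraph.card_edgeFinset_top_eq_card_choose_two (V := Fin n)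
  simp

lemma ind_nonneg (X : SimpleGraph (Fin n)) (e : Sym2 (Fin n)) : 0 ≤ ind X e := by
  unfold ind; split_ifs <;> norm_num

lemma ind_le_one (X : SimpleGraph (Fin n)) (e : Sym2 (Fin n)) : ind X e ≤ 1 := by
  unfold ind; split_ifs <;> norm_num

lemma ind_mono {X Y : SimpleGraph (Fin n)} (h : X ≤ Y) (e : Sym2 (Fin n)) :
    ind X e ≤ ind Y e := by
  unfold ind
  have := SimpleGraph.edgeSet_mono h
  split_ifs with h1 h2
  · rfl
  · exact absurd (this h1) h2
  · norm_num
  · rfl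

lemma mem_addEdge {X : SimpleGraph (Fin n)} {e e' : Sym2 (Fin n)} (he : e ∈ edges n) :
    e' ∈ (addEdge X e).edgeSet ↔ e' = e ∨ e' ∈ X.edgeSet := by
  rw [mem_edges] at he
  simp only [addEdge, SimpleGraph.edgeSet_sup, SimpleGraph.edgeSet_fromEdgeSet, Set.mem_union,
    Set.mem_sdiff, Set.mem_singleton_iff, Sym2.mem_diagSet]
  constructor
  · tauto
  · rintro (rfl | h) <;> tauto

lemma mem_removeEdge {X : SimpleGraph (Fin n)} {e e' : Sym2 (Fin n)} :
    e' ∈ (removeEdge X e).edgeSet ↔ e' ≠ e ∧ e' ∈ X.edgeSet := by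
  simp only [removeEdge, SimpleGraph.edgeSet_deleteEdges, Set.mem_sdiff, Set.mem_singleton_iff]
  tauto

lemma ind_addEdge (X : SimpleGraph (Fin n)) {e : Sym2 (Fin n)} (he : e ∈ edges n)
    (e' : Sym2 (Fin n)) : ind (addEdge X e) e' = if e' = e then 1 else ind X e' := by
  simp only [ind, mem_addEdge he]
  split_ifs <;> tauto

lemma ind_removeEdge (X : SimpleGraph (Fin n)) (e e' : Sym2 (Fin n)) :
    ind (removeEdge X e) e' = if e' = e then 0 else ind X e' := by
  simp only [ind, mem_removeEdge]
  split_ifs <;> tauto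

lemma le_addEdge (X : SimpleGraph (Fin n)) (e : Sym2 (Fin n)) : X ≤ addEdge X e := le_sup_left

lemma removeEdge_le (X : SimpleGraph (Fin n)) (e : Sym2 (Fin n)) : removeEdge X e ≤ X :=
  SimpleGraph.deleteEdges_le _

lemma removeEdge_le_addEdge (X : SimpleGraph (Fin n)) (e : Sym2 (Fin n)) :
    removeEdge X e ≤ addEdge X e := (removeEdge_le X e).trans (le_addEdge X e)

lemma addEdge_mono {X Y : SimpleGraph (Fin n)} (h : X ≤ Y) (e : Sym2 (Fin n)) :
    addEdge X e ≤ addEdge Y e := sup_le_sup_right h _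

lemma removeEdge_mono {X Y : SimpleGraph (Fin n)} (h : X ≤ Y) (e : Sym2 (Fin n)) :
    removeEdge X e ≤ removeEdge Y e := SimpleGraph.deleteEdges_mono h

lemma addEdge_of_mem {X : SimpleGraph (Fin n)} {e : Sym2 (Fin n)} (he : e ∈ edges n)
    (h : e ∈ X.edgeSet) : addEdge X e = X := by
  rw [← SimpleGraph.edgeSet_inj]; ext e'; rw [mem_addEdge he]
  constructor
  · rintro (rfl | h') <;> assumption
  · exact Or.inr

lemma removeEdge_of_notMem {X : SimpleGraph (Fin n)} {e : Sym2 (Fin n)}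
    (h : e ∉ X.edgeSet) : removeEdge X e = X := by
  rw [← SimpleGraph.edgeSet_inj]; ext e'; rw [mem_removeEdge]
  constructor
  · exact And.right
  · exact fun h' ↦ ⟨fun h2 ↦ h (h2 ▸ h'), h'⟩

lemma addEdge_comm (X : SimpleGraph (Fin n)) {e e' : Sym2 (Fin n)} :
    addEdge (addEdge X e) e' = addEdge (addEdge X e') e := by
  simp only [addEdge, sup_right_comm]

lemma addEdge_removeEdge_comm (X : SimpleGraph (Fin n)) {e e' : Sym2 (Fin n)}
    (he : e ∈ edges n) (h : e ≠ e') :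
    addEdge (removeEdge X e') e = removeEdge (addEdge X e) e' := by
  rw [← SimpleGraph.edgeSet_inj]; ext x
  simp only [mem_addEdge he, mem_removeEdge]
  constructor
  · rintro (rfl | ⟨h1, h2⟩) <;> tauto
  · tauto

lemma removeEdge_comm (X : SimpleGraph (Fin n)) (e e' : Sym2 (Fin n)) :
    removeEdge (removeEdge X e) e' = removeEdge (removeEdge X e') e := by
  rw [← SimpleGraph.edgeSet_inj]; ext x
  simp only [mem_removeEdge]; tauto

@[simp] lemma addEdge_addEdge (X : SimpleGraph (Fin n)) (e : Sym2 (Fin n)) :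
    addEdge (addEdge X e) e = addEdge X e := by
  simp [addEdge]

@[simp] lemma addEdge_removeEdge (X : SimpleGraph (Fin n)) {e : Sym2 (Fin n)}
    (he : e ∈ edges n) : addEdge (removeEdge X e) e = addEdge X e := by
  rw [← SimpleGraph.edgeSet_inj]; ext x
  simp only [mem_addEdge he, mem_removeEdge]; tauto

@[simp] lemma removeEdge_addEdge (X : SimpleGraph (Fin n)) {e : Sym2 (Fin n)}
    (he : e ∈ edges n) : removeEdge (addEdge X e) e = removeEdge X e := by
  rw [← SimpleGraph.edgeSet_inj]; ext x
  simp only [mem_addEdge he, mem_removeEdge]; tauto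

@[simp] lemma removeEdge_removeEdge (X : SimpleGraph (Fin n)) (e : Sym2 (Fin n)) :
    removeEdge (removeEdge X e) e = removeEdge X e := by
  rw [← SimpleGraph.edgeSet_inj]; ext x
  simp only [mem_removeEdge]; tauto

/-- The number of edges of a graph, as a real number. -/
def edgeCount (X : SimpleGraph (Fin n)) : ℝ := ∑ e ∈ edges n, ind X e

lemma edgeCount_mono : Monotone (edgeCount (n := n)) :=
  fun _ _ h ↦ Finset.sum_le_sum fun e _ ↦ ind_mono h e

lemma edgeCount_nonneg (X : SimpleGraph (Fin n)) : 0 ≤ edgeCount X :=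
  Finset.sum_nonneg fun e _ ↦ ind_nonneg X e

lemma edgeCount_le (X : SimpleGraph (Fin n)) : edgeCount X ≤ n.choose 2 := by
  rw [← card_edges]
  simpa [edgeCount] using Finset.sum_le_sum (s := edges n) fun e _ ↦ ind_le_one X e

lemma edgeCount_bot : edgeCount (⊥ : SimpleGraph (Fin n)) = 0 := by
  simp [edgeCount, ind]

lemma edgeCount_top : edgeCount (⊤ : SimpleGraph (Fin n)) = n.choose 2 := by
  rw [← card_edges, edgeCount, Finset.sum_congr rfl (g := fun _ ↦ 1)]
  · simp
  · intro e he
    rw [mem_edges] at he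
    simp [ind, he]

lemma edgeCount_add_one_le {X Y : SimpleGraph (Fin n)} (h : X < Y) :
    edgeCount X + 1 ≤ edgeCount Y := by
  obtain ⟨e, h1, h2⟩ := Set.exists_of_ssubset (SimpleGraph.edgeSet_strict_mono h)
  have he : e ∈ edges n := mem_edges.2 (Y.not_isDiag_of_mem_edgeSet h1)
  have h3 : edgeCount Y - edgeCount X = ∑ e ∈ edges n, (ind Y e - ind X e) := by
    simp [edgeCount]
  have h4 := Finset.single_le_sum (f := fun e ↦ ind Y e - ind X e)
    (fun e _ ↦ sub_nonneg.2 (ind_mono h.le e)) he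
  simp only [ind, h1, h2, if_true, if_false] at h4
  simp only [ind] at h3
  linarith

end Graphs

/-! ### Single-edge updates -/

section Updates
variable {n : ℕ}

/-- The Markov operator of the single-edge update dynamics with rates `r`: a uniformly random edge
`e` is made present with probability `r e X` and absent otherwise. -/
def upd (r : Sym2 (Fin n) → SimpleGraph (Fin n) → ℝ) : Module.End ℝ (SimpleGraph (Fin n) → ℝ) where
  toFun f X := (n.choose 2 : ℝ)⁻¹ *
    ∑ e ∈ edges n, (r e X * f (addEdge X e) + (1 - r e X) * f (removeEdge X e))
  map_add' f g := by
    ext X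
    simp only [Pi.add_apply, ← mul_add, ← Finset.sum_add_distrib]
    congr 1
    exact Finset.sum_congr rfl fun e _ ↦ by ring
  map_smul' c f := by
    ext X
    simp only [Pi.smul_apply, smul_eq_mul, RingHom.id_apply, Finset.mul_sum]
    exact Finset.sum_congr rfl fun e _ ↦ by ring

lemma upd_apply (r : Sym2 (Fin n) → SimpleGraph (Fin n) → ℝ) (f : SimpleGraph (Fin n) → ℝ)
    (X : SimpleGraph (Fin n)) : upd r f X = (n.choose 2 : ℝ)⁻¹ *
      ∑ e ∈ edges n, (r e X * f (addEdge X e) + (1 - r e X) * f (removeEdge X e)) := rfl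

/-- The update rates are probabilities. -/
def IsRate (r : Sym2 (Fin n) → SimpleGraph (Fin n) → ℝ) : Prop :=
  ∀ e X, 0 ≤ r e X ∧ r e X ≤ 1

lemma choose_two_pos (hn : 2 ≤ n) : (0 : ℝ) < n.choose 2 := by
  exact_mod_cast Nat.choose_pos hn

lemma avg_const (hn : 2 ≤ n) (c : ℝ) :
    (n.choose 2 : ℝ)⁻¹ * ∑ _e ∈ edges n, c = c := by
  have := choose_two_pos hn
  rw [Finset.sum_const, card_edges, nsmul_eq_mul]
  field_simp

lemma avg_le_avg {F F' : Sym2 (Fin n) → ℝ} (h : ∀ e ∈ edges n, F e ≤ F' e) :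
    (n.choose 2 : ℝ)⁻¹ * ∑ e ∈ edges n, F e ≤ (n.choose 2 : ℝ)⁻¹ * ∑ e ∈ edges n, F' e :=
  mul_le_mul_of_nonneg_left (Finset.sum_le_sum h) (by positivity)

variable {r : Sym2 (Fin n) → SimpleGraph (Fin n) → ℝ}

lemma isMarkov_upd (hn : 2 ≤ n) (hr : IsRate r) : IsMarkov (upd r) where
  mono f g h X := by
    refine avg_le_avg fun e _ ↦ ?_
    exact add_le_add (mul_le_mul_of_nonneg_left (h _) (hr e X).1)
      (mul_le_mul_of_nonneg_left (h _) (sub_nonneg.2 (hr e X).2))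
  one := by
    ext X
    rw [upd_apply]
    simpa using avg_const hn 1

/-- Attractive dynamics preserve increasing functions. -/
lemma upd_monotone (hr : IsRate r) (hm : ∀ e ∈ edges n, Monotone (r e))
    {f : SimpleGraph (Fin n) → ℝ} (hf : Monotone f) : Monotone (upd r f) := by
  intro X Y h
  refine avg_le_avg fun e he ↦ ?_
  have h1 := hf (addEdge_mono h e)
  have h2 := hf (removeEdge_mono h e)
  have h3 := hf (removeEdge_le_addEdge Y e)
  have h4 := hm e he h
  nlinarith [hr e X, hr e Y, mul_le_mul_of_nonneg_left h1 (hr e X).1,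
    mul_le_mul_of_nonneg_left h2 (sub_nonneg.2 (hr e X).2)]

lemma upd_pow_monotone (hr : IsRate r) (hm : ∀ e ∈ edges n, Monotone (r e))
    {f : SimpleGraph (Fin n) → ℝ} (hf : Monotone f) (t : ℕ) : Monotone ((upd r ^ t) f) := by
  induction t with
  | zero => simpa using hf
  | succ t ih => simpa [pow_succ'] using upd_monotone hr hm ih

lemma edgeCount_addEdge (X : SimpleGraph (Fin n)) {e : Sym2 (Fin n)} (he : e ∈ edges n) :
    edgeCount (addEdge X e) = edgeCount X + (1 - ind X e) := by
  unfold edgeCount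
  rw [← sub_eq_iff_eq_add', ← Finset.sum_sub_distrib,
    Finset.sum_eq_single_of_mem e he]
  · simp [ind_addEdge X he]
  · intro b _ hb
    simp [ind_addEdge X he, hb]

lemma edgeCount_removeEdge (X : SimpleGraph (Fin n)) {e : Sym2 (Fin n)} (he : e ∈ edges n) :
    edgeCount (removeEdge X e) = edgeCount X - ind X e := by
  unfold edgeCount
  rw [eq_sub_iff_add_eq, ← eq_sub_iff_add_eq', ← Finset.sum_sub_distrib,
    Finset.sum_eq_single_of_mem e he]
  · simp [ind_removeEdge]
  · intro b _ hb
    simp [ind_removeEdge, hb]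

lemma upd_edgeCount (hn : 2 ≤ n) (X : SimpleGraph (Fin n)) :
    upd r edgeCount X = (1 - (n.choose 2 : ℝ)⁻¹) * edgeCount X
      + (n.choose 2 : ℝ)⁻¹ * ∑ e ∈ edges n, r e X := by
  have h : ∀ e ∈ edges n, r e X * edgeCount (addEdge X e)
      + (1 - r e X) * edgeCount (removeEdge X e) = edgeCount X + (r e X - ind X e) := by
    intro e he
    rw [edgeCount_addEdge X he, edgeCount_removeEdge X he]; ring
  rw [upd_apply, Finset.sum_congr rfl h, Finset.sum_add_distrib, mul_add, avg_const hn,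
    Finset.sum_sub_distrib]
  change _ + _ * (_ - edgeCount X) = _
  ring

/-! ### Concentration for update dynamics -/

/-- `c e` bounds the influence of the edge `e` on the function `g`. -/
def EdgeLip (c : Sym2 (Fin n) → ℝ) (g : SimpleGraph (Fin n) → ℝ) : Prop :=
  ∀ X, ∀ e ∈ edges n, |g (addEdge X e) - g (removeEdge X e)| ≤ c e

lemma eq_addEdge_or_eq_removeEdge (X : SimpleGraph (Fin n)) {e : Sym2 (Fin n)}
    (he : e ∈ edges n) : X = addEdge X e ∨ X = removeEdge X e := by
  by_cases h : e ∈ X.edgeSet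
  · exact Or.inl (addEdge_of_mem he h).symm
  · exact Or.inr (removeEdge_of_notMem h).symm

lemma EdgeLip.nonneg {c : Sym2 (Fin n) → ℝ} {g : SimpleGraph (Fin n) → ℝ} (h : EdgeLip c g)
    {e : Sym2 (Fin n)} (he : e ∈ edges n) : 0 ≤ c e := (abs_nonneg _).trans (h ⊥ e he)

lemma EdgeLip.smul_sign {c : Sym2 (Fin n) → ℝ} {g : SimpleGraph (Fin n) → ℝ} (h : EdgeLip c g)
    {s : ℝ} (hs : |s| = 1) : EdgeLip c (fun X ↦ s * g X) := by
  intro X e he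
  rw [← mul_sub, abs_mul, hs, one_mul]
  exact h X e he

lemma EdgeLip.abs_addEdge_sub {c : Sym2 (Fin n) → ℝ} {g : SimpleGraph (Fin n) → ℝ}
    (h : EdgeLip c g) (X : SimpleGraph (Fin n)) {e : Sym2 (Fin n)} (he : e ∈ edges n) :
    |g (addEdge X e) - g X| ≤ c e := by
  rcases eq_addEdge_or_eq_removeEdge X he with h1 | h1
  · rw [← h1]; simpa using h.nonneg he
  · nth_rewrite 2 [h1]; exact h X e he

lemma EdgeLip.abs_removeEdge_sub {c : Sym2 (Fin n) → ℝ} {g : SimpleGraph (Fin n) → ℝ}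
    (h : EdgeLip c g) (X : SimpleGraph (Fin n)) {e : Sym2 (Fin n)} (he : e ∈ edges n) :
    |g (removeEdge X e) - g X| ≤ c e := by
  rcases eq_addEdge_or_eq_removeEdge X he with h1 | h1
  · nth_rewrite 2 [h1]; rw [abs_sub_comm]; exact h X e he
  · rw [← h1]; simpa using h.nonneg he

/-- Independent updates do not increase the influence of any edge. -/
lemma EdgeLip.upd_const (hn : 2 ≤ n) {c : Sym2 (Fin n) → ℝ} {g : SimpleGraph (Fin n) → ℝ}
    (h : EdgeLip c g) {q : ℝ} (h0 : 0 ≤ q) (h1 : q ≤ 1) :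
    EdgeLip c (upd (fun _ _ ↦ q) g) := by
  intro X e he
  rw [upd_apply, upd_apply, ← mul_sub, ← Finset.sum_sub_distrib, abs_mul,
    abs_of_nonneg (by positivity : (0 : ℝ) ≤ (n.choose 2 : ℝ)⁻¹)]
  refine (mul_le_mul_of_nonneg_left (Finset.abs_sum_le_sum_abs _ _) (by positivity)).trans ?_
  refine (avg_le_avg (F' := fun _ ↦ c e) fun e' he' ↦ ?_).trans (avg_const hn _).le
  by_cases hee : e = e'
  · subst hee
    simp only [addEdge_addEdge, addEdge_removeEdge _ he, removeEdge_addEdge _ he,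
      removeEdge_removeEdge, sub_self, abs_zero]
    exact h.nonneg he
  · have a1 := h (addEdge X e') e he
    have a2 := h (removeEdge X e') e he
    rw [addEdge_comm (X := X) (e := e) (e' := e'),
      ← addEdge_removeEdge_comm X he hee, addEdge_removeEdge_comm X he' (Ne.symm hee),
      removeEdge_comm X e e']
    rw [show ∀ a b a' b' : ℝ, q * a + (1 - q) * b - (q * a' + (1 - q) * b') =
      q * (a - a') + (1 - q) * (b - b') from fun a b a' b' ↦ by ring]
    rw [abs_le] at *
    constructor <;> nlinarith

/-- One step of an update dynamics increases the logarithmic exponential moment of `g` by at most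
a sub-Gaussian amount. -/
lemma EdgeLip.upd_exp_le (hn : 2 ≤ n) (hr : IsRate r) {c : Sym2 (Fin n) → ℝ}
    {g : SimpleGraph (Fin n) → ℝ} (h : EdgeLip c g) {l : ℝ} (hl : 0 ≤ l)
    (hc : ∀ e ∈ edges n, l * c e ≤ 1) (X : SimpleGraph (Fin n)) :
    upd r (fun Y ↦ Real.exp (l * g Y)) X ≤
      Real.exp (l * upd r g X + l ^ 2 * ((n.choose 2 : ℝ)⁻¹ * ∑ e ∈ edges n, c e ^ 2)) := by
  have key : ∀ d k : ℝ, |d| ≤ k → l * k ≤ 1 → Real.exp (l * d) ≤ 1 + l * d + l ^ 2 * k ^ 2 := by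
    intro d k hd hk
    have h1 : |l * d| ≤ 1 := by
      rw [abs_mul, abs_of_nonneg hl]
      exact (mul_le_mul_of_nonneg_left hd hl).trans hk
    have h2 := (abs_le.1 (Real.abs_exp_sub_one_sub_id_le h1)).2
    have h3 : d ^ 2 ≤ k ^ 2 := sq_le_sq' (by linarith [(abs_le.1 hd).1]) (abs_le.1 hd).2
    nlinarith [mul_le_mul_of_nonneg_left h3 (sq_nonneg l)]
  have step : upd r (fun Y ↦ Real.exp (l * (g Y - g X))) X ≤
      1 + l * (upd r g X - g X) + l ^ 2 * ((n.choose 2 : ℝ)⁻¹ * ∑ e ∈ edges n, c e ^ 2) := by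
    have : 1 + l * (upd r g X - g X) + l ^ 2 * ((n.choose 2 : ℝ)⁻¹ * ∑ e ∈ edges n, c e ^ 2)
        = (n.choose 2 : ℝ)⁻¹ * ∑ e ∈ edges n, (1 - l * g X + l * (r e X * g (addEdge X e) +
          (1 - r e X) * g (removeEdge X e)) + l ^ 2 * c e ^ 2) := by
      rw [Finset.sum_add_distrib, Finset.sum_add_distrib, mul_add, mul_add, avg_const hn,
        upd_apply, ← Finset.mul_sum, ← Finset.mul_sum]
      ring
    rw [this]
    refine avg_le_avg fun e he ↦ ?_
    have h1 := key _ _ (h.abs_addEdge_sub X he) (hc e he)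
    have h2 := key _ _ (h.abs_removeEdge_sub X he) (hc e he)
    nlinarith [mul_le_mul_of_nonneg_left h1 (hr e X).1,
      mul_le_mul_of_nonneg_left h2 (sub_nonneg.2 (hr e X).2)]
  have e1 : (fun Y ↦ Real.exp (l * g Y)) =
      Real.exp (l * g X) • fun Y ↦ Real.exp (l * (g Y - g X)) := by
    ext Y
    rw [Pi.smul_apply, smul_eq_mul, ← Real.exp_add]
    congr 1; ring
  rw [e1, map_smul, Pi.smul_apply, smul_eq_mul]
  calc _ ≤ Real.exp (l * g X) * Real.exp (l * (upd r g X - g X)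
        + l ^ 2 * ((n.choose 2 : ℝ)⁻¹ * ∑ e ∈ edges n, c e ^ 2)) := by
        refine mul_le_mul_of_nonneg_left (step.trans ?_) (Real.exp_pos _).le
        linarith [Real.add_one_le_exp (l * (upd r g X - g X)
          + l ^ 2 * ((n.choose 2 : ℝ)⁻¹ * ∑ e ∈ edges n, c e ^ 2))]
    _ = _ := by rw [← Real.exp_add]; congr 1; ring

lemma EdgeLip.upd_pow_exp_le (hn : 2 ≤ n) {q : ℝ} (h0 : 0 ≤ q) (h1 : q ≤ 1)
    {c : Sym2 (Fin n) → ℝ} {l : ℝ} (hl : 0 ≤ l) (hc : ∀ e ∈ edges n, l * c e ≤ 1) (t : ℕ) :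
    ∀ {g : SimpleGraph (Fin n) → ℝ}, EdgeLip c g → ∀ X,
    (upd (fun _ _ ↦ q) ^ t) (fun Y ↦ Real.exp (l * g Y)) X ≤
      Real.exp (l * (upd (fun _ _ ↦ q) ^ t) g X
        + t * (l ^ 2 * ((n.choose 2 : ℝ)⁻¹ * ∑ e ∈ edges n, c e ^ 2))) := by
  have hr : IsRate (fun (_ : Sym2 (Fin n)) (_ : SimpleGraph (Fin n)) ↦ q) := fun _ _ ↦ ⟨h0, h1⟩
  set v := l ^ 2 * ((n.choose 2 : ℝ)⁻¹ * ∑ e ∈ edges n, c e ^ 2) with hv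
  induction t with
  | zero => intro g _ X; simp
  | succ t ih =>
    intro g h X
    have hM := (isMarkov_upd hn hr).pow t
    have s1 : upd (fun _ _ ↦ q) (fun Y ↦ Real.exp (l * g Y)) ≤
        Real.exp v • fun Y ↦ Real.exp (l * upd (fun _ _ ↦ q) g Y) := by
      intro Y
      rw [Pi.smul_apply, smul_eq_mul, ← Real.exp_add, add_comm v]
      exact h.upd_exp_le hn hr hl hc Y
    have s2 := hM.mono s1 X
    rw [map_smul, Pi.smul_apply, smul_eq_mul] at s2
    have s3 := ih (h.upd_const hn h0 h1) X
    rw [pow_succ, Module.End.mul_apply, Module.End.mul_apply]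
    refine s2.trans ((mul_le_mul_of_nonneg_left s3 (Real.exp_pos _).le).trans ?_)
    rw [← Real.exp_add]
    refine Real.exp_le_exp.2 ?_
    push_cast
    linarith

/-- Chernoff bound for independent updates: a McDiarmid inequality along the chain. -/
lemma EdgeLip.upd_pow_tail (hn : 2 ≤ n) {q : ℝ} (h0 : 0 ≤ q) (h1 : q ≤ 1)
    {c : Sym2 (Fin n) → ℝ} {l : ℝ} (hl : 0 ≤ l) (hc : ∀ e ∈ edges n, l * c e ≤ 1) (t : ℕ)
    {g : SimpleGraph (Fin n) → ℝ} (h : EdgeLip c g) {X : SimpleGraph (Fin n)} {m d : ℝ}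
    (hm : (upd (fun _ _ ↦ q) ^ t) g X ≤ m - d) :
    (upd (fun _ _ ↦ q) ^ t) (fun Y ↦ if m < g Y then 1 else 0) X ≤
      Real.exp (t * (l ^ 2 * ((n.choose 2 : ℝ)⁻¹ * ∑ e ∈ edges n, c e ^ 2)) - l * d) := by
  have hr : IsRate (fun (_ : Sym2 (Fin n)) (_ : SimpleGraph (Fin n)) ↦ q) := fun _ _ ↦ ⟨h0, h1⟩
  have hM := (isMarkov_upd hn hr).pow t
  have s1 : (fun Y ↦ if m < g Y then (1 : ℝ) else 0) ≤
      Real.exp (-(l * m)) • fun Y ↦ Real.exp (l * g Y) := by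
    intro Y
    rw [Pi.smul_apply, smul_eq_mul, ← Real.exp_add]
    dsimp only
    split_ifs with hY
    · exact Real.one_le_exp (by nlinarith)
    · exact (Real.exp_pos _).le
  have s2 := hM.mono s1 X
  rw [map_smul, Pi.smul_apply, smul_eq_mul] at s2
  refine s2.trans ((mul_le_mul_of_nonneg_left (h.upd_pow_exp_le hn h0 h1 hl hc t X)
    (Real.exp_pos _).le).trans ?_)
  rw [← Real.exp_add]
  refine Real.exp_le_exp.2 ?_
  nlinarith [mul_le_mul_of_nonneg_left hm hl]

/-- The variance of `g` after `t` steps is at most the sum of the squared influences of single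
edges on the functions `upd r ^ s g`. -/
lemma upd_pow_sq_le (hn : 2 ≤ n) (hr : IsRate r) (t : ℕ) :
    ∀ {g : SimpleGraph (Fin n) → ℝ} {K : ℕ → ℝ},
    (∀ s, EdgeLip (fun _ ↦ K s) ((upd r ^ s) g)) → ∀ X,
    (upd r ^ t) (fun Y ↦ g Y ^ 2) X ≤ (upd r ^ t) g X ^ 2 + ∑ s ∈ Finset.range t, K s ^ 2 := by
  have hM := isMarkov_upd hn hr
  induction t with
  | zero => intro g K _ X; simp
  | succ t ih =>
    intro g K h X
    have s1 : upd r (fun Y ↦ g Y ^ 2) ≤ (fun Y ↦ upd r g Y ^ 2) + fun _ ↦ K 0 ^ 2 := by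
      intro Y
      have e1 : upd r (fun Z ↦ (g Z - g Y) ^ 2) Y =
          upd r (fun Z ↦ g Z ^ 2) Y - 2 * g Y * upd r g Y + g Y ^ 2 := by
        have : (fun Z ↦ (g Z - g Y) ^ 2) =
            (fun Z ↦ g Z ^ 2) - (2 * g Y) • g + fun _ ↦ g Y ^ 2 := by
          ext Z; simp; ring
        rw [this, map_add, map_sub, map_smul, hM.const]
        simp
      have e2 : upd r (fun Z ↦ (g Z - g Y) ^ 2) Y ≤ K 0 ^ 2 := by
        refine (avg_le_avg (F' := fun _ ↦ K 0 ^ 2) fun e he ↦ ?_).trans (avg_const hn _).le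
        have h0 : EdgeLip (fun _ ↦ K 0) g := by simpa using h 0
        have a1 := h0.abs_addEdge_sub Y he
        have a2 := h0.abs_removeEdge_sub Y he
        have b1 := sq_le_sq' (by linarith [(abs_le.1 a1).1]) (abs_le.1 a1).2
        have b2 := sq_le_sq' (by linarith [(abs_le.1 a2).1]) (abs_le.1 a2).2
        nlinarith [mul_le_mul_of_nonneg_left b1 (hr e Y).1,
          mul_le_mul_of_nonneg_left b2 (sub_nonneg.2 (hr e Y).2)]
      simp only [Pi.add_apply]
      nlinarith [sq_nonneg (upd r g Y - g Y)]
    have s2 := (hM.pow t).mono s1 X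
    rw [map_add, (hM.pow t).const] at s2
    have s3 := ih (g := upd r g) (K := fun s ↦ K (s + 1)) (fun s ↦ by
      have := h (s + 1)
      rwa [pow_succ, Module.End.mul_apply] at this) X
    rw [pow_succ, Module.End.mul_apply, Module.End.mul_apply, Finset.sum_range_succ']
    simp only [Pi.add_apply] at s2
    linarith

/-! ### Independent updates on monomials -/

lemma prod_ind_le_one (A : Finset (Sym2 (Fin n))) (X : SimpleGraph (Fin n)) :
    ∏ e ∈ A, ind X e ≤ 1 := Finset.prod_le_one (fun e _ ↦ ind_nonneg X e) fun e _ ↦ ind_le_one X e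

lemma prod_ind_nonneg (A : Finset (Sym2 (Fin n))) (X : SimpleGraph (Fin n)) :
    0 ≤ ∏ e ∈ A, ind X e := Finset.prod_nonneg fun e _ ↦ ind_nonneg X e

lemma upd_const_prod (hn : 2 ≤ n) (q : ℝ) {A : Finset (Sym2 (Fin n))} (hA : A ⊆ edges n)
    (X : SimpleGraph (Fin n)) :
    upd (fun _ _ ↦ q) (fun Y ↦ ∏ e ∈ A, ind Y e) X =
      (1 - A.card * (n.choose 2 : ℝ)⁻¹) * ∏ e ∈ A, ind X e
      + (n.choose 2 : ℝ)⁻¹ * (q * ∑ e ∈ A, ∏ e' ∈ A.erase e, ind X e') := by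
  have h : ∀ e ∈ edges n, q * ∏ e' ∈ A, ind (addEdge X e) e'
      + (1 - q) * ∏ e' ∈ A, ind (removeEdge X e) e' = ∏ e' ∈ A, ind X e' +
        if e ∈ A then q * ∏ e' ∈ A.erase e, ind X e' - ∏ e' ∈ A, ind X e' else 0 := by
    intro e he
    split_ifs with heA
    · rw [← Finset.mul_prod_erase A (fun e' ↦ ind (addEdge X e) e') heA,
        ← Finset.mul_prod_erase A (fun e' ↦ ind (removeEdge X e) e') heA,
        Finset.prod_congr rfl (g := fun e' ↦ ind X e')]
      · simp [ind_addEdge X he, ind_removeEdge]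
      · intro e' he'
        simp [ind_addEdge X he, Finset.ne_of_mem_erase he']
    · rw [Finset.prod_congr rfl (g := fun e' ↦ ind X e'),
        Finset.prod_congr rfl (f := fun e' ↦ ind (removeEdge X e) e') (g := fun e' ↦ ind X e')]
      · ring
      · intro e' he'
        simp [ind_removeEdge, show e' ≠ e from fun h ↦ heA (h ▸ he')]
      · intro e' he'
        simp [ind_addEdge X he, show e' ≠ e from fun h ↦ heA (h ▸ he')]
  rw [upd_apply, Finset.sum_congr rfl h, Finset.sum_add_distrib, mul_add, avg_const hn,
    ← Finset.sum_filter, Finset.filter_mem_eq_inter, Finset.inter_eq_right.2 hA,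
    Finset.sum_sub_distrib, ← Finset.mul_sum, Finset.sum_const, nsmul_eq_mul]
  ring

/-- Under independent updates with parameter `q`, the expectation of a monomial of degree `k`
relaxes to `q ^ k` at the rate of a single edge. -/
lemma abs_upd_const_pow_prod_sub_le (hn : 2 ≤ n) {q : ℝ} (h0 : 0 ≤ q) (h1 : q ≤ 1) (t : ℕ) :
    ∀ {A : Finset (Sym2 (Fin n))}, A ⊆ edges n → ∀ X,
    |(upd (fun _ _ ↦ q) ^ t) (fun Y ↦ ∏ e ∈ A, ind Y e) X - q ^ A.card| ≤
      A.card * (1 - (n.choose 2 : ℝ)⁻¹) ^ t := by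
  induction t with
  | zero =>
    intro A hA X
    rcases A.eq_empty_or_nonempty with rfl | hne
    · simp
    · have : (1 : ℝ) ≤ A.card := by exact_mod_cast hne.card_pos
      have a1 := prod_ind_nonneg A X
      have a2 := prod_ind_le_one A X
      have a3 := pow_nonneg h0 A.card
      have a4 := pow_le_one₀ (n := A.card) h0 h1
      simp only [pow_zero, Module.End.one_apply, mul_one]
      rw [abs_le]; constructor <;> linarith
  | succ t ih =>
    intro A hA X
    set N : ℝ := ((n.choose 2 : ℕ) : ℝ) with hN
    have hNpos : 0 < N := choose_two_pos hn
    have hAN : (A.card : ℝ) ≤ N := by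
      rw [hN, ← card_edges]; exact_mod_cast Finset.card_le_card hA
    set ρ := (1 - N⁻¹) ^ t with hρ
    have hN1 : (1 : ℝ) ≤ N := by rw [hN]; exact_mod_cast Nat.choose_pos hn
    have hρ0 : 0 ≤ ρ := pow_nonneg (sub_nonneg.2 (inv_le_one_of_one_le₀ hN1)) t
    have e1 : (upd (fun _ _ ↦ q) ^ (t + 1)) (fun Y ↦ ∏ e ∈ A, ind Y e) X =
        (1 - A.card * N⁻¹) * (upd (fun _ _ ↦ q) ^ t) (fun Y ↦ ∏ e ∈ A, ind Y e) X
        + N⁻¹ * (q * ∑ e ∈ A, (upd (fun _ _ ↦ q) ^ t) (fun Y ↦ ∏ e' ∈ A.erase e, ind Y e') X) := by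
      have : upd (fun _ _ ↦ q) (fun Y ↦ ∏ e ∈ A, ind Y e) =
          (1 - A.card * N⁻¹) • (fun Y ↦ ∏ e ∈ A, ind Y e)
          + (N⁻¹ * q) • ∑ e ∈ A, fun Y ↦ ∏ e' ∈ A.erase e, ind Y e' := by
        ext Y
        rw [upd_const_prod hn q hA Y]
        simp only [Pi.add_apply, Pi.smul_apply, smul_eq_mul, Finset.sum_apply]
        ring
      rw [pow_succ, Module.End.mul_apply, this, map_add, map_smul, map_smul, map_sum]
      simp only [Pi.add_apply, Pi.smul_apply, smul_eq_mul, Finset.sum_apply]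
      ring
    have e2 : q ^ A.card = (1 - A.card * N⁻¹) * q ^ A.card
        + N⁻¹ * (q * ∑ e ∈ A, q ^ (A.erase e).card) := by
      rw [Finset.mul_sum, Finset.sum_congr rfl (g := fun _ ↦ q ^ A.card)]
      · rw [Finset.sum_const, nsmul_eq_mul]; ring
      · intro e he
        rw [Finset.card_erase_of_mem he, ← pow_succ',
          Nat.sub_add_cancel (Finset.card_pos.2 ⟨e, he⟩)]
    have b1 := ih hA X
    have b2 : |∑ e ∈ A, (upd (fun _ _ ↦ q) ^ t) (fun Y ↦ ∏ e' ∈ A.erase e, ind Y e') X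
        - ∑ e ∈ A, q ^ (A.erase e).card| ≤ A.card * ((A.card - 1) * ρ) := by
      rw [← Finset.sum_sub_distrib, ← nsmul_eq_mul]
      refine (Finset.abs_sum_le_sum_abs _ _).trans (Finset.sum_le_card_nsmul _ _ _ fun e he ↦ ?_)
      refine (ih ((Finset.erase_subset _ _).trans hA) X).trans_eq ?_
      rw [Finset.card_erase_of_mem he, Nat.cast_sub (Finset.card_pos.2 ⟨e, he⟩), Nat.cast_one]
    rw [e1, e2]
    rw [show ∀ a x x' b y y' : ℝ, a * x + b * (q * y) - (a * x' + b * (q * y')) =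
      a * (x - x') + b * (q * (y - y')) from fun a x x' b y y' ↦ by ring]
    refine (abs_add_le _ _).trans ?_
    have hk : (A.card : ℝ) * N⁻¹ ≤ 1 := by rw [← div_eq_mul_inv, div_le_one hNpos]; exact hAN
    have hNi : 0 ≤ N⁻¹ := by positivity
    rw [abs_mul, abs_mul, abs_mul, abs_of_nonneg (sub_nonneg.2 hk), abs_of_nonneg hNi,
      abs_of_nonneg h0]
    have c1 := mul_le_mul_of_nonneg_left b1 (sub_nonneg.2 hk)
    have c2 : q * |∑ e ∈ A, (upd (fun _ _ ↦ q) ^ t) (fun Y ↦ ∏ e' ∈ A.erase e, ind Y e') X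
        - ∑ e ∈ A, q ^ (A.erase e).card| ≤ A.card * ((A.card - 1) * ρ) :=
      (mul_le_of_le_one_left (abs_nonneg _) h1).trans b2
    have c3 := mul_le_mul_of_nonneg_left c2 hNi
    refine (add_le_add c1 c3).trans_eq ?_
    rw [pow_succ, ← hρ]; ring

end Updates

/-! ### Counting rooted embeddings -/

section Rooted
variable {v n : ℕ}

/-- The injective maps from the vertices of a pattern graph to `Fin n` that send the pair `a` to
the pair `e`. -/
def rootedEmb (a : Sym2 (Fin v)) (e : Sym2 (Fin n)) : Finset (Fin v ↪ Fin n) :=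
  Finset.univ.filter fun f ↦ a.map f = e

lemma mem_rootedEmb {a : Sym2 (Fin v)} {e : Sym2 (Fin n)} {f : Fin v ↪ Fin n} :
    f ∈ rootedEmb a e ↔ a.map f = e := by simp [rootedEmb]

lemma map_mem_edges (f : Fin v ↪ Fin n) {a : Sym2 (Fin v)} (ha : ¬ a.IsDiag) :
    a.map f ∈ edges n := by
  rw [mem_edges]
  induction a with | _ x y => simpa using ha

lemma card_embedding_prescribed_le (A : Finset (Fin v)) (h : Fin v → Fin n) :
    (Finset.univ.filter fun f : Fin v ↪ Fin n ↦ ∀ z ∈ A, f z = h z).card ≤ n ^ (v - A.card) := by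
  have h1 : (Fintype.piFinset fun z ↦ if z ∈ A then {h z} else (Finset.univ : Finset (Fin n))).card
      = n ^ (v - A.card) := by
    rw [Fintype.card_piFinset]
    have : ∀ z, (if z ∈ A then {h z} else (Finset.univ : Finset (Fin n))).card =
        if z ∈ A then 1 else n := by intro z; split_ifs <;> simp
    simp only [this]
    rw [Finset.prod_ite, Finset.prod_const_one, one_mul, Finset.prod_const]
    congr 1
    rw [← Finset.compl_filter, Finset.card_compl]
    simp
  rw [← h1]
  refine Finset.card_le_card_of_injOn (fun f ↦ ⇑f) ?_ (fun f _ g _ h ↦ DFunLike.coe_injective h)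
  intro f hf
  simp only [Finset.coe_filter, Finset.mem_univ, true_and, Set.mem_ofPred_eq] at hf
  simp only [Finset.mem_coe, Fintype.mem_piFinset]
  intro z
  split_ifs with hz
  · simpa using hf z hz
  · simp

lemma card_rootedEmb_le {a : Sym2 (Fin v)} (ha : ¬ a.IsDiag) (e : Sym2 (Fin n)) :
    (rootedEmb a e).card ≤ 2 * n ^ (v - 2) := by
  induction a with | _ x y =>
  induction e with | _ u w =>
  have hxy : x ≠ y := by simpa using ha
  have hc : ({x, y} : Finset (Fin v)).card = 2 := Finset.card_pair hxy
  have h1 := card_embedding_prescribed_le {x, y} (fun z ↦ if z = x then u else w)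
  have h2 := card_embedding_prescribed_le {x, y} (fun z ↦ if z = x then w else u)
  rw [hc] at h1 h2
  refine (Finset.card_le_card (t := _ ∪ _) ?_).trans
    ((Finset.card_union_le _ _).trans ((add_le_add h1 h2).trans_eq (two_mul _).symm))
  intro f hf
  simp only [mem_rootedEmb, Sym2.map_mk, Sym2.eq_iff] at hf
  simp [hxy.symm]
  exact hf

lemma card_rootedEmb_pair_le {a b : Sym2 (Fin v)} (ha : ¬ a.IsDiag) (hb : ¬ b.IsDiag)
    (hab : a ≠ b) (e e' : Sym2 (Fin n)) :
    ((rootedEmb a e).filter fun f : Fin v ↪ Fin n ↦ b.map f = e').card ≤ 4 * n ^ (v - 3) := by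
  obtain ⟨z, hzb, hza⟩ : ∃ z ∈ b, z ∉ a := by
    by_contra! hcon
    refine hab ?_
    induction a with | _ x y =>
    induction b with | _ p q =>
    have h1 := hcon p (by simp)
    have h2 := hcon q (by simp)
    have hpq : p ≠ q := by simpa using hb
    simp only [Sym2.mem_iff] at h1 h2
    rw [Sym2.eq_iff]
    rcases h1 with rfl | rfl <;> rcases h2 with rfl | rfl <;> simp_all
  obtain ⟨p, rfl⟩ := hzb
  induction a with | _ x y =>
  induction e with | _ u w =>
  induction e' with | _ u' w' =>
  have hxy : x ≠ y := by simpa using ha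
  simp only [Sym2.mem_iff, not_or] at hza
  have hc : ({x, y, z} : Finset (Fin v)).card = 3 :=
    Finset.card_eq_three.2 ⟨x, y, z, hxy, Ne.symm hza.1, Ne.symm hza.2, rfl⟩
  have key : ∀ c : Fin n × Fin n × Fin n, (Finset.univ.filter fun f : Fin v ↪ Fin n ↦
      f x = c.1 ∧ f y = c.2.1 ∧ f z = c.2.2).card ≤ n ^ (v - 3) := by
    intro c
    have h1 := card_embedding_prescribed_le {x, y, z}
      (fun t ↦ if t = x then c.1 else if t = y then c.2.1 else c.2.2)
    rw [hc] at h1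
    refine (Finset.card_le_card ?_).trans h1
    intro f hf
    simp only [Finset.mem_filter, Finset.mem_univ, true_and] at hf
    simp [hxy.symm, hza.1, hza.2, hf]
  have hsub : ((rootedEmb s(x, y) s(u, w)).filter fun f : Fin v ↪ Fin n ↦ Sym2.map f s(z, p) = s(u', w')) ⊆
      ({(u, w, u'), (u, w, w'), (w, u, u'), (w, u, w')} : Finset (Fin n × Fin n × Fin n)).biUnion
      fun c ↦ Finset.univ.filter fun f : Fin v ↪ Fin n ↦ f x = c.1 ∧ f y = c.2.1 ∧ f z = c.2.2 := by
    intro f hf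
    simp only [Finset.mem_filter, mem_rootedEmb, Sym2.map_mk, Sym2.eq_iff] at hf
    simp only [Finset.mem_biUnion, Finset.mem_insert, Finset.mem_singleton, Finset.mem_filter,
      Finset.mem_univ, true_and, exists_eq_or_imp, exists_eq_left]
    tauto
  refine (Finset.card_le_card hsub).trans
    ((Finset.card_biUnion_le_card_mul _ _ _ fun c _ ↦ key c).trans ?_)
  exact Nat.mul_le_mul_right _ Finset.card_le_four

lemma le_card_embedding_pair {x y : Fin v} (hxy : x ≠ y) {u w : Fin n} (huw : u ≠ w) :
    (n - 2).descFactorial (v - 2) ≤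
      (Finset.univ.filter fun f : Fin v ↪ Fin n ↦ f x = u ∧ f y = w).card := by
  have c1 : Fintype.card {z : Fin v // z ∉ ({x, y} : Finset (Fin v))} = v - 2 := by
    rw [Fintype.card_subtype_compl, Fintype.card_coe, Finset.card_pair hxy, Fintype.card_fin]
  have c2 : Fintype.card {z : Fin n // z ∉ ({u, w} : Finset (Fin n))} = n - 2 := by
    rw [Fintype.card_subtype_compl, Fintype.card_coe, Finset.card_pair huw, Fintype.card_fin]
  rw [← c1, ← c2, ← Fintype.card_embedding_eq, ← Finset.card_univ]
  have hne : ∀ g : {z : Fin v // z ∉ ({x, y} : Finset (Fin v))} ↪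
      {z : Fin n // z ∉ ({u, w} : Finset (Fin n))}, ∀ z, (g z : Fin n) ≠ u ∧ (g z : Fin n) ≠ w :=
    fun g z ↦ by simpa using (g z).2
  have hmem : ∀ z, ¬ z = x → ¬ z = y → z ∉ ({x, y} : Finset (Fin v)) := by
    intro z h1 h2; simp [h1, h2]
  have hinj : ∀ g : {z : Fin v // z ∉ ({x, y} : Finset (Fin v))} ↪
      {z : Fin n // z ∉ ({u, w} : Finset (Fin n))}, Function.Injective fun z ↦
      if h : z = x then u else if h' : z = y then w else (g ⟨z, hmem z h h'⟩ : Fin n) := by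
    intro g z z' h
    dsimp only at h
    split_ifs at h with h1 h2 h3 h4 h5 h6 h7 h8
    · rw [h1, h2]
    · exact absurd h huw
    · exact absurd h.symm (hne g _).1
    · exact absurd h.symm huw
    · rw [h4, h6]
    · exact absurd h.symm (hne g _).2
    · exact absurd h (hne g _).1
    · exact absurd h (hne g _).2
    · simpa using g.injective (Subtype.ext h)
  let F : ({z : Fin v // z ∉ ({x, y} : Finset (Fin v))} ↪
      {z : Fin n // z ∉ ({u, w} : Finset (Fin n))}) → (Fin v ↪ Fin n) := fun g ↦ ⟨_, hinj g⟩
  have hF : ∀ g z, F g z =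
      if h : z = x then u else if h' : z = y then w else (g ⟨z, hmem z h h'⟩ : Fin n) :=
    fun _ _ ↦ rfl
  refine Finset.card_le_card_of_injOn F ?_ ?_
  · intro g _
    simp [hF, hxy.symm]
  · intro g _ g' _ h
    ext z
    have hz := z.2
    simp only [Finset.mem_insert, Finset.mem_singleton, not_or] at hz
    have := DFunLike.congr_fun h z.1
    rw [hF, hF] at this
    simp only [hz.1, hz.2, dif_neg, not_false_eq_true] at this
    rw [this]

lemma le_card_rootedEmb {a : Sym2 (Fin v)} (ha : ¬ a.IsDiag) {e : Sym2 (Fin n)}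
    (he : e ∈ edges n) : 2 * (n - 2).descFactorial (v - 2) ≤ (rootedEmb a e).card := by
  rw [mem_edges] at he
  induction a with | _ x y =>
  induction e with | _ u w =>
  have hxy : x ≠ y := by simpa using ha
  have huw : u ≠ w := by simpa using he
  have h : rootedEmb s(x, y) s(u, w) = (Finset.univ.filter fun f : Fin v ↪ Fin n ↦
      f x = u ∧ f y = w) ∪ (Finset.univ.filter fun f : Fin v ↪ Fin n ↦ f x = w ∧ f y = u) := by
    ext f
    simp [mem_rootedEmb]
  rw [h, Finset.card_union_of_disjoint, two_mul]
  · exact add_le_add (le_card_embedding_pair hxy huw) (le_card_embedding_pair hxy huw.symm)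
  · rw [Finset.disjoint_left]
    intro f h1 h2
    simp only [Finset.mem_filter, Finset.mem_univ, true_and] at h1 h2
    exact huw (h1.1.symm.trans h2.1)

/-! ### Rooted subgraph densities -/

/-- The normalized number of injective maps of the pattern that send the root pair `a` to `e` and
all pairs in `S` to edges of `X`; the normalization `2 * n ^ (v - 2)` makes it close to
`q ^ #S` for a random graph of density `q`. -/
def dens (a : Sym2 (Fin v)) (S : Finset (Sym2 (Fin v))) (X : SimpleGraph (Fin n))
    (e : Sym2 (Fin n)) : ℝ :=
  (∑ f ∈ rootedEmb a e, ∏ b ∈ S, ind X (b.map f)) / (2 * (n : ℝ) ^ (v - 2))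

/-- A bound for the influence of the edge `e'` on the rooted density at `e`. -/
def influence (a : Sym2 (Fin v)) (S : Finset (Sym2 (Fin v))) (e e' : Sym2 (Fin n)) : ℝ :=
  (∑ b ∈ S, (((rootedEmb a e).filter fun f : Fin v ↪ Fin n ↦ b.map f = e').card : ℝ)) / (2 * (n : ℝ) ^ (v - 2))

lemma prod_ind_map_mono (S : Finset (Sym2 (Fin v))) (f : Fin v ↪ Fin n)
    {X Y : SimpleGraph (Fin n)} (h : X ≤ Y) :
    ∏ b ∈ S, ind X (b.map f) ≤ ∏ b ∈ S, ind Y (b.map f) :=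
  Finset.prod_le_prod (fun _ _ ↦ ind_nonneg _ _) fun _ _ ↦ ind_mono h _

lemma dens_mono (a : Sym2 (Fin v)) (S : Finset (Sym2 (Fin v))) (e : Sym2 (Fin n)) :
    Monotone fun X ↦ dens a S X e := fun _ _ h ↦
  div_le_div_of_nonneg_right (Finset.sum_le_sum fun f _ ↦ prod_ind_map_mono S f h) (by positivity)

lemma dens_nonneg (a : Sym2 (Fin v)) (S : Finset (Sym2 (Fin v))) (X : SimpleGraph (Fin n))
    (e : Sym2 (Fin n)) : 0 ≤ dens a S X e :=
  div_nonneg (Finset.sum_nonneg fun _ _ ↦ Finset.prod_nonneg fun _ _ ↦ ind_nonneg _ _)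
    (by positivity)

lemma dens_empty (a : Sym2 (Fin v)) (X : SimpleGraph (Fin n)) (e : Sym2 (Fin n)) :
    dens a ∅ X e = (rootedEmb a e).card / (2 * (n : ℝ) ^ (v - 2)) := by simp [dens]

lemma card_rootedEmb_div_le_one (hn : 0 < n) {a : Sym2 (Fin v)} (ha : ¬ a.IsDiag)
    (e : Sym2 (Fin n)) : ((rootedEmb a e).card : ℝ) / (2 * (n : ℝ) ^ (v - 2)) ≤ 1 := by
  rw [div_le_one (by positivity)]
  exact_mod_cast card_rootedEmb_le ha e

lemma dens_le_one (hn : 0 < n) {a : Sym2 (Fin v)} (ha : ¬ a.IsDiag) (S : Finset (Sym2 (Fin v)))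
    (X : SimpleGraph (Fin n)) (e : Sym2 (Fin n)) : dens a S X e ≤ 1 := by
  refine le_trans ?_ (card_rootedEmb_div_le_one hn ha e)
  refine div_le_div_of_nonneg_right ?_ (by positivity)
  rw [← nsmul_one]
  exact Finset.sum_le_card_nsmul _ _ _ fun f _ ↦
    Finset.prod_le_one (fun _ _ ↦ ind_nonneg _ _) fun _ _ ↦ ind_le_one _ _

lemma one_sub_le_card_rootedEmb_div (hv : v ≤ n) {a : Sym2 (Fin v)}
    (ha : ¬ a.IsDiag) {e : Sym2 (Fin n)} (he : e ∈ edges n) :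
    1 - (v : ℝ) ^ 2 / n ≤ ((rootedEmb a e).card : ℝ) / (2 * (n : ℝ) ^ (v - 2)) := by
  have hv2 : 2 ≤ v := by
    induction a with | _ x y =>
    have hxy : x ≠ y := by simpa using ha
    by_contra! hlt
    have := x.2; have := y.2
    exact hxy (Fin.ext (by omega))
  have hn : 0 < n := by omega
  have hnR : (0 : ℝ) < n := by exact_mod_cast hn
  have h1 : 2 * (n - v) ^ (v - 2) ≤ (rootedEmb a e).card := by
    refine le_trans ?_ (le_card_rootedEmb ha he)
    refine Nat.mul_le_mul_left _ (le_trans ?_ (Nat.pow_sub_le_descFactorial _ _))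
    exact Nat.pow_le_pow_left (by omega) _
  have h2 : (2 : ℝ) * ((n : ℝ) - v) ^ (v - 2) ≤ (rootedEmb a e).card := by
    rw [← Nat.cast_sub hv]; exact_mod_cast h1
  rw [le_div_iff₀ (by positivity)]
  refine le_trans ?_ h2
  have h3 : ((n : ℝ) - v) = n * (1 + -(v / n)) := by field_simp; ring
  have hvn : (v : ℝ) / n ≤ 1 := by rw [div_le_one hnR]; exact_mod_cast hv
  have h4 := one_add_mul_le_pow (a := -((v : ℝ) / n)) (by linarith) (v - 2)
  rw [h3, mul_pow]
  have h5 : 1 - (v : ℝ) ^ 2 / n ≤ (1 + -((v : ℝ) / n)) ^ (v - 2) := by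
    refine le_trans ?_ h4
    have h6 : ((v - 2 : ℕ) : ℝ) ≤ v := by exact_mod_cast Nat.sub_le _ _
    have h7 : (0 : ℝ) ≤ v / n := by positivity
    have h8 : (v : ℝ) ^ 2 / n = v * (v / n) := by ring
    rw [h8]; nlinarith
  nlinarith [mul_le_mul_of_nonneg_left h5 (by positivity : (0 : ℝ) ≤ 2 * (n : ℝ) ^ (v - 2))]

lemma abs_dens_empty_sub_one_le (hv : v ≤ n) (hn : 0 < n) {a : Sym2 (Fin v)} (ha : ¬ a.IsDiag)
    (X : SimpleGraph (Fin n)) {e : Sym2 (Fin n)} (he : e ∈ edges n) :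
    |dens a ∅ X e - 1| ≤ (v : ℝ) ^ 2 / n := by
  rw [dens_empty, abs_le]
  have h1 := one_sub_le_card_rootedEmb_div hv ha he
  have h2 := card_rootedEmb_div_le_one hn ha e
  have : (0 : ℝ) ≤ (v : ℝ) ^ 2 / n := by positivity
  constructor <;> linarith

lemma edgeLip_dens (a : Sym2 (Fin v)) (S : Finset (Sym2 (Fin v))) (e : Sym2 (Fin n)) :
    EdgeLip (influence a S e) fun X ↦ dens a S X e := by
  intro X e' he'
  rw [abs_of_nonneg (sub_nonneg.2 (dens_mono a S e (removeEdge_le_addEdge X e')))]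
  simp only [dens, influence]
  rw [← sub_div, ← Finset.sum_sub_distrib]
  refine div_le_div_of_nonneg_right ?_ (by positivity)
  have : ∀ b ∈ S, (((rootedEmb a e).filter fun f : Fin v ↪ Fin n ↦ b.map f = e').card : ℝ) =
      ∑ f ∈ rootedEmb a e, if b.map f = e' then 1 else 0 := by
    intro b _; simp
  rw [Finset.sum_congr rfl this, Finset.sum_comm]
  refine Finset.sum_le_sum fun f _ ↦ ?_
  by_cases h : ∃ b ∈ S, b.map f = e'
  · obtain ⟨b, hb, hbe⟩ := h
    have h1 : (1 : ℝ) ≤ ∑ b ∈ S, if b.map f = e' then (1 : ℝ) else 0 := by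
      have := Finset.single_le_sum (f := fun b : Sym2 (Fin v) ↦ if b.map f = e' then (1 : ℝ) else 0)
        (fun i _ ↦ by split_ifs <;> norm_num) hb
      simpa [hbe] using this
    have h2 : ∏ b ∈ S, ind (addEdge X e') (b.map f) ≤ 1 :=
      Finset.prod_le_one (fun _ _ ↦ ind_nonneg _ _) fun _ _ ↦ ind_le_one _ _
    have h3 : 0 ≤ ∏ b ∈ S, ind (removeEdge X e') (b.map f) :=
      Finset.prod_nonneg fun _ _ ↦ ind_nonneg _ _
    linarith
  · push Not at h
    have h1 : ∏ b ∈ S, ind (addEdge X e') (b.map f) = ∏ b ∈ S, ind X (b.map f) :=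
      Finset.prod_congr rfl fun b hb ↦ by simp [ind_addEdge X he', h b hb]
    have h2 : ∏ b ∈ S, ind (removeEdge X e') (b.map f) = ∏ b ∈ S, ind X (b.map f) :=
      Finset.prod_congr rfl fun b hb ↦ by simp [ind_removeEdge, h b hb]
    rw [h1, h2, sub_self]
    exact Finset.sum_nonneg fun b _ ↦ by split_ifs <;> norm_num

lemma influence_nonneg (a : Sym2 (Fin v)) (S : Finset (Sym2 (Fin v))) (e e' : Sym2 (Fin n)) :
    0 ≤ influence a S e e' := by unfold influence; positivity

lemma influence_le (hn : 0 < n) {a : Sym2 (Fin v)} (ha : ¬ a.IsDiag) {S : Finset (Sym2 (Fin v))}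
    (hS : ∀ b ∈ S, ¬ b.IsDiag) (haS : a ∉ S) (e e' : Sym2 (Fin n)) :
    influence a S e e' ≤ 2 * S.card / n := by
  have hnR : (0 : ℝ) < n := by exact_mod_cast hn
  rw [influence, div_le_iff₀ (by positivity)]
  calc _ ≤ ∑ b ∈ S, (4 * (n : ℝ) ^ (v - 3)) := by
        refine Finset.sum_le_sum fun b hb ↦ ?_
        exact_mod_cast card_rootedEmb_pair_le ha (hS b hb) (fun h ↦ haS (h ▸ hb)) e e'
    _ ≤ _ := by
        rw [Finset.sum_const, nsmul_eq_mul]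
        rcases S.eq_empty_or_nonempty with rfl | ⟨b, hb⟩
        · simp
        have hv3 : 3 ≤ v := by
          have hab : a ≠ b := fun h ↦ haS (h ▸ hb)
          have hbd := hS b hb
          by_contra! hlt
          refine hab ?_
          induction a with | _ x y =>
          induction b with | _ p q =>
          have hxy : x ≠ y := by simpa using ha
          have hpq : p ≠ q := by simpa using hbd
          rw [Sym2.eq_iff]
          simp only [Fin.ext_iff, ne_eq] at *
          omega
        obtain ⟨k, rfl⟩ := Nat.exists_eq_add_of_le hv3
        rw [show 3 + k - 3 = k by omega, show 3 + k - 2 = k + 1 by omega, pow_succ]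
        field_simp
        ring_nf
        rfl

lemma sum_influence_le (hn : 0 < n) {a : Sym2 (Fin v)} (ha : ¬ a.IsDiag)
    (S : Finset (Sym2 (Fin v))) (e : Sym2 (Fin n)) :
    ∑ e' ∈ edges n, influence a S e e' ≤ S.card := by
  simp only [influence]
  rw [← Finset.sum_div, Finset.sum_comm]
  rw [div_le_iff₀ (by positivity)]
  rw [← nsmul_eq_mul]
  refine Finset.sum_le_card_nsmul _ _ _ fun b _ ↦ ?_
  have h1 : ∑ e' ∈ edges n, ((rootedEmb a e).filter fun f : Fin v ↪ Fin n ↦ b.map f = e').card ≤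
      (rootedEmb a e).card :=
    (Finset.sum_card_fiberwise_eq_card_filter _ _ _).trans_le (Finset.card_filter_le _ _)
  exact_mod_cast h1.trans (card_rootedEmb_le ha e)

lemma sum_influence_sq_le (hn : 0 < n) {a : Sym2 (Fin v)} (ha : ¬ a.IsDiag)
    {S : Finset (Sym2 (Fin v))} (hS : ∀ b ∈ S, ¬ b.IsDiag) (haS : a ∉ S) (e : Sym2 (Fin n)) :
    ∑ e' ∈ edges n, influence a S e e' ^ 2 ≤ 2 * S.card ^ 2 / n := by
  calc _ ≤ ∑ e' ∈ edges n, 2 * S.card / n * influence a S e e' := by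
        refine Finset.sum_le_sum fun e' _ ↦ ?_
        rw [sq]
        exact mul_le_mul_of_nonneg_right (influence_le hn ha hS haS e e') (influence_nonneg ..)
    _ ≤ 2 * S.card / n * S.card := by
        rw [← Finset.mul_sum]
        exact mul_le_mul_of_nonneg_left (sum_influence_le hn ha S e) (by positivity)
    _ = _ := by ring

lemma prod_ind_map_eq (S : Finset (Sym2 (Fin v))) (f : Fin v ↪ Fin n) (X : SimpleGraph (Fin n)) :
    ∏ b ∈ S, ind X (b.map f) = ∏ e ∈ S.image (Sym2.map f), ind X e :=
  (Finset.prod_image ((Sym2.map.injective f.injective).injOn)).symm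

/-- Independent updates drive each rooted density to that of the binomial random graph. -/
lemma abs_upd_const_pow_dens_sub_le (hn : 2 ≤ n) (hv : v ≤ n) {q : ℝ} (h0 : 0 ≤ q) (h1 : q ≤ 1)
    {a : Sym2 (Fin v)} (ha : ¬ a.IsDiag) {S : Finset (Sym2 (Fin v))}
    (hS : ∀ b ∈ S, ¬ b.IsDiag) {e : Sym2 (Fin n)} (he : e ∈ edges n) (t : ℕ)
    (X : SimpleGraph (Fin n)) :
    |(upd (fun _ _ ↦ q) ^ t) (fun Y ↦ dens a S Y e) X - q ^ S.card| ≤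
      S.card * (1 - (n.choose 2 : ℝ)⁻¹) ^ t + (v : ℝ) ^ 2 / n := by
  have hn0 : 0 < n := by omega
  set R := rootedEmb a e
  set Z : ℝ := 2 * (n : ℝ) ^ (v - 2) with hZ
  have hZ0 : 0 < Z := by positivity
  set ε := (S.card : ℝ) * (1 - (n.choose 2 : ℝ)⁻¹) ^ t
  have hε : 0 ≤ ε := by
    have : (1 : ℝ) ≤ n.choose 2 := by exact_mod_cast Nat.choose_pos hn
    exact mul_nonneg (by positivity) (pow_nonneg (sub_nonneg.2 (inv_le_one_of_one_le₀ this)) t)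
  set U : (Fin v ↪ Fin n) → ℝ := fun f ↦
    (upd (fun _ _ ↦ q) ^ t) (fun Y ↦ ∏ e ∈ S.image (Sym2.map f), ind Y e) X with hU
  have e1 : (upd (fun _ _ ↦ q) ^ t) (fun Y ↦ dens a S Y e) X = Z⁻¹ * ∑ f ∈ R, U f := by
    have : (fun Y ↦ dens a S Y e) =
        Z⁻¹ • ∑ f ∈ R, fun Y ↦ ∏ e ∈ S.image (Sym2.map f), ind Y e := by
      ext Y
      simp only [dens, prod_ind_map_eq, Pi.smul_apply, Finset.sum_apply, smul_eq_mul]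
      rw [div_eq_inv_mul]
    rw [this, map_smul, map_sum]
    simp [hU]
  have e2 : ∀ f ∈ R, |U f - q ^ S.card| ≤ ε := by
    intro f _
    have hc : (S.image (Sym2.map f)).card = S.card :=
      Finset.card_image_of_injective _ (Sym2.map.injective f.injective)
    have := abs_upd_const_pow_prod_sub_le hn h0 h1 t (A := S.image (Sym2.map f)) (by
      intro x hx
      obtain ⟨b, hb, rfl⟩ := Finset.mem_image.1 hx
      exact map_mem_edges f (hS b hb)) X
    rwa [hc] at this
  have e3 : |∑ f ∈ R, (U f - q ^ S.card)| ≤ R.card * ε := by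
    rw [← nsmul_eq_mul]
    exact (Finset.abs_sum_le_sum_abs _ _).trans (Finset.sum_le_card_nsmul _ _ _ e2)
  have e4 : Z⁻¹ * R.card ≤ 1 := by
    rw [← div_eq_inv_mul]; exact card_rootedEmb_div_le_one hn0 ha e
  have e5 : 1 - (v : ℝ) ^ 2 / n ≤ Z⁻¹ * R.card := by
    rw [← div_eq_inv_mul]; exact one_sub_le_card_rootedEmb_div hv ha he
  have e6 : (upd (fun _ _ ↦ q) ^ t) (fun Y ↦ dens a S Y e) X - q ^ S.card =
      Z⁻¹ * ∑ f ∈ R, (U f - q ^ S.card) + q ^ S.card * (Z⁻¹ * R.card - 1) := by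
    rw [e1, Finset.sum_sub_distrib, Finset.sum_const, nsmul_eq_mul]; ring
  rw [e6]
  refine (abs_add_le _ _).trans (add_le_add ?_ ?_)
  · rw [abs_mul, abs_of_nonneg (inv_nonneg.2 hZ0.le)]
    have := mul_le_mul_of_nonneg_left e3 (inv_nonneg.2 hZ0.le)
    nlinarith
  · rw [abs_mul, abs_of_nonneg (pow_nonneg h0 _), abs_sub_comm, abs_of_nonneg (by linarith)]
    have := pow_le_one₀ (n := S.card) h0 h1
    nlinarith

/-- Exponential concentration of the rooted densities after `t` rounds of independent updates. -/
lemma upd_const_pow_dens_tail (hn : 2 ≤ n) (hv : v ≤ n) {q : ℝ} (h0 : 0 ≤ q) (h1 : q ≤ 1)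
    {a : Sym2 (Fin v)} (ha : ¬ a.IsDiag) {S : Finset (Sym2 (Fin v))}
    (hS : ∀ b ∈ S, ¬ b.IsDiag) (haS : a ∉ S) {e : Sym2 (Fin n)} (he : e ∈ edges n) (t : ℕ)
    {s : ℝ} (hs : |s| = 1) {η l : ℝ} (hl : 0 ≤ l) (hlS : l * (2 * S.card) ≤ n)
    (h2 : S.card * (1 - (n.choose 2 : ℝ)⁻¹) ^ t ≤ η / 4) (h3 : (v : ℝ) ^ 2 / n ≤ η / 4)
    (X : SimpleGraph (Fin n)) :
    (upd (fun _ _ ↦ q) ^ t) (fun Y ↦ if η < s * (dens a S Y e - q ^ S.card) then 1 else 0) X ≤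
      Real.exp (t * (l ^ 2 * ((n.choose 2 : ℝ)⁻¹ * (2 * S.card ^ 2 / n))) - l * (η / 2)) := by
  have hn0 : 0 < n := by omega
  have hnR : (0 : ℝ) < n := by exact_mod_cast hn0
  have hg := (edgeLip_dens a S e).smul_sign hs
  have hm : (upd (fun _ _ ↦ q) ^ t) (fun Y ↦ s * dens a S Y e) X ≤
      (η + s * q ^ S.card) - η / 2 := by
    have e1 : (fun Y ↦ s * dens a S Y e) = s • fun Y ↦ dens a S Y e := rfl
    rw [e1, map_smul, Pi.smul_apply, smul_eq_mul]
    have := abs_upd_const_pow_dens_sub_le hn hv h0 h1 ha hS he t X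
    have h5 := le_abs_self (s * ((upd (fun _ _ ↦ q) ^ t) (fun Y ↦ dens a S Y e) X - q ^ S.card))
    rw [abs_mul, hs, one_mul, mul_sub] at h5
    linarith
  have := hg.upd_pow_tail hn h0 h1 hl (fun e' _ ↦ ?_) t hm
  · have e2 : (fun Y ↦ if η < s * (dens a S Y e - q ^ S.card) then (1 : ℝ) else 0) =
        fun Y ↦ if η + s * q ^ S.card < s * dens a S Y e then 1 else 0 := by
      ext Y
      congr 1
      rw [mul_sub, lt_sub_iff_add_lt]
    rw [e2]
    refine this.trans (Real.exp_le_exp.2 (sub_le_sub_right ?_ _))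
    have := sum_influence_sq_le hn0 ha hS haS e
    gcongr
  · have h4 := influence_le hn0 ha hS haS e e'
    calc l * influence a S e e' ≤ l * (2 * S.card / n) := mul_le_mul_of_nonneg_left h4 hl
      _ = l * (2 * S.card) / n := by ring
      _ ≤ 1 := by rwa [div_le_one hnR]

end Rooted

/-! ### The Glauber dynamics as an update dynamics -/

section Model
variable {ι : Type*} [Fintype ι] (V : ι → ℕ) (G : (i : ι) → SimpleGraph (Fin (V i))) (β : ι → ℝ)
variable {n : ℕ}

/-- The edge set of a pattern graph, as a `Finset`. -/
def pat {v : ℕ} (H : SimpleGraph (Fin v)) : Finset (Sym2 (Fin v)) := H.edgeSet.toFinset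

lemma mem_pat {v : ℕ} {H : SimpleGraph (Fin v)} {a : Sym2 (Fin v)} :
    a ∈ pat H ↔ a ∈ H.edgeSet := by simp [pat]

lemma not_isDiag_of_mem_pat {v : ℕ} {H : SimpleGraph (Fin v)} {a : Sym2 (Fin v)}
    (h : a ∈ pat H) : ¬ a.IsDiag := H.not_isDiag_of_mem_edgeSet (mem_pat.1 h)

lemma card_pat {v : ℕ} (H : SimpleGraph (Fin v)) : (pat H).card = H.edgeSet.ncard := by
  rw [pat, Set.ncard_eq_toFinset_card']

/-- The change `H(X_{e+}) - H(X_{e-})` of the Hamiltonian, in terms of rooted densities. -/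
def field (e : Sym2 (Fin n)) (X : SimpleGraph (Fin n)) : ℝ :=
  ∑ i, 2 * β i * ∑ a ∈ pat (G i), dens a ((pat (G i)).erase a) X e

/-- The conditional probability of the edge `e` given the rest of the graph. -/
def rate (e : Sym2 (Fin n)) (X : SimpleGraph (Fin n)) : ℝ := Real.sigmoid (field V G β e X)

lemma labelledCopyCount_eq {v : ℕ} (H : SimpleGraph (Fin v)) (X : SimpleGraph (Fin n)) :
    (X.labelledCopyCount H : ℝ) = ∑ f : Fin v ↪ Fin n, ∏ b ∈ pat H, ind X (b.map f) := by
  have h1 : ∀ f : Fin v ↪ Fin n, ∏ b ∈ pat H, ind X (b.map f) =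
      if ∀ b ∈ pat H, b.map f ∈ X.edgeSet then 1 else 0 := by
    intro f
    simp only [ind]
    rw [Finset.prod_ite_zero]
    simp
  simp only [h1]
  let φ : SimpleGraph.Copy H X ≃ {f : Fin v ↪ Fin n // ∀ b ∈ pat H, b.map f ∈ X.edgeSet} :=
    { toFun := fun c ↦ ⟨⟨c, c.injective⟩, fun b hb ↦ by
        rw [mem_pat] at hb
        induction b with | _ x y =>
        exact c.toHom.map_adj hb⟩
      invFun := fun f ↦ ⟨⟨f.1, fun {x y} h ↦ f.2 s(x, y) (mem_pat.2 h)⟩, f.1.injective⟩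
      left_inv := fun _ ↦ rfl
      right_inv := fun _ ↦ rfl }
  have h2 : X.labelledCopyCount H = Nat.card (SimpleGraph.Copy H X) := by
    unfold SimpleGraph.labelledCopyCount
    symm
    convert Nat.card_eq_fintype_card
  rw [Finset.sum_boole, h2, Nat.card_congr φ, Nat.card_eq_fintype_card, Fintype.card_subtype]

lemma sum_prod_addEdge_sub {v : ℕ} (E : Finset (Sym2 (Fin v))) (X : SimpleGraph (Fin n))
    {e : Sym2 (Fin n)} (he : e ∈ edges n) :
    ∑ f : Fin v ↪ Fin n, ∏ b ∈ E, ind (addEdge X e) (b.map f)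
      - ∑ f : Fin v ↪ Fin n, ∏ b ∈ E, ind (removeEdge X e) (b.map f) =
    ∑ a ∈ E, ∑ f ∈ rootedEmb a e, ∏ b ∈ E.erase a, ind X (b.map f) := by
  simp only [rootedEmb, Finset.sum_filter]
  rw [Finset.sum_comm, ← Finset.sum_sub_distrib]
  refine Finset.sum_congr rfl fun f _ ↦ ?_
  by_cases h : ∃ a ∈ E, a.map f = e
  · obtain ⟨a, ha, hae⟩ := h
    have hne : ∀ b, b ≠ a → b.map f ≠ e := fun b hb h ↦
      hb (Sym2.map.injective f.injective (h.trans hae.symm))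
    rw [Finset.sum_eq_single_of_mem a ha (fun b _ hb ↦ if_neg (hne b hb)), if_pos hae,
      ← Finset.mul_prod_erase E (fun b ↦ ind (addEdge X e) (b.map f)) ha,
      ← Finset.mul_prod_erase E (fun b ↦ ind (removeEdge X e) (b.map f)) ha]
    have h1 : ∏ b ∈ E.erase a, ind (addEdge X e) (b.map f) = ∏ b ∈ E.erase a, ind X (b.map f) :=
      Finset.prod_congr rfl fun b hb ↦ by
        simp [ind_addEdge X he, hne b (Finset.ne_of_mem_erase hb)]
    rw [h1]
    simp [ind_addEdge X he, ind_removeEdge, hae]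
  · push Not at h
    have h1 : ∏ b ∈ E, ind (addEdge X e) (b.map f) = ∏ b ∈ E, ind X (b.map f) :=
      Finset.prod_congr rfl fun b hb ↦ by simp [ind_addEdge X he, h b hb]
    have h2 : ∏ b ∈ E, ind (removeEdge X e) (b.map f) = ∏ b ∈ E, ind X (b.map f) :=
      Finset.prod_congr rfl fun b hb ↦ by simp [ind_removeEdge, h b hb]
    rw [h1, h2, sub_self]
    exact (Finset.sum_eq_zero fun a ha ↦ if_neg (h a ha)).symm

lemma two_le_of_not_isDiag {v : ℕ} {a : Sym2 (Fin v)} (ha : ¬ a.IsDiag) : 2 ≤ v := by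
  induction a with | _ x y =>
  have hxy : x ≠ y := by simpa using ha
  by_contra! hlt
  have := x.2; have := y.2
  exact hxy (Fin.ext (by omega))

lemma hamiltonian_addEdge_sub (hn : 0 < n) (X : SimpleGraph (Fin n)) {e : Sym2 (Fin n)}
    (he : e ∈ edges n) :
    hamiltonian V G β (addEdge X e) - hamiltonian V G β (removeEdge X e) = field V G β e X := by
  have hnR : (0 : ℝ) < n := by exact_mod_cast hn
  simp only [hamiltonian, field]
  rw [← Finset.sum_sub_distrib]
  refine Finset.sum_congr rfl fun i _ ↦ ?_
  rw [← mul_sub, ← sub_div, labelledCopyCount_eq, labelledCopyCount_eq,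
    sum_prod_addEdge_sub _ X he]
  rcases (pat (G i)).eq_empty_or_nonempty with h | ⟨a, ha⟩
  · simp [h]
  · have hv := two_le_of_not_isDiag (not_isDiag_of_mem_pat ha)
    have hz : (n : ℝ) ^ ((V i : ℤ) - 2) = (n : ℝ) ^ (V i - 2) := by
      rw [← zpow_natCast]; congr 1; omega
    rw [hz]
    simp only [dens]
    rw [← Finset.sum_div]
    field_simp

lemma gibbs_pos (X : SimpleGraph (Fin n)) : 0 < gibbs V G β X :=
  div_pos (Real.exp_pos _) (Finset.sum_pos (fun _ _ ↦ Real.exp_pos _) ⟨⊥, Finset.mem_univ _⟩)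

lemma sum_gibbs : ∑ X : SimpleGraph (Fin n), gibbs V G β X = 1 := by
  simp only [gibbs]
  rw [← Finset.sum_div, div_self]
  exact (Finset.sum_pos (fun _ _ ↦ Real.exp_pos _) ⟨⊥, Finset.mem_univ _⟩).ne'

lemma gibbs_ratio (hn : 0 < n) (X : SimpleGraph (Fin n)) {e : Sym2 (Fin n)} (he : e ∈ edges n) :
    gibbs V G β (addEdge X e) / (gibbs V G β (addEdge X e) + gibbs V G β (removeEdge X e)) =
      rate V G β e X := by
  have hZ : 0 < ∑ Y : SimpleGraph (Fin n), Real.exp (hamiltonian V G β Y) :=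
    Finset.sum_pos (fun _ _ ↦ Real.exp_pos _) ⟨⊥, Finset.mem_univ _⟩
  rw [rate, ← hamiltonian_addEdge_sub V G β hn X he, Real.sigmoid_def, neg_sub, Real.exp_sub]
  simp only [gibbs]
  have := Real.exp_pos (hamiltonian V G β (addEdge X e))
  have := Real.exp_pos (hamiltonian V G β (removeEdge X e))
  field_simp

lemma gibbs_ratio' (hn : 0 < n) (X : SimpleGraph (Fin n)) {e : Sym2 (Fin n)} (he : e ∈ edges n) :
    gibbs V G β (removeEdge X e) / (gibbs V G β (addEdge X e) + gibbs V G β (removeEdge X e)) =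
      1 - rate V G β e X := by
  rw [← gibbs_ratio V G β hn X he]
  have := gibbs_pos V G β (addEdge X e)
  have := gibbs_pos V G β (removeEdge X e)
  field_simp
  ring

lemma isRate_rate : IsRate (rate V G β (n := n)) := fun _ _ ↦
  ⟨Real.sigmoid_nonneg _, Real.sigmoid_le_one _⟩

lemma glauber_mulVec (hn : 0 < n) (f : SimpleGraph (Fin n) → ℝ) :
    (glauber V G β n).mulVec f = upd (rate V G β) f := by
  ext X
  simp only [Matrix.mulVec, dotProduct, glauber, upd_apply]
  simp only [mul_assoc, ← Finset.mul_sum, Finset.sum_mul]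
  congr 1
  rw [Finset.sum_comm]
  have hE : (⊤ : SimpleGraph (Fin n)).edgeFinset = edges n := by
    unfold edges; congr
  refine Finset.sum_congr (by convert hE) fun e he ↦ ?_
  have he' : e ∈ edges n := he
  rw [gibbs_ratio V G β hn X he', gibbs_ratio' V G β hn X he']
  simp [add_mul, Finset.sum_add_distrib]

lemma glauber_pow_sum (hn : 0 < n) (t : ℕ) (f : SimpleGraph (Fin n) → ℝ) (X : SimpleGraph (Fin n)) :
    ∑ Y, ((glauber V G β n) ^ t) X Y * f Y = (upd (rate V G β) ^ t) f X := by
  have h : ∀ t : ℕ, ((glauber V G β n) ^ t).mulVec f = (upd (rate V G β) ^ t) f := by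
    intro t
    induction t with
    | zero => simp
    | succ t ih =>
      rw [pow_succ', ← Matrix.mulVec_mulVec, ih, glauber_mulVec V G β hn, pow_succ',
        Module.End.mul_apply]
  exact congrFun (h t) X

/-- Averaging over the state of one edge does not change a sum over all graphs. -/
lemma sum_eq_sum_addEdge_add_removeEdge {e : Sym2 (Fin n)} (he : e ∈ edges n)
    (F : SimpleGraph (Fin n) → ℝ) :
    2 * ∑ X, F X = ∑ X, (F (addEdge X e) + F (removeEdge X e)) := by
  let τ : SimpleGraph (Fin n) → SimpleGraph (Fin n) := fun X ↦
    if e ∈ X.edgeSet then removeEdge X e else addEdge X e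
  have hτ : Function.Involutive τ := by
    intro X
    by_cases h : e ∈ X.edgeSet
    · have h1 : τ X = removeEdge X e := if_pos h
      have h2 : e ∉ (removeEdge X e).edgeSet := by simp [mem_removeEdge]
      rw [h1]
      change (if e ∈ (removeEdge X e).edgeSet then _ else _) = _
      rw [if_neg h2, addEdge_removeEdge X he, addEdge_of_mem he h]
    · have h1 : τ X = addEdge X e := if_neg h
      have h2 : e ∈ (addEdge X e).edgeSet := by simp [mem_addEdge he]
      rw [h1]
      change (if e ∈ (addEdge X e).edgeSet then _ else _) = _
      rw [if_pos h2, removeEdge_addEdge X he, removeEdge_of_notMem h]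
  have h1 : ∑ X, F (τ X) = ∑ X, F X := Equiv.sum_comp hτ.toPerm F
  rw [two_mul]
  nth_rewrite 2 [← h1]
  rw [← Finset.sum_add_distrib]
  refine Finset.sum_congr rfl fun X _ ↦ ?_
  by_cases h : e ∈ X.edgeSet
  · rw [show τ X = removeEdge X e from if_pos h, addEdge_of_mem he h]
  · rw [show τ X = addEdge X e from if_neg h, removeEdge_of_notMem h, add_comm]

/-- The Gibbs measure is stationary. -/
lemma sum_gibbs_mul_upd (hn : 2 ≤ n) (f : SimpleGraph (Fin n) → ℝ) :
    ∑ X, gibbs V G β X * upd (rate V G β) f X = ∑ X, gibbs V G β X * f X := by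
  have h : ∀ e ∈ edges n, ∑ X, gibbs V G β X * (rate V G β e X * f (addEdge X e)
      + (1 - rate V G β e X) * f (removeEdge X e)) = ∑ X, gibbs V G β X * f X := by
    intro e he
    have hn0 : 0 < n := by omega
    refine mul_left_cancel₀ two_ne_zero ?_
    rw [sum_eq_sum_addEdge_add_removeEdge he, sum_eq_sum_addEdge_add_removeEdge he]
    refine Finset.sum_congr rfl fun X _ ↦ ?_
    rw [← gibbs_ratio V G β hn0 _ he, ← gibbs_ratio V G β hn0 _ he]
    simp only [addEdge_addEdge, addEdge_removeEdge _ he, removeEdge_addEdge _ he,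
      removeEdge_removeEdge]
    have := gibbs_pos V G β (addEdge X e)
    have := gibbs_pos V G β (removeEdge X e)
    field_simp
    ring
  calc _ = (n.choose 2 : ℝ)⁻¹ * ∑ e ∈ edges n, ∑ X, gibbs V G β X *
        (rate V G β e X * f (addEdge X e) + (1 - rate V G β e X) * f (removeEdge X e)) := by
        rw [Finset.sum_comm, Finset.mul_sum]
        refine Finset.sum_congr rfl fun X _ ↦ ?_
        rw [upd_apply, ← Finset.mul_sum]; ring
    _ = _ := by
        rw [Finset.sum_congr rfl h, avg_const hn]

lemma sum_gibbs_mul_upd_pow (hn : 2 ≤ n) (t : ℕ) (f : SimpleGraph (Fin n) → ℝ) :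
    ∑ X, gibbs V G β X * (upd (rate V G β) ^ t) f X = ∑ X, gibbs V G β X * f X := by
  induction t with
  | zero => simp
  | succ t ih => rw [pow_succ', Module.End.mul_apply, sum_gibbs_mul_upd V G β hn, ih]

lemma tvDist_le (hn : 2 ≤ n) {t : ℕ} {δ : ℝ}
    (h : ∀ f : SimpleGraph (Fin n) → ℝ, (∀ X, |f X| ≤ 1) →
      ∀ X Y, (upd (rate V G β) ^ t) f X - (upd (rate V G β) ^ t) f Y ≤ δ)
    (X : SimpleGraph (Fin n)) : tvDist ((glauber V G β n ^ t) X) (gibbs V G β) ≤ δ / 2 := by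
  set μ := (glauber V G β n ^ t) X with hμ
  set f : SimpleGraph (Fin n) → ℝ := fun Y ↦ if gibbs V G β Y ≤ μ Y then 1 else -1 with hf
  have h1 : ∀ Y, |μ Y - gibbs V G β Y| = μ Y * f Y - gibbs V G β Y * f Y := by
    intro Y
    simp only [hf]
    split_ifs with hY
    · rw [abs_of_nonneg (sub_nonneg.2 hY)]; ring
    · rw [abs_of_neg (by linarith)]; ring
  have h2 : ∀ Y, |f Y| ≤ 1 := by
    intro Y; simp only [hf]; split_ifs <;> simp
  have h3 : ∑ Y, |μ Y - gibbs V G β Y| ≤ δ := by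
    rw [Finset.sum_congr rfl fun Y _ ↦ h1 Y, Finset.sum_sub_distrib, hμ,
      glauber_pow_sum V G β (by omega), ← sum_gibbs_mul_upd_pow V G β hn t f]
    calc _ = ∑ Y, gibbs V G β Y * ((upd (rate V G β) ^ t) f X - (upd (rate V G β) ^ t) f Y) := by
          simp only [mul_sub]
          rw [Finset.sum_sub_distrib, ← Finset.sum_mul, sum_gibbs, one_mul]
      _ ≤ ∑ Y, gibbs V G β Y * δ :=
          Finset.sum_le_sum fun Y _ ↦ mul_le_mul_of_nonneg_left (h f h2 X Y) (gibbs_pos V G β Y).le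
      _ = δ := by rw [← Finset.sum_mul, sum_gibbs, one_mul]
  rw [tvDist]; linarith

lemma upd_pow_sub_le_of_tvDist (hn : 2 ≤ n) {t : ℕ} {δ : ℝ}
    (h : ∀ X : SimpleGraph (Fin n), tvDist ((glauber V G β n ^ t) X) (gibbs V G β) ≤ δ)
    {f : SimpleGraph (Fin n) → ℝ} (h0 : ∀ X, 0 ≤ f X) (h1 : ∀ X, f X ≤ 1)
    (X Y : SimpleGraph (Fin n)) :
    (upd (rate V G β) ^ t) f X - (upd (rate V G β) ^ t) f Y ≤ 2 * δ := by
  have hM := (isMarkov_upd hn (isRate_rate V G β)).pow t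
  -- Centring `f` at `1 / 2` gains the factor two in the definition of the distance.
  set g : SimpleGraph (Fin n) → ℝ := f - fun _ ↦ 1 / 2 with hg
  have key : ∀ Z, |(upd (rate V G β) ^ t) g Z - ∑ W, gibbs V G β W * g W| ≤ δ := by
    intro Z
    refine le_trans ?_ (h Z)
    rw [← glauber_pow_sum V G β (by omega), ← Finset.sum_sub_distrib, tvDist, Finset.mul_sum]
    refine (Finset.abs_sum_le_sum_abs _ _).trans (Finset.sum_le_sum fun W _ ↦ ?_)
    rw [← sub_mul, abs_mul, mul_comm]
    refine mul_le_mul_of_nonneg_right ?_ (abs_nonneg _)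
    have := h0 W; have := h1 W
    simp only [hg, Pi.sub_apply]
    rw [abs_le]; constructor <;> linarith
  have e : ∀ Z, (upd (rate V G β) ^ t) g Z = (upd (rate V G β) ^ t) f Z - 1 / 2 := by
    intro Z
    rw [hg, map_sub, hM.const]; rfl
  have k1 := (abs_le.1 (key X)).2
  have k2 := (abs_le.1 (key Y)).1
  rw [e] at k1 k2
  linarith

end Model

/-! ### Burn-in -/

section BurnIn
variable {ι : Type*} [Fintype ι] (V : ι → ℕ) (G : (i : ι) → SimpleGraph (Fin (V i))) (β : ι → ℝ)
variable {n : ℕ}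

/-- The dynamics is attractive: a negative coefficient occurs only at a pattern with at most one
edge, which contributes a constant to the field. -/
def Attractive : Prop := ∀ i, 0 ≤ β i ∨ (pat (G i)).card ≤ 1

/-- The graph `X` looks from above (`s = 1`) or from below (`s = -1`) like a random graph of
density `q`, up to `η`, in all rooted densities of subpatterns of the `G i`. -/
def IsGood (s q η : ℝ) (X : SimpleGraph (Fin n)) : Prop :=
  ∀ i, ∀ a ∈ pat (G i), ∀ S ⊆ (pat (G i)).erase a, ∀ e ∈ edges n,
    s * (dens a S X e - q ^ S.card) ≤ η

/-- The indicator function of the graphs that are not good. -/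
def bad (s q η : ℝ) (X : SimpleGraph (Fin n)) : ℝ := if IsGood V G s q η X then 0 else 1

/-- A Lipschitz constant for the field as a function of the rooted densities. -/
def fieldConst : ℝ := ∑ i, 2 * |β i| * (pat (G i)).card

lemma fieldConst_nonneg : 0 ≤ fieldConst V G β :=
  Finset.sum_nonneg fun i _ ↦ by positivity

variable {V G β}

lemma erase_eq_empty_of_card_le_one {v : ℕ} {H : SimpleGraph (Fin v)} (h : (pat H).card ≤ 1)
    {a : Sym2 (Fin v)} (ha : a ∈ pat H) : (pat H).erase a = ∅ := by
  rw [← Finset.card_eq_zero, Finset.card_erase_of_mem ha]; omega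

lemma Attractive.field_mono (hβ : Attractive V G β) (e : Sym2 (Fin n)) :
    Monotone (field V G β e) := by
  intro X Y h
  refine Finset.sum_le_sum fun i _ ↦ ?_
  rcases hβ i with h0 | h1
  · exact mul_le_mul_of_nonneg_left (Finset.sum_le_sum fun a _ ↦ dens_mono a _ e h) (by positivity)
  · refine le_of_eq (congrArg _ (Finset.sum_congr rfl fun a ha ↦ ?_))
    rw [erase_eq_empty_of_card_le_one h1 ha, dens_empty, dens_empty]

lemma Attractive.rate_mono (hβ : Attractive V G β) (e : Sym2 (Fin n)) :
    Monotone (rate V G β e) := fun _ _ h ↦ Real.sigmoid_le (hβ.field_mono e h)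

lemma phi_eq_sigmoid (q : ℝ) : phi V G β q = Real.sigmoid (Psi V G β q) := by
  rw [phi, Real.sigmoid_def, Real.exp_neg]
  have := Real.exp_pos (Psi V G β q)
  field_simp
  ring

lemma sigmoid_sub_le {a b c : ℝ} (h : a - b ≤ c) (hc : 0 ≤ c) :
    Real.sigmoid a - Real.sigmoid b ≤ c := by
  have hd : ∀ x, ‖deriv Real.sigmoid x‖ ≤ 1 := by
    intro x
    rw [Real.deriv_sigmoid, Real.norm_eq_abs]
    have h1 := Real.sigmoid_pos x
    have h2 := Real.sigmoid_lt_one x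
    dsimp only
    rw [abs_of_nonneg (by nlinarith)]
    nlinarith
  rcases le_total a b with hab | hab
  · linarith [Real.sigmoid_le hab]
  · have := Convex.norm_image_sub_le_of_norm_deriv_le (s := Set.univ) (f := Real.sigmoid)
      (fun x _ ↦ differentiable_sigmoid x) (fun x _ ↦ hd x) convex_univ
      (Set.mem_univ b) (Set.mem_univ a)
    rw [one_mul, Real.norm_eq_abs, Real.norm_eq_abs, abs_of_nonneg (sub_nonneg.2 hab)] at this
    linarith [le_abs_self (Real.sigmoid a - Real.sigmoid b)]

/-- All error terms of order `1 / n` in the counts of embeddings are below `η`. -/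
def IsLarge (V : ι → ℕ) (η : ℝ) (n : ℕ) : Prop := 2 ≤ n ∧ ∀ i, V i ≤ n ∧ (V i : ℝ) ^ 2 / n ≤ η

lemma eventually_isLarge (V : ι → ℕ) {η : ℝ} (hη : 0 < η) : ∀ᶠ n in atTop, IsLarge V η n := by
  refine (eventually_ge_atTop 2).and ?_
  rw [eventually_all]
  intro i
  refine (eventually_ge_atTop (V i)).and ?_
  have : Tendsto (fun n : ℕ ↦ (V i : ℝ) ^ 2 / n) atTop (nhds 0) :=
    tendsto_const_div_atTop_nhds_zero_nat _
  exact (this.eventually (gt_mem_nhds hη)).mono fun _ h ↦ h.le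

lemma IsGood.field_le (hβ : Attractive V G β) {s q η : ℝ} (hs : |s| = 1)
    (hn : IsLarge V η n) {X : SimpleGraph (Fin n)} (hX : IsGood V G s q η X)
    {e : Sym2 (Fin n)} (he : e ∈ edges n) :
    s * (field V G β e X - Psi V G β q) ≤ fieldConst V G β * η := by
  have h2 : Psi V G β q = ∑ i, 2 * β i * ∑ a ∈ pat (G i), q ^ ((pat (G i)).erase a).card := by
    refine Finset.sum_congr rfl fun i _ ↦ ?_
    rw [Finset.sum_congr rfl (g := fun _ ↦ q ^ ((pat (G i)).card - 1)), Finset.sum_const,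
      nsmul_eq_mul, card_pat, mul_assoc]
    intro a ha
    rw [Finset.card_erase_of_mem ha]
  rw [field, h2, ← Finset.sum_sub_distrib, Finset.mul_sum, fieldConst, Finset.sum_mul]
  refine Finset.sum_le_sum fun i _ ↦ ?_
  rw [← mul_sub, ← Finset.sum_sub_distrib]
  have e1 : s * (2 * β i * ∑ a ∈ pat (G i), (dens a ((pat (G i)).erase a) X e
      - q ^ ((pat (G i)).erase a).card)) = 2 * β i * ∑ a ∈ pat (G i),
      (s * (dens a ((pat (G i)).erase a) X e - q ^ ((pat (G i)).erase a).card)) := by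
    rw [← Finset.mul_sum]; ring
  have e2 : 2 * |β i| * (pat (G i)).card * η = 2 * |β i| * ∑ a ∈ pat (G i), η := by
    rw [Finset.sum_const, nsmul_eq_mul]; ring
  rw [e1, e2]
  rcases hβ i with h0 | h1
  · rw [abs_of_nonneg h0]
    exact mul_le_mul_of_nonneg_left
      (Finset.sum_le_sum fun a ha ↦ hX i a ha _ subset_rfl e he) (by positivity)
  · refine (le_abs_self _).trans ?_
    rw [abs_mul, abs_mul, abs_two]
    refine mul_le_mul_of_nonneg_left ?_ (by positivity)
    refine (Finset.abs_sum_le_sum_abs _ _).trans (Finset.sum_le_sum fun a ha ↦ ?_)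
    rw [abs_mul, hs, one_mul, erase_eq_empty_of_card_le_one h1 ha, Finset.card_empty, pow_zero]
    exact (abs_dens_empty_sub_one_le (hn.2 i).1 (by linarith [hn.1])
      (not_isDiag_of_mem_pat ha) X he).trans (hn.2 i).2

lemma eq_or_eq_neg_one {s : ℝ} (hs : |s| = 1) : s = 1 ∨ s = -1 := eq_or_eq_neg_of_abs_eq hs

lemma IsGood.rate_le (hβ : Attractive V G β) {s q η : ℝ} (hs : |s| = 1) (hη : 0 ≤ η)
    (hn : IsLarge V η n) {X : SimpleGraph (Fin n)} (hX : IsGood V G s q η X)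
    {e : Sym2 (Fin n)} (he : e ∈ edges n) :
    s * (rate V G β e X - phi V G β q) ≤ fieldConst V G β * η := by
  have h := hX.field_le hβ hs hn he
  have hC := mul_nonneg (fieldConst_nonneg V G β) hη
  rw [phi_eq_sigmoid, rate]
  rcases eq_or_eq_neg_one hs with rfl | rfl
  · rw [one_mul] at *
    exact sigmoid_sub_le h hC
  · have := sigmoid_sub_le (a := Psi V G β q) (b := field V G β e X) (by linarith) hC
    linarith

omit [Fintype ι] in
lemma bad_nonneg (s q η : ℝ) (X : SimpleGraph (Fin n)) : 0 ≤ bad V G s q η X := by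
  unfold bad; split_ifs <;> norm_num

omit [Fintype ι] in
lemma bad_le_one (s q η : ℝ) (X : SimpleGraph (Fin n)) : bad V G s q η X ≤ 1 := by
  unfold bad; split_ifs <;> norm_num

omit [Fintype ι] in
lemma mul_bad_mono {s : ℝ} (hs : |s| = 1) (q η : ℝ) :
    Monotone fun X : SimpleGraph (Fin n) ↦ s * bad V G s q η X := by
  intro X Y h
  rcases eq_or_eq_neg_one hs with rfl | rfl
  · have : IsGood V G 1 q η Y → IsGood V G 1 q η X := fun hY i a ha S hS e he ↦ by
      have h1 := hY i a ha S hS e he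
      have h2 := dens_mono a S e h
      dsimp only at h2
      linarith
    simp only [bad]
    split_ifs <;> simp_all
  · have : IsGood V G (-1) q η X → IsGood V G (-1) q η Y := fun hX i a ha S hS e he ↦ by
      have h1 := hX i a ha S hS e he
      have h2 := dens_mono a S e h
      dsimp only at h2
      linarith
    simp only [bad]
    split_ifs <;> simp_all

/-- On good graphs one Glauber step is dominated by an independent update. -/
lemma upd_rate_le (hβ : Attractive V G β) {s q q' η : ℝ} (hs : |s| = 1) (hη : 0 ≤ η)
    (hn : IsLarge V η n) (h0 : 0 ≤ q') (h1 : q' ≤ 1)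
    (hq : fieldConst V G β * η ≤ s * (q' - phi V G β q)) {f : SimpleGraph (Fin n) → ℝ}
    (hf : Monotone fun X ↦ s * f X) (hf0 : ∀ X, 0 ≤ f X) (hf1 : ∀ X, f X ≤ 1) :
    upd (rate V G β) f ≤ upd (fun _ _ ↦ q') f + bad V G s q η := by
  intro X
  have hQ : IsRate (fun (_ : Sym2 (Fin n)) (_ : SimpleGraph (Fin n)) ↦ q') := fun _ _ ↦ ⟨h0, h1⟩
  rw [Pi.add_apply]
  by_cases hX : IsGood V G s q η X
  · rw [bad, if_pos hX, add_zero]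
    refine avg_le_avg fun e he ↦ ?_
    have a1 := hX.rate_le hβ hs hη hn he
    have a2 := hf (removeEdge_le_addEdge X e)
    dsimp only at a2
    have a3 : 0 ≤ (s * (q' - rate V G β e X)) * (s * f (addEdge X e) - s * f (removeEdge X e)) :=
      mul_nonneg (by linarith) (by linarith)
    have hs2 : s * s = 1 := by rw [← abs_mul_abs_self, hs, one_mul]
    have a4 : (s * (q' - rate V G β e X)) * (s * f (addEdge X e) - s * f (removeEdge X e)) =
      (s * s) * ((q' - rate V G β e X) * (f (addEdge X e) - f (removeEdge X e))) := by ring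
    rw [a4, hs2, one_mul] at a3
    nlinarith
  · rw [bad, if_neg hX]
    have a1 := (isMarkov_upd hn.1 (isRate_rate V G β)).le_const hf1 X
    have a2 := (isMarkov_upd hn.1 hQ).const_le hf0 X
    linarith

lemma upd_rate_pow_bad_le (hβ : Attractive V G β) {s q q' η : ℝ} (hs : |s| = 1) (hη : 0 ≤ η)
    (hn : IsLarge V η n) (h0 : 0 ≤ q') (h1 : q' ≤ 1)
    (hq : fieldConst V G β * η ≤ s * (q' - phi V G β q)) (t : ℕ) :
    (upd (rate V G β) ^ t) (bad V G s q' η) ≤ (upd (fun _ _ ↦ q') ^ t) (bad V G s q' η)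
      + ∑ u ∈ Finset.range t, (upd (rate V G β) ^ u) (bad V G s q η (n := n)) := by
  have hQ : IsRate (fun (_ : Sym2 (Fin n)) (_ : SimpleGraph (Fin n)) ↦ q') := fun _ _ ↦ ⟨h0, h1⟩
  refine (isMarkov_upd hn.1 (isRate_rate V G β)).pow_le_add_sum _ _ _ (fun u ↦ ?_) t
  have hM := (isMarkov_upd hn.1 hQ).pow u
  refine upd_rate_le hβ hs hη hn h0 h1 hq ?_ (hM.const_le (bad_nonneg s q' η))
    (hM.le_const (bad_le_one s q' η))
  have := upd_pow_monotone hQ (fun _ _ _ _ _ ↦ le_rfl) (mul_bad_mono (V := V) (G := G) hs q' η) u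
  have e : (fun X : SimpleGraph (Fin n) ↦ s * bad V G s q' η X) = s • bad V G s q' η := rfl
  rw [e, map_smul] at this
  exact this

/-- The number of rooted subpatterns. -/
def numPatterns (G : (i : ι) → SimpleGraph (Fin (V i))) : ℝ :=
  ∑ i, ∑ a ∈ pat (G i), (((pat (G i)).erase a).powerset.card : ℝ)

/-- Union bound over the events that violate goodness. -/
lemma upd_const_pow_bad_le (hn : 2 ≤ n) {s q η ε : ℝ} (h0 : 0 ≤ q) (h1 : q ≤ 1) (t : ℕ)
    (X : SimpleGraph (Fin n))
    (h : ∀ i, ∀ a ∈ pat (G i), ∀ S ⊆ (pat (G i)).erase a, ∀ e ∈ edges n,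
      (upd (fun _ _ ↦ q) ^ t) (fun Y ↦ if η < s * (dens a S Y e - q ^ S.card) then 1 else 0) X
        ≤ ε) :
    (upd (fun _ _ ↦ q) ^ t) (bad V G s q η) X ≤ numPatterns G * (n.choose 2 * ε) := by
  have hQ : IsRate (fun (_ : Sym2 (Fin n)) (_ : SimpleGraph (Fin n)) ↦ q) := fun _ _ ↦ ⟨h0, h1⟩
  have hM := (isMarkov_upd hn hQ).pow t
  have hle : bad V G s q η ≤ ∑ i, ∑ a ∈ pat (G i), ∑ S ∈ ((pat (G i)).erase a).powerset,
      ∑ e ∈ edges n, fun Y ↦ if η < s * (dens a S Y e - q ^ S.card) then (1 : ℝ) else 0 := by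
    intro Y
    simp only [Finset.sum_apply]
    have nn : ∀ (P : Prop) [Decidable P], (0 : ℝ) ≤ if P then 1 else 0 := by
      intro P _; split_ifs <;> norm_num
    by_cases hY : IsGood V G s q η Y
    · rw [bad, if_pos hY]
      exact Finset.sum_nonneg fun i _ ↦ Finset.sum_nonneg fun a _ ↦ Finset.sum_nonneg fun S _ ↦
        Finset.sum_nonneg fun e _ ↦ nn _
    · rw [bad, if_neg hY]
      unfold IsGood at hY
      push Not at hY
      obtain ⟨i, a, ha, S, hS, e, he, hlt⟩ := hY
      have b1 := Finset.single_le_sum (f := fun e ↦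
        if η < s * (dens a S Y e - q ^ S.card) then (1 : ℝ) else 0) (fun e _ ↦ nn _) he
      have b2 := Finset.single_le_sum (f := fun S ↦ ∑ e ∈ edges n,
        if η < s * (dens a S Y e - q ^ S.card) then (1 : ℝ) else 0)
        (fun S _ ↦ Finset.sum_nonneg fun e _ ↦ nn _) (Finset.mem_powerset.2 hS)
      have b3 := Finset.single_le_sum (f := fun a ↦ ∑ S ∈ ((pat (G i)).erase a).powerset,
        ∑ e ∈ edges n, if η < s * (dens a S Y e - q ^ S.card) then (1 : ℝ) else 0)
        (fun a _ ↦ Finset.sum_nonneg fun S _ ↦ Finset.sum_nonneg fun e _ ↦ nn _) ha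
      have b4 := Finset.single_le_sum (f := fun i ↦ ∑ a ∈ pat (G i),
        ∑ S ∈ ((pat (G i)).erase a).powerset,
        ∑ e ∈ edges n, if η < s * (dens a S Y e - q ^ S.card) then (1 : ℝ) else 0)
        (fun i _ ↦ Finset.sum_nonneg fun a _ ↦ Finset.sum_nonneg fun S _ ↦
          Finset.sum_nonneg fun e _ ↦ nn _) (Finset.mem_univ i)
      rw [if_pos hlt] at b1
      linarith
  refine (hM.mono hle X).trans ?_
  simp only [map_sum, Finset.sum_apply]
  rw [numPatterns, Finset.sum_mul]
  refine Finset.sum_le_sum fun i _ ↦ ?_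
  rw [Finset.sum_mul]
  refine Finset.sum_le_sum fun a ha ↦ ?_
  rw [← nsmul_eq_mul]
  refine Finset.sum_le_card_nsmul _ _ _ fun S hS ↦ ?_
  rw [← card_edges, ← nsmul_eq_mul]
  exact Finset.sum_le_card_nsmul _ _ _ fun e he ↦ h i a ha S (Finset.mem_powerset.1 hS) e he

lemma choose_two_le (n : ℕ) : (n.choose 2 : ℝ) ≤ n ^ 2 / 2 := by
  rw [Nat.cast_choose_two]
  have : (0 : ℝ) ≤ n := by positivity
  nlinarith

lemma le_choose_two (hn : 2 ≤ n) : (n : ℝ) ^ 2 / 4 ≤ n.choose 2 := by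
  rw [Nat.cast_choose_two]
  have : (2 : ℝ) ≤ n := by exact_mod_cast hn
  nlinarith

lemma one_sub_inv_pow_le (hn : 2 ≤ n) {c : ℝ} (hc0 : 0 ≤ c) (hc1 : c ≤ 1) (t : ℕ) :
    (1 - c * (n.choose 2 : ℝ)⁻¹) ^ t ≤ Real.exp (-(2 * c * t / n ^ 2)) := by
  have hN := choose_two_pos hn
  have hN1 : (1 : ℝ) ≤ n.choose 2 := by exact_mod_cast Nat.choose_pos hn
  have hnR : (0 : ℝ) < n := by exact_mod_cast (by omega : 0 < n)
  have h1 : (2 : ℝ) / n ^ 2 ≤ (n.choose 2 : ℝ)⁻¹ := by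
    rw [← inv_div]
    exact inv_anti₀ hN (choose_two_le n)
  have h2 : (n.choose 2 : ℝ)⁻¹ ≤ 1 := inv_le_one_of_one_le₀ hN1
  have h4 : c * (2 / (n : ℝ) ^ 2) ≤ c * (n.choose 2 : ℝ)⁻¹ := mul_le_mul_of_nonneg_left h1 hc0
  have h3 : 1 - c * (n.choose 2 : ℝ)⁻¹ ≤ Real.exp (-(c * (2 / n ^ 2))) := by
    linarith [Real.add_one_le_exp (-(c * (2 / (n : ℝ) ^ 2)))]
  refine (pow_le_pow_left₀ (by nlinarith [inv_pos.2 hN]) h3 t).trans_eq ?_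
  rw [← Real.exp_nat_mul]
  congr 1; ring

lemma exists_moment_parameter (L K : ℝ) {η : ℝ} (hη : 0 < η) :
    ∃ θ > 0, θ * (2 * L) ≤ 1 ∧ 8 * K * θ * L ^ 2 ≤ η / 4 := by
  have h1 : ∀ᶠ θ : ℝ in nhdsWithin 0 (Set.Ioi 0), θ * (2 * L) < 1 :=
    nhdsWithin_le_nhds ((by fun_prop : Continuous fun θ : ℝ ↦ θ * (2 * L)).continuousAt.eventually
      (gt_mem_nhds (by simp)))
  have h2 : ∀ᶠ θ : ℝ in nhdsWithin 0 (Set.Ioi 0), 8 * K * θ * L ^ 2 < η / 4 :=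
    nhdsWithin_le_nhds ((by fun_prop : Continuous fun θ : ℝ ↦ 8 * K * θ * L ^ 2).continuousAt
      |>.eventually (gt_mem_nhds (by simpa using hη)))
  obtain ⟨θ, ⟨a, b⟩, c⟩ := ((h1.and h2).and self_mem_nhdsWithin).exists
  exact ⟨θ, c, a.le, b.le⟩

variable (V G) in
/-- Independent updates reach goodness for their own density in order `n ^ 2` steps, with
exponentially small failure probability. -/
lemma exists_upd_const_pow_bad_le {η : ℝ} (hη : 0 < η) :
    ∃ K : ℕ, ∃ c > 0, ∀ᶠ n in atTop, ∀ s q : ℝ, |s| = 1 → 0 ≤ q → q ≤ 1 →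
      ∀ X : SimpleGraph (Fin n), (upd (fun _ _ ↦ q) ^ (K * n ^ 2)) (bad V G s q η) X ≤
        numPatterns G * (n ^ 2 * Real.exp (-(c * n))) := by
  obtain ⟨L, hL⟩ : ∃ L : ℕ, ∀ i, (pat (G i)).card ≤ L :=
    ⟨∑ i, (pat (G i)).card, fun i ↦ Finset.single_le_sum (f := fun i ↦ (pat (G i)).card)
      (fun _ _ ↦ Nat.zero_le _) (Finset.mem_univ i)⟩
  obtain ⟨K, hK⟩ : ∃ K : ℕ, L * Real.exp (-(2 * K)) ≤ η / 4 := by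
    have h1 : Tendsto (fun K : ℕ ↦ (L : ℝ) * Real.exp (-(2 * (K : ℝ)))) atTop (nhds (L * 0)) := by
      refine Tendsto.const_mul _ (Real.tendsto_exp_neg_atTop_nhds_zero.comp ?_)
      exact tendsto_natCast_atTop_atTop.const_mul_atTop two_pos
    rw [mul_zero] at h1
    have h2 := h1.eventually (gt_mem_nhds (by positivity : (0 : ℝ) < η / 4))
    exact h2.exists.imp fun _ h ↦ h.le
  -- The exponential moment is taken at the parameter `θ * n`.
  obtain ⟨θ, hθ0, hθ1, hθ2⟩ := exists_moment_parameter L K hη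
  refine ⟨K, θ * η / 4, by positivity, ?_⟩
  filter_upwards [eventually_isLarge V (by positivity : 0 < η / 4)] with n hn s q hs h0 h1 X
  have hnR : (0 : ℝ) < n := Nat.cast_pos.2 (two_pos.trans_le hn.1)
  have hP : 0 ≤ numPatterns G := by unfold numPatterns; positivity
  refine (upd_const_pow_bad_le (ε := Real.exp (-(θ * η / 4 * n))) hn.1 h0 h1 _ X ?_).trans ?_
  · intro i a ha S hS e he
    have hSd : ∀ b ∈ S, ¬ b.IsDiag := fun b hb ↦
      not_isDiag_of_mem_pat (Finset.mem_of_mem_erase (hS hb))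
    have haS : a ∉ S := fun h ↦ Finset.notMem_erase _ _ (hS h)
    have hSL : (S.card : ℝ) ≤ L := by
      exact_mod_cast (Finset.card_le_card (hS.trans (Finset.erase_subset _ _))).trans (hL i)
    have hdecay : (S.card : ℝ) * (1 - (n.choose 2 : ℝ)⁻¹) ^ (K * n ^ 2) ≤ η / 4 := by
      refine le_trans (mul_le_mul hSL ?_ ?_ (by positivity)) hK
      · have := one_sub_inv_pow_le hn.1 zero_le_one le_rfl (K * n ^ 2)
        rw [one_mul] at this
        refine this.trans_eq ?_
        congr 2
        push_cast
        field_simp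
      · refine pow_nonneg (sub_nonneg.2 (inv_le_one_of_one_le₀ ?_)) _
        exact_mod_cast Nat.choose_pos hn.1
    have hl : θ * n * (2 * S.card) ≤ n := by
      calc θ * n * (2 * S.card) ≤ θ * n * (2 * L) := by gcongr
        _ = n * (θ * (2 * L)) := by ring
        _ ≤ n * 1 := by gcongr
        _ = n := mul_one _
    have := upd_const_pow_dens_tail hn.1 (hn.2 i).1 h0 h1 (not_isDiag_of_mem_pat ha) hSd haS he
      (K * n ^ 2) hs (l := θ * n) (by positivity) hl hdecay (hn.2 i).2 X
    refine this.trans (Real.exp_le_exp.2 ?_)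
    have hN := le_choose_two hn.1
    have hN0 := choose_two_pos hn.1
    have hTN : ((K * n ^ 2 : ℕ) : ℝ) * (n.choose 2 : ℝ)⁻¹ ≤ 4 * K := by
      rw [← div_eq_mul_inv, div_le_iff₀ hN0]
      push_cast
      nlinarith [mul_le_mul_of_nonneg_left hN (by positivity : (0 : ℝ) ≤ 4 * K)]
    have hS2 : (S.card : ℝ) ^ 2 ≤ L ^ 2 := pow_le_pow_left₀ (by positivity) hSL 2
    calc _ = (((K * n ^ 2 : ℕ) : ℝ) * (n.choose 2 : ℝ)⁻¹) * (θ ^ 2 * n * 2) * S.card ^ 2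
          - θ * n * (η / 2) := by field_simp
      _ ≤ 4 * K * (θ ^ 2 * n * 2) * L ^ 2 - θ * n * (η / 2) := by gcongr
      _ = θ * n * (8 * K * θ * L ^ 2) - θ * n * (η / 2) := by ring
      _ ≤ θ * n * (η / 4) - θ * n * (η / 2) := by gcongr
      _ = _ := by ring
  · refine mul_le_mul_of_nonneg_left (mul_le_mul_of_nonneg_right ?_ (Real.exp_pos _).le) hP
    have := choose_two_le n
    have : (0 : ℝ) ≤ n ^ 2 := by positivity
    linarith

variable (V G β) in
/-- After order `n ^ 2` steps of the Glauber dynamics from any initial state, the graph is good for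
`q` at each later time, up to a probability smaller than every power of `1 / n`. -/
def Reaches (η s q : ℝ) : Prop := ∃ K : ℕ, ∀ m : ℕ, ∀ᶠ n : ℕ in atTop, ∀ t, K * n ^ 2 ≤ t →
  ∀ X : SimpleGraph (Fin n), (upd (rate V G β) ^ t) (bad V G s q η) X ≤ ((n : ℝ) ^ m)⁻¹

lemma reaches_of_eventually_isGood {η s q : ℝ}
    (h : ∀ᶠ n : ℕ in atTop, ∀ X : SimpleGraph (Fin n), IsGood V G s q η X) :
    Reaches V G β η s q := by
  refine ⟨0, fun m ↦ ?_⟩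
  filter_upwards [h, eventually_ge_atTop 2] with n hn h2 t _ X
  refine ((isMarkov_upd h2 (isRate_rate V G β)).pow t).le_const (fun Y ↦ ?_) X
  rw [bad, if_pos (hn Y)]
  positivity

lemma reaches_one {η : ℝ} (hη : 0 < η) : Reaches V G β η 1 1 := by
  refine reaches_of_eventually_isGood ?_
  filter_upwards [eventually_ge_atTop 1] with n hn X i a ha S _ e _
  have := dens_le_one hn (not_isDiag_of_mem_pat ha) S X e
  rw [one_pow]; linarith

lemma reaches_zero {η : ℝ} (hη : 0 < η) : Reaches V G β η (-1) 0 := by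
  refine reaches_of_eventually_isGood ?_
  filter_upwards [eventually_isLarge V hη] with n hn X i a ha S _ e he
  rcases S.eq_empty_or_nonempty with rfl | hS
  · have := abs_dens_empty_sub_one_le (hn.2 i).1 (by linarith [hn.1]) (not_isDiag_of_mem_pat ha) X he
    have := (abs_le.1 (this.trans (hn.2 i).2)).1
    rw [Finset.card_empty, pow_zero]; linarith
  · have := dens_nonneg a S X e
    rw [zero_pow hS.card_pos.ne']; linarith

/-- One stage of the burn-in: from goodness for `q` to goodness for `φ(q)`, up to an error. -/
lemma Reaches.step (hβ : Attractive V G β) {η s q q' : ℝ} (hη : 0 < η)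
    (hs : |s| = 1) (h : Reaches V G β η s q) (h0 : 0 ≤ q') (h1 : q' ≤ 1)
    (hq : fieldConst V G β * η ≤ s * (q' - phi V G β q)) : Reaches V G β η s q' := by
  obtain ⟨K, hK⟩ := h
  obtain ⟨K', c, hc, hK'⟩ := exists_upd_const_pow_bad_le V G hη
  refine ⟨K + K', fun m ↦ ?_⟩
  have hP : 0 ≤ numPatterns G := by unfold numPatterns; positivity
  have hsmall : ∀ᶠ n : ℕ in atTop,
      numPatterns G * (n ^ 2 * Real.exp (-(c * n))) ≤ ((n : ℝ) ^ m)⁻¹ / 2 := by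
    have ho := (isLittleO_pow_exp_pos_mul_atTop (m + 2) hc).comp_tendsto
      (tendsto_natCast_atTop_atTop (R := ℝ))
    have := ho.bound (by positivity : 0 < 1 / (2 * (numPatterns G + 1)))
    filter_upwards [this, eventually_ge_atTop 1] with n hn hn1
    have hnR : (0 : ℝ) < n := by exact_mod_cast hn1
    simp only [Function.comp_apply, Real.norm_eq_abs, Real.abs_exp] at hn
    rw [abs_of_nonneg (by positivity), one_div, inv_mul_eq_div, le_div_iff₀ (by positivity)] at hn
    rw [Real.exp_neg, le_div_iff₀ two_pos, ← one_div ((n : ℝ) ^ m), le_div_iff₀ (by positivity)]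
    have he := Real.exp_pos (c * n)
    rw [show numPatterns G * ((n : ℝ) ^ 2 * (Real.exp (c * n))⁻¹) * 2 * (n : ℝ) ^ m =
      ((n : ℝ) ^ (m + 2) * (2 * numPatterns G)) / Real.exp (c * n) by rw [pow_add]; field_simp,
      div_le_one he]
    refine le_trans ?_ hn
    gcongr
    linarith
  filter_upwards [hK (m + 4), hK', hsmall, eventually_isLarge V hη,
    eventually_ge_atTop (2 * K' + 1)] with n a1 a2 a3 hn hnK t ht X
  obtain ⟨u, rfl⟩ : ∃ u, t = (K * n ^ 2 + u) + K' * n ^ 2 :=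
    ⟨t - (K + K') * n ^ 2, by rw [add_mul] at ht ⊢; omega⟩
  have hM := isMarkov_upd hn.1 (isRate_rate V G β)
  have hnR : (0 : ℝ) < n := by exact_mod_cast (by omega : 0 < n)
  set ε := numPatterns G * ((n : ℝ) ^ 2 * Real.exp (-(c * n)))
  have b1 : (upd (rate V G β) ^ (K' * n ^ 2)) (bad V G s q' η) ≤ (fun _ ↦ ε) +
      ∑ u ∈ Finset.range (K' * n ^ 2), (upd (rate V G β) ^ u) (bad V G s q η (n := n)) :=
    (upd_rate_pow_bad_le hβ hs hη.le hn h0 h1 hq _).trans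
      (add_le_add_left (fun Y ↦ a2 s q' hs h0 h1 Y) _)
  have b2 := (hM.pow (K * n ^ 2 + u)).mono b1 X
  rw [map_add, (hM.pow _).const, map_sum, Pi.add_apply, Finset.sum_apply] at b2
  rw [pow_add, Module.End.mul_apply]
  refine b2.trans ?_
  have b3 : ∑ w ∈ Finset.range (K' * n ^ 2), (upd (rate V G β) ^ (K * n ^ 2 + u))
      ((upd (rate V G β) ^ w) (bad V G s q η)) X ≤ (K' * n ^ 2 : ℕ) * ((n : ℝ) ^ (m + 4))⁻¹ := by
    rw [← nsmul_eq_mul]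
    refine (Finset.sum_le_card_nsmul _ _ (((n : ℝ) ^ (m + 4))⁻¹) fun w _ ↦ ?_).trans_eq (by simp)
    rw [← Module.End.mul_apply, ← pow_add]
    exact a1 _ (by omega) X
  have b4 : ((K' * n ^ 2 : ℕ) : ℝ) * ((n : ℝ) ^ (m + 4))⁻¹ ≤ ((n : ℝ) ^ m)⁻¹ / 2 := by
    have hK'n : 2 * (K' : ℝ) ≤ n := by exact_mod_cast (by omega : 2 * K' ≤ n)
    have hn1 : (1 : ℝ) ≤ n := by exact_mod_cast (by omega : 1 ≤ n)
    push_cast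
    rw [pow_add, mul_inv, le_div_iff₀ two_pos]
    have : (K' : ℝ) * n ^ 2 * ((n : ℝ) ^ 4)⁻¹ * 2 ≤ 1 := by
      rw [← div_eq_mul_inv, div_mul_eq_mul_div, div_le_one (by positivity)]
      nlinarith [mul_le_mul_of_nonneg_right hK'n (by positivity : (0 : ℝ) ≤ (n : ℝ) ^ 2),
        pow_le_pow_right₀ hn1 (by norm_num : 3 ≤ 4)]
    nlinarith [inv_pos.2 (by positivity : (0 : ℝ) < (n : ℝ) ^ m)]
  change ε + _ ≤ _
  linarith

end BurnIn

/-! ### Burn-in to a neighbourhood of the fixed point -/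

section FixedPoint
variable {ι : Type*} [Fintype ι] {V : ι → ℕ} {G : (i : ι) → SimpleGraph (Fin (V i))} {β : ι → ℝ}

lemma continuous_Psi : Continuous (Psi V G β) := by unfold Psi; fun_prop

lemma continuous_phi : Continuous (phi V G β) := by
  have : phi V G β = Real.sigmoid ∘ Psi V G β := funext phi_eq_sigmoid
  rw [this]
  exact continuous_sigmoid.comp continuous_Psi

lemma phi_pos (q : ℝ) : 0 < phi V G β q := by rw [phi_eq_sigmoid]; exact Real.sigmoid_pos _

lemma phi_lt_one (q : ℝ) : phi V G β q < 1 := by rw [phi_eq_sigmoid]; exact Real.sigmoid_lt_one _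

lemma Reaches.mono {η s q q' : ℝ} (hs : |s| = 1) (h : Reaches V G β η s q) (h0 : 0 ≤ q)
    (h0' : 0 ≤ q') (hq : s * q ≤ s * q') : Reaches V G β η s q' := by
  obtain ⟨K, hK⟩ := h
  refine ⟨K, fun m ↦ ?_⟩
  filter_upwards [hK m, eventually_ge_atTop 2] with n hn h2 t ht X
  refine le_trans (((isMarkov_upd h2 (isRate_rate V G β)).pow t).mono (fun Y ↦ ?_) X) (hn t ht X)
  have : IsGood V G s q η Y → IsGood V G s q' η Y := by
    intro hY i a ha S hS e he
    have h1 := hY i a ha S hS e he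
    have h3 : s * q ^ S.card ≤ s * q' ^ S.card := by
      rcases eq_or_eq_neg_one hs with rfl | rfl
      · have := pow_le_pow_left₀ h0 (by linarith : q ≤ q') S.card
        linarith
      · have := pow_le_pow_left₀ h0' (by linarith : q' ≤ q) S.card
        linarith
    rw [mul_sub] at *
    linarith
  unfold bad
  split_ifs <;> simp_all

/-- If `φ` moves all points beyond `p + s ε` towards `p` by at least `2 κ`, then finitely many
stages of burn-in lead to goodness for `p + s ε`. -/
lemma Reaches.of_gap (hβ : Attractive V G β) {η s p ε κ q₀ : ℝ} (hη : 0 < η) (hs : |s| = 1)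
    (hp0 : 0 ≤ p) (hp1 : p ≤ 1) (hpε : 0 ≤ p + s * ε) (hε : 0 ≤ ε) (hκ : 0 < κ)
    (hηκ : fieldConst V G β * η ≤ κ)
    (hgap : ∀ q, 0 ≤ q → q ≤ 1 → ε ≤ s * (q - p) → 2 * κ ≤ s * (q - phi V G β q))
    (hq0 : 0 ≤ q₀) (hq1 : q₀ ≤ 1) (h : Reaches V G β η s q₀) :
    Reaches V G β η s (p + s * ε) := by
  have hs2 : s * s = 1 := by rw [← abs_mul_abs_self, hs, one_mul]
  have key : ∀ k : ℕ, (∃ q, 0 ≤ q ∧ q ≤ 1 ∧ Reaches V G β η s q ∧ s * (q - p) ≤ ε) ∨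
      ∃ q, 0 ≤ q ∧ q ≤ 1 ∧ Reaches V G β η s q ∧ s * (q - p) ≤ 1 - k * κ := by
    intro k
    induction k with
    | zero =>
      refine Or.inr ⟨q₀, hq0, hq1, h, (le_abs_self _).trans ?_⟩
      rw [abs_mul, hs, one_mul, Nat.cast_zero, zero_mul, sub_zero, abs_le]
      constructor <;> linarith
    | succ k ih =>
      rcases ih with ih | ⟨q, h0, h1, hq, hk⟩
      · exact Or.inl ih
      by_cases hqε : s * (q - p) ≤ ε
      · exact Or.inl ⟨q, h0, h1, hq, hqε⟩
      have hg := hgap q h0 h1 (not_le.1 hqε).le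
      have hφ0 := phi_pos (V := V) (G := G) (β := β) q
      have hφ1 := phi_lt_one (V := V) (G := G) (β := β) q
      have h0' : 0 ≤ q - s * κ := by
        rcases eq_or_eq_neg_one hs with rfl | rfl <;> linarith
      have h1' : q - s * κ ≤ 1 := by
        rcases eq_or_eq_neg_one hs with rfl | rfl <;> linarith
      refine Or.inr ⟨q - s * κ, h0', h1', hq.step hβ hη hs h0' h1' ?_, ?_⟩
      · have : s * (q - s * κ - phi V G β q) = s * (q - phi V G β q) - s * s * κ := by ring
        rw [this, hs2]; linarith
      · have : s * (q - s * κ - p) = s * (q - p) - s * s * κ := by ring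
        rw [this, hs2]; push_cast; linarith
  have fin : ∃ q, 0 ≤ q ∧ q ≤ 1 ∧ Reaches V G β η s q ∧ s * (q - p) ≤ ε := by
    obtain ⟨k, hk⟩ := exists_nat_gt (1 / κ)
    rw [div_lt_iff₀ hκ] at hk
    rcases key k with h | ⟨q, h0, h1, hq, hle⟩
    · exact h
    · exact ⟨q, h0, h1, hq, by linarith⟩
  obtain ⟨q, h0, _, hq, hle⟩ := fin
  refine hq.mono hs h0 hpε ?_
  rw [mul_add, ← mul_assoc, hs2]
  linarith [mul_sub s q p]

/-- A unique fixed point of `φ` attracts from both sides, with a uniform gap away from it. -/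
lemma exists_gap {p : ℝ}
    (hu : ∀ q ∈ Set.Icc (0 : ℝ) 1, phi V G β q = q → q = p) {s ε : ℝ} (hs : |s| = 1)
    (hε : 0 < ε) :
    ∃ κ > 0, ∀ q, 0 ≤ q → q ≤ 1 → ε ≤ s * (q - p) → 2 * κ ≤ s * (q - phi V G β q) := by
  set F : ℝ → ℝ := fun q ↦ s * (q - phi V G β q) with hF
  have hFc : Continuous F := continuous_const.mul (continuous_id.sub continuous_phi)
  have hzero : ∀ q, F q = 0 → phi V G β q = q := by
    intro q hq
    have hs0 : s ≠ 0 := by rintro rfl; simp at hs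
    have := (mul_eq_zero.1 hq).resolve_left hs0
    linarith
  have hpos : ∀ q, 0 ≤ q → q ≤ 1 → ε ≤ s * (q - p) → 0 < F q := by
    intro q h0 h1 hq
    by_contra! hle
    rcases eq_or_eq_neg_one hs with rfl | rfl
    · have h2 : 0 ≤ F 1 := by simp only [hF]; linarith [phi_lt_one (V := V) (G := G) (β := β) 1]
      obtain ⟨z, ⟨hz1, hz2⟩, hz⟩ := intermediate_value_Icc h1 hFc.continuousOn ⟨hle, h2⟩
      have := hu z ⟨h0.trans hz1, hz2⟩ (hzero z hz)
      linarith
    · have h2 : 0 ≤ F 0 := by simp only [hF]; linarith [phi_pos (V := V) (G := G) (β := β) 0]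
      obtain ⟨z, ⟨hz1, hz2⟩, hz⟩ := intermediate_value_Icc' h0 hFc.continuousOn ⟨hle, h2⟩
      have := hu z ⟨hz1, hz2.trans h1⟩ (hzero z hz)
      linarith
  set A : Set ℝ := Set.Icc 0 1 ∩ {q | ε ≤ s * (q - p)} with hA
  have hAc : IsCompact A := isCompact_Icc.inter_right
    (isClosed_le continuous_const (by fun_prop))
  rcases A.eq_empty_or_nonempty with he | hne
  · refine ⟨1, one_pos, fun q h0 h1 hq ↦ ?_⟩
    exact absurd (show q ∈ A from ⟨⟨h0, h1⟩, hq⟩) (by simp [he])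
  · obtain ⟨z, hz, hmin⟩ := hAc.exists_isMinOn hne hFc.continuousOn
    refine ⟨F z / 2, half_pos (hpos z hz.1.1 hz.1.2 hz.2), fun q h0 h1 hq ↦ ?_⟩
    have := hmin (show q ∈ A from ⟨⟨h0, h1⟩, hq⟩)
    simp only [Set.mem_ofPred_eq] at this
    linarith

end FixedPoint

/-! ### Contraction -/

section Contraction
variable {ι : Type*} [Fintype ι] {V : ι → ℕ} {G : (i : ι) → SimpleGraph (Fin (V i))} {β : ι → ℝ}
variable {n : ℕ}

lemma prod_sub_prod_le {α : Type*} [DecidableEq α] (S : Finset α) {x y : α → ℝ}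
    (h0 : ∀ b, 0 ≤ x b) (h : ∀ b, x b ≤ y b) :
    ∏ b ∈ S, y b - ∏ b ∈ S, x b ≤ ∑ b ∈ S, (y b - x b) * ∏ c ∈ S.erase b, y c := by
  induction S using Finset.induction_on with
  | empty => simp
  | insert a S ha ih =>
    rw [Finset.prod_insert ha, Finset.prod_insert ha, Finset.sum_insert ha,
      Finset.erase_insert ha]
    have e1 : ∑ b ∈ S, (y b - x b) * ∏ c ∈ (insert a S).erase b, y c =
        y a * ∑ b ∈ S, (y b - x b) * ∏ c ∈ S.erase b, y c := by
      rw [Finset.mul_sum]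
      refine Finset.sum_congr rfl fun b hb ↦ ?_
      have hab : a ≠ b := fun h ↦ ha (h ▸ hb)
      rw [Finset.erase_insert_of_ne hab, Finset.prod_insert (by simp [ha])]
      ring
    rw [e1]
    have h1 := mul_le_mul_of_nonneg_left ih ((h0 a).trans (h a))
    have h2 : ∏ b ∈ S, x b ≤ ∏ b ∈ S, y b := Finset.prod_le_prod (fun b _ ↦ h0 b) fun b _ ↦ h b
    nlinarith [mul_le_mul_of_nonneg_left h2 (sub_nonneg.2 (h a))]

lemma sum_edges_sum_rootedEmb {v : ℕ} {a : Sym2 (Fin v)} (ha : ¬ a.IsDiag)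
    (F : (Fin v ↪ Fin n) → ℝ) :
    ∑ e ∈ edges n, ∑ f ∈ rootedEmb a e, F f = ∑ f, F f :=
  Finset.sum_fiberwise_of_maps_to (g := fun f : Fin v ↪ Fin n ↦ a.map f)
    (fun f _ ↦ map_mem_edges f ha) F

lemma sum_dens_sub_le {v : ℕ} {a : Sym2 (Fin v)} (ha : ¬ a.IsDiag) {S : Finset (Sym2 (Fin v))}
    (hS : ∀ b ∈ S, ¬ b.IsDiag) {X Y : SimpleGraph (Fin n)} (h : X ≤ Y) {u : ℝ}
    (hu : ∀ b ∈ S, ∀ e ∈ edges n, dens b (S.erase b) Y e ≤ u) :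
    ∑ e ∈ edges n, (dens a S Y e - dens a S X e) ≤ S.card * u * (edgeCount Y - edgeCount X) := by
  set Z : ℝ := 2 * (n : ℝ) ^ (v - 2) with hZ
  have hZ0 : 0 ≤ Z := by positivity
  calc ∑ e ∈ edges n, (dens a S Y e - dens a S X e)
      = (∑ f : Fin v ↪ Fin n, (∏ b ∈ S, ind Y (b.map f) - ∏ b ∈ S, ind X (b.map f))) / Z := by
        rw [← sum_edges_sum_rootedEmb ha, Finset.sum_div]
        refine Finset.sum_congr rfl fun e _ ↦ ?_
        rw [dens, dens, ← sub_div, Finset.sum_sub_distrib]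
    _ ≤ (∑ f : Fin v ↪ Fin n, ∑ b ∈ S, (ind Y (b.map f) - ind X (b.map f)) *
          ∏ c ∈ S.erase b, ind Y (c.map f)) / Z := by
        refine div_le_div_of_nonneg_right (Finset.sum_le_sum fun f _ ↦ ?_) hZ0
        exact prod_sub_prod_le S (x := fun b ↦ ind X (b.map f)) (y := fun b ↦ ind Y (b.map f))
          (fun _ ↦ ind_nonneg _ _) (fun _ ↦ ind_mono h _)
    _ = ∑ b ∈ S, ∑ e ∈ edges n, (ind Y e - ind X e) * dens b (S.erase b) Y e := by
        rw [Finset.sum_comm, Finset.sum_div]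
        refine Finset.sum_congr rfl fun b hb ↦ ?_
        rw [← sum_edges_sum_rootedEmb (hS b hb), Finset.sum_div]
        refine Finset.sum_congr rfl fun e _ ↦ ?_
        rw [dens, mul_div_assoc', Finset.mul_sum]
        congr 1
        refine Finset.sum_congr rfl fun f hf ↦ ?_
        rw [mem_rootedEmb.1 hf]
    _ ≤ ∑ b ∈ S, ∑ e ∈ edges n, (ind Y e - ind X e) * u :=
        Finset.sum_le_sum fun b hb ↦ Finset.sum_le_sum fun e he ↦
          mul_le_mul_of_nonneg_left (hu b hb e he) (sub_nonneg.2 (ind_mono h e))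
    _ = _ := by
        rw [Finset.sum_const, nsmul_eq_mul, ← Finset.sum_mul, Finset.sum_sub_distrib]
        simp only [edgeCount]; ring

/-- The total change of the fields between two comparable graphs, in terms of the number of edges
by which the graphs differ. -/
lemma Attractive.sum_field_sub_le (hβ : Attractive V G β) {X Y : SimpleGraph (Fin n)} (h : X ≤ Y)
    {u : ι → ℝ} (hu : ∀ i, ∀ a ∈ pat (G i), ∀ S ⊆ (pat (G i)).erase a,
      S.card = (pat (G i)).card - 2 → ∀ e ∈ edges n, dens a S Y e ≤ u i) :
    ∑ e ∈ edges n, (field V G β e Y - field V G β e X) ≤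
      (∑ i, 2 * β i * (pat (G i)).card * ((pat (G i)).card - 1 : ℕ) * u i)
        * (edgeCount Y - edgeCount X) := by
  simp only [field, ← Finset.sum_sub_distrib]
  rw [Finset.sum_comm, Finset.sum_mul]
  refine Finset.sum_le_sum fun i _ ↦ ?_
  simp only [← mul_sub, ← Finset.sum_sub_distrib]
  rw [← Finset.mul_sum, Finset.sum_comm]
  have hbd : ∀ a ∈ pat (G i), ∑ e ∈ edges n, (dens a ((pat (G i)).erase a) Y e
      - dens a ((pat (G i)).erase a) X e) ≤
      ((pat (G i)).card - 1 : ℕ) * u i * (edgeCount Y - edgeCount X) := by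
    intro a ha
    rw [← Finset.card_erase_of_mem ha]
    refine sum_dens_sub_le (not_isDiag_of_mem_pat ha)
      (fun b hb ↦ not_isDiag_of_mem_pat (Finset.mem_of_mem_erase hb)) h fun b hb e he ↦ ?_
    refine hu i b (Finset.mem_of_mem_erase hb) _ ?_ ?_ e he
    · exact Finset.erase_subset_erase _ (Finset.erase_subset _ _)
    · rw [Finset.card_erase_of_mem hb, Finset.card_erase_of_mem ha]; omega
  rcases hβ i with h0 | h1
  · calc _ ≤ 2 * β i * ∑ a ∈ pat (G i),
          (((pat (G i)).card - 1 : ℕ) * u i * (edgeCount Y - edgeCount X)) :=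
          mul_le_mul_of_nonneg_left (Finset.sum_le_sum hbd) (by positivity)
      _ = _ := by rw [Finset.sum_const, nsmul_eq_mul]; ring
  · refine le_of_eq ?_
    rw [show (pat (G i)).card - 1 = 0 by omega, Finset.sum_eq_zero fun a ha ↦ ?_]
    · simp
    · refine Finset.sum_eq_zero fun e _ ↦ ?_
      rw [erase_eq_empty_of_card_le_one h1 ha, dens_empty, dens_empty, sub_self]

variable (V G β) in
/-- The derivative of `Ψ`. -/
def dPsi (q : ℝ) : ℝ :=
  ∑ i, 2 * β i * (pat (G i)).card * ((pat (G i)).card - 1 : ℕ) * q ^ ((pat (G i)).card - 2)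

lemma hasDerivAt_Psi (q : ℝ) : HasDerivAt (Psi V G β) (dPsi V G β q) q := by
  unfold Psi dPsi
  refine HasDerivAt.fun_sum fun i _ ↦ ?_
  have := (hasDerivAt_pow ((pat (G i)).card - 1) q).const_mul (2 * β i * ((pat (G i)).card : ℝ))
  rw [← card_pat]
  refine this.congr_deriv ?_
  rw [Nat.sub_sub]; ring

variable (V G β) in
/-- The total influence of an edge on the fields at density one, a bound for the derivative of
`Ψ` on the unit interval. -/
def dPsiConst : ℝ := dPsi V G β 1

lemma Attractive.dPsiConst_nonneg (hβ : Attractive V G β) : 0 ≤ dPsiConst V G β := by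
  refine Finset.sum_nonneg fun i _ ↦ ?_
  rcases hβ i with h0 | h1
  · positivity
  · rw [show (pat (G i)).card - 1 = 0 by omega]; simp

/-- The sum of the update rates. -/
def totalRate (V : ι → ℕ) (G : (i : ι) → SimpleGraph (Fin (V i))) (β : ι → ℝ)
    (X : SimpleGraph (Fin n)) : ℝ := ∑ e ∈ edges n, rate V G β e X

lemma totalRate_nonneg (X : SimpleGraph (Fin n)) : 0 ≤ totalRate V G β X :=
  Finset.sum_nonneg fun e _ ↦ (isRate_rate V G β e X).1

lemma totalRate_le (X : SimpleGraph (Fin n)) : totalRate V G β X ≤ n.choose 2 := by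
  rw [← card_edges]
  simpa [totalRate] using
    Finset.sum_le_sum (s := edges n) fun e _ ↦ (isRate_rate V G β e X).2

lemma Attractive.totalRate_mono (hβ : Attractive V G β) :
    Monotone (totalRate V G β (n := n)) :=
  fun _ _ h ↦ Finset.sum_le_sum fun e _ ↦ hβ.rate_mono e h

/-- A crude bound, valid for all pairs of comparable graphs. -/
lemma Attractive.totalRate_sub_le (hβ : Attractive V G β) (hn : 0 < n)
    {X Y : SimpleGraph (Fin n)} (h : X ≤ Y) :
    totalRate V G β Y - totalRate V G β X ≤ dPsiConst V G β * (edgeCount Y - edgeCount X) := by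
  have h1 := hβ.sum_field_sub_le h (u := fun i ↦ 1 ^ ((pat (G i)).card - 2)) (by
    intro i a ha S _ _ e _
    rw [one_pow]
    exact dens_le_one hn (not_isDiag_of_mem_pat ha) S Y e)
  refine le_trans ?_ h1
  rw [totalRate, totalRate, ← Finset.sum_sub_distrib]
  exact Finset.sum_le_sum fun e _ ↦ sigmoid_sub_le le_rfl (sub_nonneg.2 (hβ.field_mono e h))

/-- Contraction of the total rate between comparable graphs that are good from below and from
above. -/
lemma Attractive.totalRate_sub_le_of_isGood (hβ : Attractive V G β) {q₀ q₁ η κ : ℝ}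
    (hκ : 0 ≤ κ) (hn : IsLarge V η n)
    (hder : ∀ x, Psi V G β q₀ - fieldConst V G β * η ≤ x →
      x ≤ Psi V G β q₁ + fieldConst V G β * η → deriv Real.sigmoid x ≤ κ)
    {X Y : SimpleGraph (Fin n)} (h : X ≤ Y) (hX : IsGood V G (-1) q₀ η X)
    (hY : IsGood V G 1 q₁ η Y) :
    totalRate V G β Y - totalRate V G β X ≤
      κ * (dPsi V G β q₁ + dPsiConst V G β * η) * (edgeCount Y - edgeCount X) := by
  have h1 := hβ.sum_field_sub_le h (u := fun i ↦ q₁ ^ ((pat (G i)).card - 2) + η) (by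
    intro i a ha S hS hc e he
    have := hY i a ha S hS e he
    rw [hc] at this
    linarith)
  have h2 : (∑ i, 2 * β i * (pat (G i)).card * ((pat (G i)).card - 1 : ℕ) *
      (q₁ ^ ((pat (G i)).card - 2) + η)) = dPsi V G β q₁ + dPsiConst V G β * η := by
    simp only [dPsiConst, dPsi, one_pow, mul_one, mul_add, Finset.sum_add_distrib, Finset.sum_mul]
  rw [h2] at h1
  have h3 : ∀ e ∈ edges n, rate V G β e Y - rate V G β e X ≤
      κ * (field V G β e Y - field V G β e X) := by
    intro e he
    have a1 := hX.field_le hβ (by simp) hn he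
    have a2 := hY.field_le hβ (by simp) hn he
    have a3 := hβ.field_mono e h
    refine Convex.image_sub_le_mul_sub_of_deriv_le
      (convex_Icc (field V G β e X) (field V G β e Y)) continuous_sigmoid.continuousOn
      differentiable_sigmoid.differentiableOn (fun x hx ↦ ?_) _ ⟨le_rfl, a3⟩ _ ⟨a3, le_rfl⟩ a3
    have hx' := interior_subset hx
    exact hder x (by linarith [hx'.1]) (by linarith [hx'.2])
  calc _ ≤ ∑ e ∈ edges n, κ * (field V G β e Y - field V G β e X) := by
        rw [totalRate, totalRate, ← Finset.sum_sub_distrib]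
        exact Finset.sum_le_sum h3
    _ ≤ _ := by
        rw [← Finset.mul_sum, mul_assoc]
        exact mul_le_mul_of_nonneg_left h1 hκ

/-- A function that is increasing on a subset of a finite order extends to an increasing function
with the same bounds. -/
lemma exists_monotone_extension {S : Type*} [Fintype S] [PartialOrder S] {F : S → ℝ} {R : S → Prop}
    {B : ℝ} (hB : ∀ X, |F X| ≤ B) (hF : ∀ X Y, X ≤ Y → R X → R Y → F X ≤ F Y) :
    ∃ h : S → ℝ, Monotone h ∧ (∀ X, R X → h X = F X) ∧ ∀ X, |h X| ≤ B := by
  set T : S → Finset ℝ := fun X ↦ insert (-B) ((Finset.univ.filter fun Z ↦ Z ≤ X ∧ R Z).image F)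
    with hT
  have hne : ∀ X, (T X).Nonempty := fun X ↦ Finset.insert_nonempty _ _
  have hmem : ∀ X, ∀ y ∈ T X, y = -B ∨ ∃ Z, (Z ≤ X ∧ R Z) ∧ F Z = y := by
    intro X y hy
    simpa [hT] using hy
  have hB0 : ∀ X : S, -B ≤ B := fun X ↦ by
    have := (abs_nonneg _).trans (hB X); linarith
  refine ⟨fun X ↦ (T X).max' (hne X), ?_, ?_, ?_⟩
  · intro X Y h
    refine Finset.max'_subset _ (Finset.insert_subset_insert _ (Finset.image_subset_image ?_))
    intro Z hZ
    simp only [Finset.mem_filter, Finset.mem_univ, true_and] at *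
    exact ⟨hZ.1.trans h, hZ.2⟩
  · intro X hX
    refine le_antisymm (Finset.max'_le _ _ _ fun y hy ↦ ?_) (Finset.le_max' _ _ ?_)
    · rcases hmem X y hy with rfl | ⟨Z, hZ, rfl⟩
      · exact (abs_le.1 (hB X)).1
      · exact hF Z X hZ.1 hZ.2 hX
    · exact Finset.mem_insert_of_mem (Finset.mem_image_of_mem _ (by simp [hX]))
  · intro X
    refine abs_le.2 ⟨Finset.le_max' _ _ (Finset.mem_insert_self _ _),
      Finset.max'_le _ _ _ fun y hy ↦ ?_⟩
    rcases hmem X y hy with rfl | ⟨Z, _, rfl⟩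
    · exact hB0 X
    · exact (abs_le.1 (hB Z)).2

lemma upd_rate_edgeCount (hn : 2 ≤ n) :
    upd (rate V G β) edgeCount = (1 - (n.choose 2 : ℝ)⁻¹) • edgeCount
      + (n.choose 2 : ℝ)⁻¹ • totalRate V G β (n := n) := by
  ext X
  rw [upd_edgeCount hn]; rfl

variable (V G β) in
/-- The difference of the expected numbers of edges after `t` steps from `Y` and from `X`. -/
def edgeGap (t : ℕ) (X Y : SimpleGraph (Fin n)) : ℝ :=
  (upd (rate V G β) ^ t) edgeCount Y - (upd (rate V G β) ^ t) edgeCount X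

lemma edgeGap_succ (hn : 2 ≤ n) (t : ℕ) (X Y : SimpleGraph (Fin n)) :
    edgeGap V G β (t + 1) X Y = (1 - (n.choose 2 : ℝ)⁻¹) * edgeGap V G β t X Y
      + (n.choose 2 : ℝ)⁻¹ * ((upd (rate V G β) ^ t) (totalRate V G β) Y
        - (upd (rate V G β) ^ t) (totalRate V G β) X) := by
  simp only [edgeGap]
  rw [pow_succ, Module.End.mul_apply, upd_rate_edgeCount hn, map_add,
    map_smul, map_smul]
  simp only [Pi.add_apply, Pi.smul_apply, smul_eq_mul]
  ring

lemma Attractive.upd_pow_mono (hβ : Attractive V G β) {f : SimpleGraph (Fin n) → ℝ}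
    (hf : Monotone f) (t : ℕ) : Monotone ((upd (rate V G β) ^ t) f) :=
  upd_pow_monotone (isRate_rate V G β) (fun e _ ↦ hβ.rate_mono e) hf t

lemma Attractive.edgeGap_nonneg (hβ : Attractive V G β) (t : ℕ) {X Y : SimpleGraph (Fin n)}
    (h : X ≤ Y) : 0 ≤ edgeGap V G β t X Y := sub_nonneg.2 (hβ.upd_pow_mono edgeCount_mono t h)

lemma inv_choose_two_le_one (hn : 2 ≤ n) : (n.choose 2 : ℝ)⁻¹ ≤ 1 :=
  inv_le_one_of_one_le₀ (by exact_mod_cast Nat.choose_pos hn)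

/-- Two copies started from different numbers of edges cannot meet faster than in the independent
dynamics. -/
lemma Attractive.le_edgeGap (hβ : Attractive V G β) (hn : 2 ≤ n) (t : ℕ)
    {X Y : SimpleGraph (Fin n)} (h : X ≤ Y) :
    (1 - (n.choose 2 : ℝ)⁻¹) ^ t * (edgeCount Y - edgeCount X) ≤ edgeGap V G β t X Y := by
  induction t with
  | zero => simp [edgeGap]
  | succ t ih =>
    rw [edgeGap_succ hn, pow_succ]
    have h1 := mul_le_mul_of_nonneg_left ih (sub_nonneg.2 (inv_choose_two_le_one hn))
    have h2 := mul_nonneg (by positivity : (0 : ℝ) ≤ (n.choose 2 : ℝ)⁻¹)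
      (sub_nonneg.2 (hβ.upd_pow_mono hβ.totalRate_mono t h))
    linarith

lemma Attractive.edgeGap_le (hβ : Attractive V G β) (hn : 2 ≤ n) (t : ℕ)
    {X Y : SimpleGraph (Fin n)} (h : X ≤ Y) :
    edgeGap V G β t X Y ≤
      (1 + dPsiConst V G β * (n.choose 2 : ℝ)⁻¹) ^ t * (edgeCount Y - edgeCount X) := by
  have hC := hβ.dPsiConst_nonneg
  have hN : (0 : ℝ) ≤ (n.choose 2 : ℝ)⁻¹ := by positivity
  induction t with
  | zero => simp [edgeGap]
  | succ t ih =>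
    have hm : Monotone (dPsiConst V G β • edgeCount - totalRate V G β (n := n)) := by
      intro Z W hZW
      have := hβ.totalRate_sub_le (by omega : 0 < n) hZW
      simp only [Pi.sub_apply, Pi.smul_apply, smul_eq_mul]
      linarith
    have h1 := hβ.upd_pow_mono hm t h
    simp only [map_sub, map_smul, Pi.sub_apply, Pi.smul_apply, smul_eq_mul] at h1
    have h2 : (upd (rate V G β) ^ t) (totalRate V G β) Y
        - (upd (rate V G β) ^ t) (totalRate V G β) X ≤ dPsiConst V G β * edgeGap V G β t X Y := by
      rw [edgeGap]; linarith
    rw [edgeGap_succ hn, pow_succ]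
    have h3 := mul_le_mul_of_nonneg_left h2 hN
    have h4 := mul_nonneg hN (hβ.edgeGap_nonneg t h)
    have h5 := mul_le_mul_of_nonneg_left ih (by positivity :
      0 ≤ 1 + dPsiConst V G β * (n.choose 2 : ℝ)⁻¹)
    nlinarith

/-- One step of contraction, up to the probability of bad graphs. -/
lemma Attractive.edgeGap_succ_le (hβ : Attractive V G β) (hn : 2 ≤ n) {q₀ q₁ η ρ ε : ℝ}
    (hρ0 : 0 ≤ ρ) (hρ1 : ρ ≤ 1)
    (hgood : ∀ X Y : SimpleGraph (Fin n), X ≤ Y → IsGood V G (-1) q₀ η X → IsGood V G 1 q₁ η Y →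
      totalRate V G β Y - totalRate V G β X ≤ ρ * (edgeCount Y - edgeCount X)) {t : ℕ}
    (h0 : ∀ X : SimpleGraph (Fin n), (upd (rate V G β) ^ t) (bad V G (-1) q₀ η) X ≤ ε)
    (h1 : ∀ X : SimpleGraph (Fin n), (upd (rate V G β) ^ t) (bad V G 1 q₁ η) X ≤ ε)
    {X Y : SimpleGraph (Fin n)} (h : X ≤ Y) :
    edgeGap V G β (t + 1) X Y ≤
      (1 - (1 - ρ) * (n.choose 2 : ℝ)⁻¹) * edgeGap V G β t X Y + 8 * ε := by
  set N : ℝ := ((n.choose 2 : ℕ) : ℝ) with hN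
  have hN0 : 0 < N := choose_two_pos hn
  have hM := (isMarkov_upd hn (isRate_rate V G β)).pow t
  set F : SimpleGraph (Fin n) → ℝ := ρ • edgeCount - totalRate V G β with hF
  have hFB : ∀ Z, |F Z| ≤ N := by
    intro Z
    have a1 := edgeCount_nonneg Z
    have a2 := edgeCount_le Z
    have a3 := totalRate_nonneg (V := V) (G := G) (β := β) Z
    have a4 := totalRate_le (V := V) (G := G) (β := β) Z
    simp only [hF, Pi.sub_apply, Pi.smul_apply, smul_eq_mul]
    rw [abs_le]
    constructor <;> nlinarith
  obtain ⟨k, hkm, hkF, hkB⟩ := exists_monotone_extension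
    (R := fun Z ↦ IsGood V G (-1) q₀ η Z ∧ IsGood V G 1 q₁ η Z) hFB (by
      intro Z W hZW hZ hW
      have := hgood Z W hZW hZ.1 hW.2
      simp only [hF, Pi.sub_apply, Pi.smul_apply, smul_eq_mul]
      linarith)
  have hdiff : ∀ Z, |F Z - k Z| ≤ 2 * N * (bad V G (-1) q₀ η Z + bad V G 1 q₁ η Z) := by
    intro Z
    by_cases hZ : IsGood V G (-1) q₀ η Z ∧ IsGood V G 1 q₁ η Z
    · rw [hkF Z hZ, sub_self, abs_zero]
      have := bad_nonneg (V := V) (G := G) (-1) q₀ η Z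
      have := bad_nonneg (V := V) (G := G) 1 q₁ η Z
      positivity
    · have hb : 1 ≤ bad V G (-1) q₀ η Z + bad V G 1 q₁ η Z := by
        unfold bad
        by_cases h1 : IsGood V G (-1) q₀ η Z <;> by_cases h2 : IsGood V G 1 q₁ η Z <;> simp_all
      have := abs_sub (F Z) (k Z)
      have := hFB Z
      have := hkB Z
      nlinarith
  have hup : ∀ Z, |(upd (rate V G β) ^ t) F Z - (upd (rate V G β) ^ t) k Z| ≤ 4 * N * ε := by
    intro Z
    have b0 : (upd (rate V G β) ^ t) ((2 * N) • (bad V G (-1) q₀ η + bad V G 1 q₁ η)) Z ≤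
        4 * N * ε := by
      rw [map_smul, map_add]
      simp only [Pi.smul_apply, Pi.add_apply, smul_eq_mul]
      nlinarith [h0 Z, h1 Z]
    have b1 := hM.mono (show F - k ≤ (2 * N) • (bad V G (-1) q₀ η + bad V G 1 q₁ η) from
      fun W ↦ (abs_le.1 (hdiff W)).2) Z
    have b2 := hM.mono (show k - F ≤ (2 * N) • (bad V G (-1) q₀ η + bad V G 1 q₁ η) from
      fun W ↦ by
        have := (abs_le.1 (hdiff W)).1
        simp only [Pi.sub_apply, Pi.smul_apply, Pi.add_apply, smul_eq_mul]
        linarith) Z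
    rw [map_sub, Pi.sub_apply] at b1 b2
    rw [abs_le]
    constructor <;> linarith
  have c1 := (abs_le.1 (hup Y)).1
  have c2 := (abs_le.1 (hup X)).2
  have c3 := hβ.upd_pow_mono hkm t h
  have c4 : ∀ Z, (upd (rate V G β) ^ t) F Z = ρ * (upd (rate V G β) ^ t) edgeCount Z
      - (upd (rate V G β) ^ t) (totalRate V G β) Z := by
    intro Z
    rw [hF, map_sub, map_smul]; rfl
  rw [c4] at c1 c2
  have c5 : (upd (rate V G β) ^ t) (totalRate V G β) Y
        - (upd (rate V G β) ^ t) (totalRate V G β) X ≤ ρ * edgeGap V G β t X Y + 8 * N * ε := by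
    rw [edgeGap]; linarith
  rw [edgeGap_succ hn, ← hN]
  have c6 := mul_le_mul_of_nonneg_left c5 (inv_nonneg.2 hN0.le)
  have c7 : N⁻¹ * (8 * N * ε) = 8 * ε := by field_simp
  linarith

end Contraction

/-! ### Upper bound for the mixing time -/

section Upper
variable {ι : Type*} [Fintype ι] {V : ι → ℕ} {G : (i : ι) → SimpleGraph (Fin (V i))} {β : ι → ℝ}
variable {n : ℕ}

/-- In the high temperature phase the burn-in reaches a neighbourhood of the fixed point in which
the total rate is a contraction. -/
lemma Attractive.exists_contraction (hβ : Attractive V G β) (hT : HighTemperature V G β) :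
    ∃ η q₀ q₁ ρ : ℝ, 0 ≤ ρ ∧ ρ < 1 ∧ Reaches V G β η (-1) q₀ ∧ Reaches V G β η 1 q₁ ∧
      ∀ᶠ n in atTop, ∀ X Y : SimpleGraph (Fin n), X ≤ Y → IsGood V G (-1) q₀ η X →
        IsGood V G 1 q₁ η Y →
        totalRate V G β Y - totalRate V G β X ≤ ρ * (edgeCount Y - edgeCount X) := by
  obtain ⟨p, ⟨hp0, hp1⟩, hfix, huniq, hder⟩ := hT
  have hp : 0 < p := hfix ▸ phi_pos p
  set Ψ := Psi V G β p with hΨ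
  set σ' := deriv Real.sigmoid with hσ'
  set D := dPsi V G β p with hD
  have hσc : Continuous σ' := by
    rw [hσ', Real.deriv_sigmoid]
    exact continuous_sigmoid.mul (continuous_const.sub continuous_sigmoid)
  have hσ0 : ∀ x, 0 ≤ σ' x := by
    intro x
    rw [hσ', Real.deriv_sigmoid]
    exact mul_nonneg (Real.sigmoid_nonneg x) (sub_nonneg.2 (Real.sigmoid_le_one x))
  have hD0 : 0 ≤ D := by
    refine Finset.sum_nonneg fun i _ ↦ ?_
    rcases hβ i with h0 | h1
    · positivity
    · rw [show (pat (G i)).card - 1 = 0 by omega]; simp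
  have hlt : σ' Ψ * D < 1 := by
    have h1 : HasDerivAt (phi V G β) (σ' Ψ * D) p := by
      have e : phi V G β = Real.sigmoid ∘ Psi V G β := funext phi_eq_sigmoid
      rw [e]
      exact (differentiable_sigmoid _).hasDerivAt.comp p (hasDerivAt_Psi p)
    rwa [h1.deriv] at hder
  -- `ζ` is the slack in the contraction rate.
  obtain ⟨ζ, hζ, hζ0⟩ : ∃ ζ : ℝ, (σ' Ψ + ζ) * (D + ζ) < 1 ∧ 0 < ζ := by
    have hc : Continuous fun ζ : ℝ ↦ (σ' Ψ + ζ) * (D + ζ) := by fun_prop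
    have h1 : ∀ᶠ ζ : ℝ in nhdsWithin 0 (Set.Ioi 0), (σ' Ψ + ζ) * (D + ζ) < 1 :=
      nhdsWithin_le_nhds (hc.continuousAt.eventually (gt_mem_nhds (by simpa using hlt)))
    exact (h1.and self_mem_nhdsWithin).exists
  obtain ⟨δ, hδ0, hδ⟩ : ∃ δ > 0, ∀ x, |x - Ψ| < δ → σ' x < σ' Ψ + ζ := by
    have h1 := hσc.continuousAt.eventually (gt_mem_nhds (by linarith : σ' Ψ < σ' Ψ + ζ))
    obtain ⟨δ, h0, h⟩ := Metric.eventually_nhds_iff.1 h1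
    exact ⟨δ, h0, fun x hx ↦ h (by rwa [Real.dist_eq])⟩
  have hdc : Continuous (dPsi V G β) := by unfold dPsi; fun_prop
  obtain ⟨ε, ⟨h1, h2, h3, hεp⟩, hε0⟩ : ∃ ε : ℝ, (Psi V G β (p + ε) < Ψ + δ / 2 ∧
      Ψ - δ / 2 < Psi V G β (p - ε) ∧ dPsi V G β (p + ε) < D + ζ / 2 ∧ ε < p) ∧ 0 < ε := by
    have a1 : ∀ᶠ ε : ℝ in nhds 0, Psi V G β (p + ε) < Ψ + δ / 2 :=
      (continuous_Psi.comp (continuous_const.add continuous_id)).continuousAt.eventually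
        (gt_mem_nhds (by simpa [hΨ] using half_pos hδ0))
    have a2 : ∀ᶠ ε : ℝ in nhds 0, Ψ - δ / 2 < Psi V G β (p - ε) :=
      (continuous_Psi.comp (continuous_const.sub continuous_id)).continuousAt.eventually
        (lt_mem_nhds (by simpa [hΨ] using half_pos hδ0))
    have a3 : ∀ᶠ ε : ℝ in nhds 0, dPsi V G β (p + ε) < D + ζ / 2 :=
      (hdc.comp (continuous_const.add continuous_id)).continuousAt.eventually
        (gt_mem_nhds (by simpa [hD] using half_pos hζ0))
    exact (((a1.and (a2.and (a3.and (gt_mem_nhds hp)))).filter_mono nhdsWithin_le_nhds).and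
      (self_mem_nhdsWithin (s := Set.Ioi (0 : ℝ)))).exists
  obtain ⟨κ₁, hκ₁, hgap₁⟩ := exists_gap huniq (s := 1) (by simp) hε0
  obtain ⟨κ₀, hκ₀, hgap₀⟩ := exists_gap huniq (s := -1) (by simp) hε0
  set C := fieldConst V G β with hC
  have hC0 : 0 ≤ C := fieldConst_nonneg V G β
  have hB0 := hβ.dPsiConst_nonneg
  obtain ⟨η, ⟨e1, e2, e3, e4⟩, hη⟩ : ∃ η : ℝ, (C * η < κ₁ ∧ C * η < κ₀ ∧ C * η < δ / 2 ∧
      dPsiConst V G β * η < ζ / 2) ∧ 0 < η := by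
    have a : ∀ c k : ℝ, 0 < k → ∀ᶠ η : ℝ in nhds 0, c * η < k := fun c k hk ↦
      (by fun_prop : Continuous fun η : ℝ ↦ c * η).continuousAt.eventually
        (gt_mem_nhds (by simpa using hk))
    exact ((((a C κ₁ hκ₁).and ((a C κ₀ hκ₀).and ((a C _ (half_pos hδ0)).and
      (a _ _ (half_pos hζ0))))).filter_mono nhdsWithin_le_nhds).and
      (self_mem_nhdsWithin (s := Set.Ioi (0 : ℝ)))).exists
  have r1 : Reaches V G β η 1 (p + ε) := by
    have := Reaches.of_gap hβ (s := 1) hη (by simp) hp0 hp1 (by linarith) hε0.le hκ₁ e1.le hgap₁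
      zero_le_one le_rfl (reaches_one hη)
    rwa [one_mul] at this
  have r0 : Reaches V G β η (-1) (p - ε) := by
    have := Reaches.of_gap hβ (s := -1) hη (by simp) hp0 hp1 (by linarith) hε0.le hκ₀ e2.le hgap₀
      le_rfl zero_le_one (reaches_zero hη)
    rwa [neg_one_mul, ← sub_eq_add_neg] at this
  refine ⟨η, p - ε, p + ε, (σ' Ψ + ζ) * (D + ζ), ?_, hζ, r0, r1, ?_⟩
  · have := hσ0 Ψ
    positivity
  filter_upwards [eventually_isLarge V hη] with n hn X Y h hX hY
  have hκ : 0 ≤ σ' Ψ + ζ := by linarith [hσ0 Ψ]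
  refine (hβ.totalRate_sub_le_of_isGood hκ hn (fun x hx1 hx2 ↦ (hδ x ?_).le) h hX hY).trans ?_
  · rw [abs_lt]; constructor <;> linarith
  · refine mul_le_mul_of_nonneg_right ?_ (sub_nonneg.2 (edgeCount_mono h))
    exact mul_le_mul_of_nonneg_left (by linarith) hκ

/-- The gap in the expected edge counts controls all bounded observables. -/
lemma Attractive.upd_pow_sub_le_edgeGap (hβ : Attractive V G β) {f : SimpleGraph (Fin n) → ℝ}
    (hf : ∀ X, |f X| ≤ 1) (t : ℕ) {X Y : SimpleGraph (Fin n)} (h : X ≤ Y) :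
    (upd (rate V G β) ^ t) f X - (upd (rate V G β) ^ t) f Y ≤ 2 * edgeGap V G β t X Y := by
  have hm : Monotone ((2 : ℝ) • edgeCount + f) := by
    intro Z W hZW
    rcases hZW.eq_or_lt with rfl | hlt
    · exact le_rfl
    · have h1 := edgeCount_add_one_le hlt
      have h2 := (abs_le.1 (hf Z)).2
      have h3 := (abs_le.1 (hf W)).1
      simp only [Pi.add_apply, Pi.smul_apply, smul_eq_mul]
      linarith
  have := hβ.upd_pow_mono hm t h
  rw [map_add, map_smul] at this
  simp only [Pi.add_apply, Pi.smul_apply, smul_eq_mul] at this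
  rw [edgeGap]; linarith

/-- Mixing from a uniform bound for the gap to the complete graph. -/
lemma Attractive.tvDist_le_of_edgeGap (hβ : Attractive V G β) (hn : 2 ≤ n) {t : ℕ} {δ : ℝ}
    (h : ∀ X : SimpleGraph (Fin n), edgeGap V G β t X ⊤ ≤ δ) (X : SimpleGraph (Fin n)) :
    tvDist ((glauber V G β n ^ t) X) (gibbs V G β) ≤ 2 * δ := by
  have := tvDist_le V G β hn (t := t) (δ := 4 * δ) (fun f hf X Y ↦ ?_) X
  · linarith
  · have h1 := hβ.upd_pow_sub_le_edgeGap hf t (le_top : X ≤ ⊤)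
    have h2 := hβ.upd_pow_sub_le_edgeGap (f := -f) (fun Z ↦ by simpa using hf Z) t
      (le_top : Y ≤ ⊤)
    rw [map_neg] at h2
    simp only [Pi.neg_apply] at h2
    linarith [h X, h Y]

lemma Attractive.edgeGap_add_le (hβ : Attractive V G β) (hn : 2 ≤ n) {q₀ q₁ η ρ ε : ℝ}
    (hρ0 : 0 ≤ ρ) (hρ1 : ρ ≤ 1) (hε : 0 ≤ ε)
    (hgood : ∀ X Y : SimpleGraph (Fin n), X ≤ Y → IsGood V G (-1) q₀ η X → IsGood V G 1 q₁ η Y →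
      totalRate V G β Y - totalRate V G β X ≤ ρ * (edgeCount Y - edgeCount X)) {T : ℕ}
    (h0 : ∀ t, T ≤ t → ∀ X : SimpleGraph (Fin n),
      (upd (rate V G β) ^ t) (bad V G (-1) q₀ η) X ≤ ε)
    (h1 : ∀ t, T ≤ t → ∀ X : SimpleGraph (Fin n),
      (upd (rate V G β) ^ t) (bad V G 1 q₁ η) X ≤ ε)
    {X Y : SimpleGraph (Fin n)} (h : X ≤ Y) (u : ℕ) :
    edgeGap V G β (T + u) X Y ≤
      (1 - (1 - ρ) * (n.choose 2 : ℝ)⁻¹) ^ u * n.choose 2 + u * (8 * ε) := by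
  induction u with
  | zero =>
    have hM := (isMarkov_upd hn (isRate_rate V G β)).pow T
    have a1 := hM.le_const edgeCount_le Y
    have a2 := hM.const_le edgeCount_nonneg X
    simp only [edgeGap, add_zero, pow_zero, one_mul, Nat.cast_zero, zero_mul]
    linarith
  | succ u ih =>
    have := hβ.edgeGap_succ_le hn hρ0 hρ1 hgood (h0 (T + u) (by omega)) (h1 (T + u) (by omega)) h
    rw [← add_assoc, pow_succ]
    refine this.trans ?_
    have hN := inv_choose_two_le_one hn
    have hN0 : (0 : ℝ) ≤ (n.choose 2 : ℝ)⁻¹ := by positivity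
    have hr0 : 0 ≤ 1 - (1 - ρ) * (n.choose 2 : ℝ)⁻¹ := by nlinarith
    have hr1 : 1 - (1 - ρ) * (n.choose 2 : ℝ)⁻¹ ≤ 1 := by nlinarith
    have h2 := mul_le_mul_of_nonneg_left ih hr0
    have h3 : 0 ≤ (u : ℝ) * (8 * ε) := by positivity
    have h4 := mul_le_mul_of_nonneg_right hr1 h3
    push_cast
    nlinarith

lemma exp_neg_one_gt : (1 : ℝ) / 3 < Real.exp (-1) := by
  rw [Real.exp_neg, one_div]
  exact inv_strictAnti₀ (Real.exp_pos _) (by linarith [Real.exp_one_lt_d9])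

lemma exp_neg_one_lt : Real.exp (-1) < 2 / 5 := by
  rw [Real.exp_neg]
  refine (inv_strictAnti₀ (by norm_num) (by linarith [Real.exp_one_gt_d9] :
    (5 / 2 : ℝ) < Real.exp 1)).trans_eq (by norm_num)

/-- Rapid mixing at high temperature. -/
lemma Attractive.exists_tvDist_le (hβ : Attractive V G β) (hT : HighTemperature V G β) :
    ∃ C : ℝ, ∀ᶠ n : ℕ in atTop, ∃ t : ℕ, (t : ℝ) ≤ C * (n ^ 2 * Real.log n) ∧
      ∀ X : SimpleGraph (Fin n),
        tvDist ((glauber V G β n ^ t) X) (gibbs V G β) ≤ Real.exp (-1) := by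
  obtain ⟨η, q₀, q₁, ρ, hρ0, hρ1, ⟨K₀, hK₀⟩, ⟨K₁, hK₁⟩, hgood⟩ := hβ.exists_contraction hT
  set c := 1 - ρ with hc
  have hc0 : 0 < c := sub_pos.2 hρ1
  set A : ℝ := 2 / c with hA
  have hA0 : 0 < A := by positivity
  refine ⟨(K₀ + K₁ : ℕ) + A + 1, ?_⟩
  filter_upwards [hK₀ 6, hK₁ 6, hgood, eventually_ge_atTop 8,
    eventually_ge_atTop (⌈A⌉₊ + 1)] with n a0 a1 hg hn8 hnA
  have hn : 2 ≤ n := by omega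
  have hn8R : (8 : ℝ) ≤ n := by exact_mod_cast hn8
  have hnR : (0 : ℝ) < n := by linarith
  have hlog1 : 1 ≤ Real.log n := by
    rw [Real.le_log_iff_exp_le hnR]
    linarith [Real.exp_one_lt_d9]
  have hlogn : Real.log n ≤ n := by linarith [Real.log_le_sub_one_of_pos hnR]
  have hAn : A + 1 ≤ n := by
    have : ((⌈A⌉₊ + 1 : ℕ) : ℝ) ≤ n := by exact_mod_cast hnA
    push_cast at this
    linarith [Nat.le_ceil A]
  set u := ⌈A * (n ^ 2 * Real.log n)⌉₊ with hu
  have hul : A * (n ^ 2 * Real.log n) ≤ u := Nat.le_ceil _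
  have huu : (u : ℝ) < A * (n ^ 2 * Real.log n) + 1 := Nat.ceil_lt_add_one (by positivity)
  have hn2 : (1 : ℝ) ≤ n ^ 2 := by nlinarith
  refine ⟨(K₀ + K₁) * n ^ 2 + u, ?_, fun X ↦ ?_⟩
  · push_cast
    have h1 : (n : ℝ) ^ 2 ≤ n ^ 2 * Real.log n := le_mul_of_one_le_right (by positivity) hlog1
    have h2 : ((K₀ : ℝ) + K₁) * n ^ 2 ≤ (K₀ + K₁) * (n ^ 2 * Real.log n) :=
      mul_le_mul_of_nonneg_left h1 (by positivity)
    linarith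
  · refine (hβ.tvDist_le_of_edgeGap hn (δ := 9 / n ^ 2) (fun Z ↦ ?_) X).trans ?_
    · refine (hβ.edgeGap_add_le hn hρ0 hρ1.le (ε := ((n : ℝ) ^ 6)⁻¹) (by positivity) hg
        (fun t ht ↦ a0 t ?_) (fun t ht ↦ a1 t ?_) le_top u).trans ?_
      · exact (Nat.mul_le_mul_right _ (Nat.le_add_right _ _)).trans ht
      · exact (Nat.mul_le_mul_right _ (Nat.le_add_left _ _)).trans ht
      · have b1 : (1 - c * (n.choose 2 : ℝ)⁻¹) ^ u ≤ ((n : ℝ) ^ 4)⁻¹ := by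
          refine (one_sub_inv_pow_le hn hc0.le (by linarith) u).trans ?_
          have : ((n : ℝ) ^ 4)⁻¹ = Real.exp (-(4 * Real.log n)) := by
            rw [Real.exp_neg, ← Real.exp_log (pow_pos hnR 4), Real.log_pow]; norm_num
          rw [this]
          refine Real.exp_le_exp.2 (neg_le_neg ?_)
          rw [le_div_iff₀ (by positivity)]
          have h3 : 2 * c * (A * (n ^ 2 * Real.log n)) = 4 * Real.log n * n ^ 2 := by
            rw [hA]; field_simp; ring
          rw [← h3]
          exact mul_le_mul_of_nonneg_left hul (by positivity)
        have b2 := choose_two_le n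
        have b3 : (u : ℝ) ≤ n ^ 4 := by
          have h4 : A * (n ^ 2 * Real.log n) ≤ A * (n ^ 2 * n) := by gcongr
          have h5 : (A + 1) * (n : ℝ) ^ 3 ≤ n * n ^ 3 := by gcongr
          have h6 : (1 : ℝ) ≤ n ^ 3 := one_le_pow₀ (by linarith)
          nlinarith
        have c1 : (1 - c * (n.choose 2 : ℝ)⁻¹) ^ u * n.choose 2 ≤ 1 / n ^ 2 := by
          refine (mul_le_mul b1 b2 (by positivity) (by positivity)).trans ?_
          rw [inv_mul_eq_div, div_le_div_iff₀ (by positivity) (by positivity)]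
          have : (0 : ℝ) ≤ (n : ℝ) ^ 4 := by positivity
          nlinarith
        have c2 : (u : ℝ) * (8 * ((n : ℝ) ^ 6)⁻¹) ≤ 8 / n ^ 2 := by
          refine (mul_le_mul_of_nonneg_right b3 (by positivity)).trans_eq ?_
          field_simp
        refine (add_le_add c1 c2).trans_eq ?_
        ring
    · refine le_trans ?_ exp_neg_one_gt.le
      rw [mul_div_assoc', div_le_div_iff₀ (by positivity) (by norm_num)]
      nlinarith

end Upper

/-! ### Lower bound for the mixing time -/

section Lower
variable {ι : Type*} [Fintype ι] {V : ι → ℕ} {G : (i : ι) → SimpleGraph (Fin (V i))} {β : ι → ℝ}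
variable {n : ℕ}

lemma Attractive.edgeLip_upd_pow_edgeCount (hβ : Attractive V G β) (hn : 2 ≤ n) (t : ℕ) :
    EdgeLip (fun _ ↦ (1 + dPsiConst V G β * (n.choose 2 : ℝ)⁻¹) ^ t)
      ((upd (rate V G β) ^ t) (edgeCount (n := n))) := by
  intro X e he
  have h1 := hβ.edgeGap_le hn t (removeEdge_le_addEdge X e)
  have h2 := hβ.edgeGap_nonneg t (removeEdge_le_addEdge X e)
  rw [edgeCount_addEdge X he, edgeCount_removeEdge X he,
    show edgeCount X + (1 - ind X e) - (edgeCount X - ind X e) = 1 by ring, mul_one] at h1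
  rw [edgeGap] at h1 h2
  rwa [abs_of_nonneg h2]

/-- The variance of the number of edges after `t` steps. -/
lemma Attractive.edgeCount_variance_le (hβ : Attractive V G β) (hn : 2 ≤ n) (t : ℕ)
    (X : SimpleGraph (Fin n)) :
    (upd (rate V G β) ^ t) (fun Y ↦ (edgeCount Y - (upd (rate V G β) ^ t) edgeCount X) ^ 2) X ≤
      t * Real.exp (2 * dPsiConst V G β * (n.choose 2 : ℝ)⁻¹ * t) := by
  have hM := (isMarkov_upd hn (isRate_rate V G β)).pow t
  have hC := hβ.dPsiConst_nonneg
  set m := (upd (rate V G β) ^ t) edgeCount X with hm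
  have e1 : (fun Y : SimpleGraph (Fin n) ↦ (edgeCount Y - m) ^ 2) =
      (fun Y ↦ edgeCount Y ^ 2) - (2 * m) • edgeCount + fun _ ↦ m ^ 2 := by
    ext Y; simp; ring
  rw [e1, map_add, map_sub, map_smul, hM.const]
  have h1 := upd_pow_sq_le hn (isRate_rate V G β) t (hβ.edgeLip_upd_pow_edgeCount hn) X
  simp only [Pi.add_apply, Pi.sub_apply, Pi.smul_apply, smul_eq_mul, ← hm] at h1 ⊢
  have h2 : ∑ s ∈ Finset.range t, ((1 + dPsiConst V G β * (n.choose 2 : ℝ)⁻¹) ^ s) ^ 2 ≤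
      t * Real.exp (2 * dPsiConst V G β * (n.choose 2 : ℝ)⁻¹ * t) := by
    rw [← nsmul_eq_mul]
    refine (Finset.sum_le_card_nsmul _ _
      (Real.exp (2 * dPsiConst V G β * (n.choose 2 : ℝ)⁻¹ * t)) fun s hs ↦ ?_).trans_eq (by simp)
    have hx : 0 ≤ dPsiConst V G β * (n.choose 2 : ℝ)⁻¹ := by positivity
    calc ((1 + dPsiConst V G β * (n.choose 2 : ℝ)⁻¹) ^ s) ^ 2
        ≤ (Real.exp (dPsiConst V G β * (n.choose 2 : ℝ)⁻¹) ^ s) ^ 2 := by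
          gcongr
          linarith [Real.add_one_le_exp (dPsiConst V G β * (n.choose 2 : ℝ)⁻¹)]
      _ = Real.exp (2 * (dPsiConst V G β * (n.choose 2 : ℝ)⁻¹) * s) := by
          rw [← pow_mul, ← Real.exp_nat_mul]
          congr 1; push_cast; ring
      _ ≤ _ := by
          refine Real.exp_le_exp.2 ?_
          have : (s : ℝ) ≤ t := by exact_mod_cast (Finset.mem_range.1 hs).le
          rw [← mul_assoc]
          gcongr
  linarith

/-- Two probability measures whose means of an observable `g` are far apart compared with its
standard deviations are told apart by a threshold event. -/
lemma IsMarkov.exists_separating {S : Type*} {L : Module.End ℝ (S → ℝ)} (hL : IsMarkov L)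
    {g : S → ℝ} {x y : S} {W Δ : ℝ} (hΔ : 0 < Δ) (hgap : Δ ≤ L g y - L g x)
    (hx : L (fun z ↦ (g z - L g x) ^ 2) x ≤ W) (hy : L (fun z ↦ (g z - L g y) ^ 2) y ≤ W) :
    ∃ f : S → ℝ, (∀ z, 0 ≤ f z) ∧ (∀ z, f z ≤ 1) ∧ 1 - 8 * W / Δ ^ 2 ≤ L f y - L f x := by
  set b := L g x + Δ / 2 with hb
  set f : S → ℝ := fun z ↦ if b < g z then 1 else 0 with hf
  have h1 : f ≤ (4 / Δ ^ 2) • fun z ↦ (g z - L g x) ^ 2 := by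
    intro z
    simp only [hf, Pi.smul_apply, smul_eq_mul]
    split_ifs with h
    · rw [div_mul_eq_mul_div, le_div_iff₀ (by positivity)]
      nlinarith
    · positivity
  have h2 : (fun _ ↦ 1) - f ≤ (4 / Δ ^ 2) • fun z ↦ (g z - L g y) ^ 2 := by
    intro z
    simp only [hf, Pi.smul_apply, smul_eq_mul, Pi.sub_apply]
    split_ifs with h
    · rw [sub_self]; positivity
    · rw [div_mul_eq_mul_div, le_div_iff₀ (by positivity)]
      nlinarith
  have k1 := hL.mono h1 x
  have k2 := hL.mono h2 y
  rw [map_smul] at k1 k2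
  rw [map_sub, hL.const] at k2
  simp only [Pi.smul_apply, smul_eq_mul, Pi.sub_apply] at k1 k2
  refine ⟨f, fun z ↦ ?_, fun z ↦ ?_, ?_⟩
  · simp only [hf]; split_ifs <;> norm_num
  · simp only [hf]; split_ifs <;> norm_num
  · have h3 : 4 / Δ ^ 2 * L (fun z ↦ (g z - L g x) ^ 2) x ≤ 4 / Δ ^ 2 * W := by gcongr
    have h4 : 4 / Δ ^ 2 * L (fun z ↦ (g z - L g y) ^ 2) y ≤ 4 / Δ ^ 2 * W := by gcongr
    have h5 : 8 * W / Δ ^ 2 = 4 / Δ ^ 2 * W + 4 / Δ ^ 2 * W := by ring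
    linarith

lemma exp_neg_two_mul_le {x : ℝ} (h0 : 0 ≤ x) (h1 : x ≤ 1 / 2) : Real.exp (-(2 * x)) ≤ 1 - x := by
  have h2 : 1 + 2 * x ≤ Real.exp (2 * x) := by linarith [Real.add_one_le_exp (2 * x)]
  rw [Real.exp_neg]
  refine (inv_anti₀ (by linarith) h2).trans ?_
  rw [inv_le_iff_one_le_mul₀ (by linarith)]
  nlinarith

/-- Mixing takes at least order `n ^ 2 * log n` steps: until then the numbers of edges started from
the empty and the complete graph stay separated. -/
lemma Attractive.exists_le_of_tvDist_le (hβ : Attractive V G β) :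
    ∃ c > 0, ∀ᶠ n : ℕ in atTop, ∀ t : ℕ, (∀ X : SimpleGraph (Fin n),
      tvDist ((glauber V G β n ^ t) X) (gibbs V G β) ≤ Real.exp (-1)) →
      c * (n ^ 2 * Real.log n) ≤ t := by
  set B := dPsiConst V G β with hB
  have hB0 : 0 ≤ B := hβ.dPsiConst_nonneg
  -- With this constant the gap squared exceeds the variance by a factor `n ^ (1 / 2)`.
  set c : ℝ := 1 / (16 * B + 32) with hc
  have hc0 : 0 < c := by positivity
  have hc1 : c ≤ 1 := by
    rw [hc, div_le_one (by positivity)]; linarith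
  have hcB : 8 * B * c + 16 * c = 1 / 2 := by rw [hc]; field_simp; ring
  refine ⟨c, hc0, ?_⟩
  have hlarge : ∀ᶠ n : ℕ in atTop, (700 : ℝ) < Real.exp (1 / 2 * Real.log n) :=
    (Real.tendsto_exp_atTop.comp ((Real.tendsto_log_atTop.comp
      tendsto_natCast_atTop_atTop).const_mul_atTop (by norm_num))).eventually_gt_atTop _
  filter_upwards [hlarge, eventually_ge_atTop 3] with n hn700 hn3 t ht
  by_contra! hlt
  have hn : 2 ≤ n := by omega
  have hn3R : (3 : ℝ) ≤ n := by exact_mod_cast hn3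
  have hnR : (0 : ℝ) < n := by linarith
  have hM := (isMarkov_upd hn (isRate_rate V G β)).pow t
  set ℓ := Real.log n with hℓ
  have hℓ0 : 0 < ℓ := Real.log_pos (by linarith)
  have hℓn : ℓ ≤ n := by linarith [Real.log_le_sub_one_of_pos hnR]
  set N : ℝ := ((n.choose 2 : ℕ) : ℝ) with hN
  have hN4 : (n : ℝ) ^ 2 / 4 ≤ N := le_choose_two hn
  have hN0 : 0 < N := choose_two_pos hn
  have hN2 : N⁻¹ ≤ 1 / 2 := by
    rw [one_div]
    refine inv_anti₀ two_pos ?_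
    nlinarith
  have htN : N⁻¹ * t ≤ 4 * c * ℓ := by
    rw [inv_mul_le_iff₀ hN0]
    have := mul_le_mul_of_nonneg_right hN4 (by positivity : 0 ≤ 4 * c * ℓ)
    nlinarith
  set W : ℝ := t * Real.exp (2 * B * N⁻¹ * t) with hW
  set Δ : ℝ := Real.exp (-(8 * c * ℓ)) * N with hΔ
  have hΔ0 : 0 < Δ := by positivity
  have hgap : Δ ≤ (upd (rate V G β) ^ t) edgeCount (⊤ : SimpleGraph (Fin n))
      - (upd (rate V G β) ^ t) edgeCount (⊥ : SimpleGraph (Fin n)) := by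
    have h1 := hβ.le_edgeGap hn t (bot_le : (⊥ : SimpleGraph (Fin n)) ≤ ⊤)
    rw [edgeCount_top, edgeCount_bot, sub_zero] at h1
    refine le_trans ?_ h1
    refine mul_le_mul_of_nonneg_right ?_ hN0.le
    calc Real.exp (-(8 * c * ℓ)) ≤ Real.exp (-(2 * N⁻¹)) ^ t := by
          rw [← Real.exp_nat_mul]
          exact Real.exp_le_exp.2 (by linarith)
      _ ≤ _ := pow_le_pow_left₀ (Real.exp_pos _).le
          (exp_neg_two_mul_le (inv_nonneg.2 hN0.le) hN2) t
  obtain ⟨f, hf0, hf1, hf⟩ := hM.exists_separating hΔ0 hgap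
    (hβ.edgeCount_variance_le hn t ⊥) (hβ.edgeCount_variance_le hn t ⊤)
  have h2 := upd_pow_sub_le_of_tvDist V G β hn ht hf0 hf1 ⊤ ⊥
  have h3 := exp_neg_one_lt
  have h4 : 8 * W / Δ ^ 2 < 1 / 5 := by
    rw [div_lt_iff₀ (by positivity)]
    have w1 : W ≤ n ^ 3 * Real.exp (8 * B * c * ℓ) := by
      refine mul_le_mul ?_ (Real.exp_le_exp.2 ?_) (Real.exp_pos _).le (by positivity)
      · refine hlt.le.trans ?_
        calc c * (n ^ 2 * ℓ) ≤ 1 * ((n : ℝ) ^ 2 * n) := by gcongr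
          _ = (n : ℝ) ^ 3 := by ring
      · nlinarith [mul_le_mul_of_nonneg_left htN (by positivity : 0 ≤ 2 * B)]
    have d1 : Real.exp (-(16 * c * ℓ)) * (n ^ 4 / 16) ≤ Δ ^ 2 := by
      rw [hΔ, mul_pow, ← Real.exp_nat_mul]
      have : (n : ℝ) ^ 4 / 16 ≤ N ^ 2 := by
        calc (n : ℝ) ^ 4 / 16 = (n ^ 2 / 4) ^ 2 := by ring
          _ ≤ N ^ 2 := by gcongr
      refine mul_le_mul (Real.exp_le_exp.2 (by push_cast; linarith)) this (by positivity)
        (Real.exp_pos _).le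
    have e1 : Real.exp (8 * B * c * ℓ) =
        Real.exp (-(16 * c * ℓ)) * Real.exp (1 / 2 * ℓ) := by
      rw [← Real.exp_add]
      congr 1
      rw [← hcB]; ring
    have e2 : (n : ℝ) = Real.exp (1 / 2 * ℓ) * Real.exp (1 / 2 * ℓ) := by
      rw [← Real.exp_add, show 1 / 2 * ℓ + 1 / 2 * ℓ = ℓ by ring, hℓ, Real.exp_log hnR]
    set E := Real.exp (1 / 2 * ℓ) with hE
    have hE0 : 0 < E := Real.exp_pos _
    set J := Real.exp (-(16 * c * ℓ)) with hJ
    have hJ0 : 0 < J := Real.exp_pos _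
    calc 8 * W ≤ 8 * (n ^ 3 * (J * E)) := by rw [← e1]; linarith
      _ = (8 * (J * n ^ 3)) * E := by ring
      _ < (8 * (J * n ^ 3)) * (E * E / 640) := by
          refine mul_lt_mul_of_pos_left ?_ (by positivity)
          rw [lt_div_iff₀ (by norm_num)]
          nlinarith
      _ = 1 / 5 * (J * (n ^ 4 / 16)) := by rw [← e2]; ring
      _ ≤ 1 / 5 * Δ ^ 2 := by linarith
  linarith

end Lower

lemma mixingTime_le {S : Type*} [Fintype S] {P : Matrix S S ℝ} {π : S → ℝ} {t : ℕ}
    (h : ∀ x, tvDist ((P ^ t) x) π ≤ Real.exp (-1)) : mixingTime P π ≤ t := by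
  unfold mixingTime
  exact Nat.sInf_le h

/-- The mixing time is attained once the chain mixes at all; otherwise the infimum of the empty set
would be the junk value zero. -/
lemma tvDist_mixingTime_le {S : Type*} [Fintype S] {P : Matrix S S ℝ} {π : S → ℝ} {t : ℕ}
    (h : ∀ x, tvDist ((P ^ t) x) π ≤ Real.exp (-1)) (x : S) :
    tvDist ((P ^ mixingTime P π) x) π ≤ Real.exp (-1) := by
  have hne : {t : ℕ | ∀ x : S, tvDist ((P ^ t) x) π ≤ Real.exp (-1)}.Nonempty := ⟨t, h⟩
  unfold mixingTime
  exact Nat.sInf_mem hne x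

/-- The hypotheses on the coefficients make the dynamics attractive: a negative coefficient is
allowed only at the single edge. -/
lemma attractive_of_nonneg {s : ℕ} {V : Fin (s + 1) → ℕ}
    {G : (i : Fin (s + 1)) → SimpleGraph (Fin (V i))} (hV : V 0 = 2) {β : Fin (s + 1) → ℝ}
    (hβ : ∀ i, i ≠ 0 → 0 ≤ β i) : Attractive V G β := by
  intro i
  by_cases hi : i = 0
  · subst hi
    refine Or.inr ?_
    have h1 : (pat (G 0)).card ≤ (edges (V 0)).card :=
      Finset.card_le_card fun a ha ↦ mem_edges.2 (not_isDiag_of_mem_pat ha)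
    have h2 : (V 0).choose 2 = 1 := by rw [hV]; rfl
    rw [card_edges] at h1
    omega
  · exact Or.inl (hβ i hi)

end

end ERGM

theorem theorem1 (s : ℕ) (V : Fin (s + 1) → ℕ) (G : (i : Fin (s + 1)) → SimpleGraph (Fin (V i)))
    (hV : V 0 = 2) (hG : G 0 = ⊤)
    (β : Fin (s + 1) → ℝ) (hβ : ∀ i, i ≠ 0 → 0 ≤ β i)
    (hHigh : ERGM.HighTemperature V G β) :
    (fun n : ℕ ↦ (ERGM.mixingTime (ERGM.glauber V G β n) (ERGM.gibbs V G β) : ℝ))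
      =Θ[atTop] fun n : ℕ ↦ (n : ℝ) ^ 2 * Real.log n := by
  have hA : ERGM.Attractive V G β := ERGM.attractive_of_nonneg hV hβ
  obtain ⟨C, hC⟩ := hA.exists_tvDist_le hHigh
  obtain ⟨c, hc0, hc⟩ := hA.exists_le_of_tvDist_le
  refine ⟨IsBigO.of_bound C ?_, IsBigO.of_bound c⁻¹ ?_⟩
  · filter_upwards [hC, eventually_ge_atTop 1] with n hn hn1
    obtain ⟨t, ht, hmix⟩ := hn
    have hlog : 0 ≤ Real.log n := Real.log_natCast_nonneg n
    rw [Real.norm_of_nonneg (by positivity), Real.norm_of_nonneg (by positivity)]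
    refine le_trans ?_ ht
    exact_mod_cast ERGM.mixingTime_le hmix
  · filter_upwards [hC, hc] with n hn hlow
    obtain ⟨t, _, hmix⟩ := hn
    have hlog : 0 ≤ Real.log n := Real.log_natCast_nonneg n
    rw [Real.norm_of_nonneg (by positivity), Real.norm_of_nonneg (by positivity),
      inv_mul_eq_div, le_div_iff₀ hc0, mul_comm]
    exact hlow _ (ERGM.tvDist_mixingTime_le hmix)
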